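/- Let $k$ be a field and let $A$ be a finite dimensional elementary $k$-algebra of finite global dimension (elementary means that $A/\operatorname{rad}A$ is isomorphic, as a $k$-algebra, to a product of finitely many copies of $k$). Let $\{e_1,\dots,e_n\}$ be a complete set of orthogonal primitive idempotents of $A$, and let $C_A=(c_{ij})\in\mathbb Z^{n\times n}$, $c_{ij}=\dim_k e_jAe_i$, be the Cartan matrix of $A$. For a bounded complex $M$ of finite dimensional right $A$-modules let $\underline{\dim}\,M\in\mathbb Z^n$ be the column vector with entries $\sum_{l}(-1)^l\dim_k M^le_i$; for a bounded complex $N$ of finite dimensional left $A$-modules let $\underline{\dim}\,N$ be the row vector with entries $\sum_l(-1)^l\dim_k e_iN^l$; for a bounded complex $M$ of finite dimensional $A$-bimodules (on which $k$ acts centrally) let $\underline{\underline{\dim}}\,M\in\mathbb Z^{n\times n}$ be the matrix with $(i,j)$ entry $\sum_l(-1)^l\dim_k e_jM^le_i$. Let $A^e=A^{op}\otimes_kA$. Then $C_A$ is invertible over $\mathbb Z$, and, with $\operatorname{Ext}^l_A(M,N)=H^l(\mathrm{RHom}_A(M,N))$ and $\operatorname{Tor}^A_l(M,N)=H_l(M\otimes^L_AN)=H^{-l}(M\otimes^L_AN)$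 denoting the hyper-Ext and hyper-Tor of complexes, all vector spaces below are finite dimensional, only finitely many of them in each sum are nonzero, and the following hold. (1) For all bounded complexes $M$ and $N$ of finite dimensional right $A$-modules, $$\sum_{l\in\mathbb Z}(-1)^l\dim_k\operatorname{Ext}^l_A(M,N)=(\underline{\dim}\,M)^T\,C_A^{-T}\,\underline{\dim}\,N .$$ (2) For every bounded complex $M$ of finite dimensional right $A$-modules and every bounded complex $N$ of finite dimensional left $A$-modules, $$\sum_{l\in\mathbb Z}(-1)^l\dim_k\operatorname{Tor}^A_l(M,N)=\underline{\dim}\,N\; C_A^{-1}\,\underline{\dim}\,M .$$ (3) For every bounded complex $M$ of finite dimensional $A$-bimodules, with $HH^l(A,M)=\operatorname{Ext}^l_{A^e}(A,M)$, $$\sum_{l\in\mathbb Z}(-1)^l\dim_kHH^l(A,M)=\operatorname{tr}\big(C_A^{-T}\,\underline{\underline{\dim}}\,M\big).$$ (4) For every bounded complex $M$ of finite dimensional $A$-bimodules, with $HH_l(A,M)=\operatorname{Tor}_l^{A^e}(A,M)$, $$\sum_{l\in\mathbb Z}(-1)^l\dim_kHH_l(A,M)=\operatorname{tr}\big(C_A^{-1}\,\underline{\underline{\dim}}\,M\big).$$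 -/

import Mathlib

open CategoryTheory MulOpposite
open scoped TensorProduct Matrix

universe u

namespace HRR

/-! ### Finite dimensional elementary algebras -/

section Algebras

variable (k : Type u) [Field k] (A : Type u) [Ring A] [Algebra k A]

/-- `A` is a finite dimensional elementary `k`-algebra: `A / rad A` is isomorphic, as a `k`-algebra,
to the product of finitely many copies of `k`. -/
def IsElementary : Prop :=
  Module.Finite k A ∧ ∃ m : ℕ, Nonempty ((A ⧸ Ring.jacobson A) ≃ₐ[k] (Fin m → k))

/-- `A` has finite global dimension: the projective dimensions of the right `A`-modules
(i.e. modules over `Aᵐᵒᵖ`) are uniformly bounded. -/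
def HasFiniteGlobalDimension (A : Type u) [Ring A] : Prop :=
  ∃ d : ℕ, ∀ M : ModuleCat.{u} Aᵐᵒᵖ, HasProjectiveDimensionLE M d

variable {A}

/-- A nonzero idempotent that is not the sum of two nonzero orthogonal idempotents. -/
def IsPrimitiveIdempotent {A : Type u} [Ring A] (e : A) : Prop :=
  IsIdempotentElem e ∧ e ≠ 0 ∧
    ∀ f g : A, IsIdempotentElem f → IsIdempotentElem g → f * g = 0 → g * f = 0 →
      e = f + g → f = 0 ∨ g = 0

/-- `e₁, …, eₙ` is a complete set of orthogonal primitive idempotents: pairwise orthogonal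
primitive idempotents with sum `1`. -/
def IsCompletePrimitive {A : Type u} [Ring A] {n : ℕ} (e : Fin n → A) : Prop :=
  CompleteOrthogonalIdempotents e ∧ ∀ i, IsPrimitiveIdempotent (e i)

/-- The Cartan matrix `C_A`, with entries `c_{ij} = dim_k (e_j A e_i)`. -/
noncomputable def cartanMatrix {n : ℕ} (e : Fin n → A) : Matrix (Fin n) (Fin n) ℤ :=
  Matrix.of fun i j ↦
    (Module.finrank k (LinearMap.range (LinearMap.mulLeftRight k (e j, e i))) : ℤ)

end Algebras

/-- The Ringel form `(x, y) ↦ xᵀ C⁻ᵀ y` of an algebra with Cartan matrix `C`. -/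
noncomputable def ringelForm {n : ℕ} (C : Matrix (Fin n) (Fin n) ℤ) (x y : Fin n → ℤ) : ℤ :=
  x ⬝ᵥ ((C⁻¹)ᵀ *ᵥ y)

/-- The Ringel form `(x, y) ↦ xᵀ C⁻¹ y` of the opposite of an algebra with Cartan matrix `C`. -/
noncomputable def ringelFormOp {n : ℕ} (C : Matrix (Fin n) (Fin n) ℤ) (x y : Fin n → ℤ) : ℤ :=
  x ⬝ᵥ (C⁻¹ *ᵥ y)

/-- The `ℤ`-graded vector space `V` is finite dimensional in total, that is, every `V l` is
finite dimensional and only finitely many are nonzero, and `∑ (-1)^l dim V l = χ`. -/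
def HasSuperDim (k : Type u) [Field k] (V : ℤ → ModuleCat k) (χ : ℤ) : Prop :=
  (∀ l, Module.Finite k (V l)) ∧ {l : ℤ | Nontrivial (V l)}.Finite ∧
    ∑ᶠ l : ℤ, (l.negOnePow : ℤ) * (Module.finrank k (V l) : ℤ) = χ

/-! ### Complexes of modules over a `k`-algebra

Left `R`-modules are objects of `ModuleCat R`, right `R`-modules are objects of `ModuleCat Rᵐᵒᵖ`,
and `R`-bimodules (over `k`) are objects of `ModuleCat (R ⊗[k] Rᵐᵒᵖ)`. -/

section Modules

open scoped ModuleCat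

variable (k : Type u) [Field k] {R : Type u} [Ring R] [Algebra k R]

/-- A bounded complex of modules that are finite dimensional over `k`. -/
def IsBoundedFD (M : CochainComplex (ModuleCat.{u} R) ℤ) : Prop :=
  (∃ a b : ℤ, M.IsStrictlyGE a ∧ M.IsStrictlyLE b) ∧ ∀ l, Module.Finite k (M.X l)

/-- `dim_k (e M)` for an element `e` of `R` acting on the `R`-module `M`. -/
noncomputable def actionRank (e : R) (M : ModuleCat.{u} R) : ℕ :=
  Module.finrank k (LinearMap.range (Algebra.lsmul k k M e))

/-- The alternating sum `∑ (-1)^l dim_k (e M^l)` for a bounded complex `M`. -/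
noncomputable def superRank (e : R) (M : CochainComplex (ModuleCat.{u} R) ℤ) : ℤ :=
  ∑ᶠ l : ℤ, (l.negOnePow : ℤ) * (actionRank k e (M.X l) : ℤ)

/-- The super dimension vector of a complex of right modules, with entries
`∑ (-1)^l dim (M^l e_i)`. -/
noncomputable def dimVecRight {n : ℕ} (e : Fin n → R)
    (M : CochainComplex (ModuleCat.{u} Rᵐᵒᵖ) ℤ) : Fin n → ℤ :=
  fun i ↦ superRank k (op (e i)) M

/-- The super dimension vector of a complex of left modules, with entries
`∑ (-1)^l dim (e_i N^l)`. -/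
noncomputable def dimVecLeft {n : ℕ} (e : Fin n → R)
    (N : CochainComplex (ModuleCat.{u} R) ℤ) : Fin n → ℤ :=
  fun i ↦ superRank k (e i) N

/-- The super dimension matrix of a complex of bimodules, with `(i, j)` entry
`∑ (-1)^l dim (e_j M^l e_i)`. -/
noncomputable def dimMatrix {n : ℕ} (e : Fin n → R)
    (M : CochainComplex (ModuleCat.{u} (R ⊗[k] Rᵐᵒᵖ)) ℤ) : Matrix (Fin n) (Fin n) ℤ :=
  Matrix.of fun i j ↦ superRank k (e j ⊗ₜ[k] op (e i)) M

/-! ### Ext of complexes -/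

attribute [local instance] HasDerivedCategory.standard

/-- `Ext_R^l(M, N) = H^l(RHom_R(M, N))`, the `k`-vector space of morphisms `M ⟶ N[l]` in the
derived category of `R`-modules. -/
noncomputable def ext (M N : CochainComplex (ModuleCat.{u} R) ℤ) (l : ℤ) : ModuleCat.{u + 1} k :=
  ModuleCat.of k (DerivedCategory.Q.obj M ⟶ (DerivedCategory.Q.obj N)⟦l⟧)

/-! ### Tor of complexes -/

/-- The subspace of `M ⊗_k N` spanned by the elements `m r ⊗ n - m ⊗ r n`. -/
def balancing (M : ModuleCat.{u} Rᵐᵒᵖ) (N : ModuleCat.{u} R) : Submodule k (M ⊗[k] N) :=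
  Submodule.span k {t | ∃ (m : M) (r : R) (n : N), t = (op r • m) ⊗ₜ[k] n - m ⊗ₜ[k] (r • n)}

/-- The `k`-linear map `f ⊗ g`. -/
noncomputable def tensorHom {M M' : ModuleCat.{u} Rᵐᵒᵖ} {N N' : ModuleCat.{u} R}
    (f : M ⟶ M') (g : N ⟶ N') : M ⊗[k] N →ₗ[k] M' ⊗[k] N' :=
  TensorProduct.map (f.hom.restrictScalars k) (g.hom.restrictScalars k)

lemma balancing_le {M M' : ModuleCat.{u} Rᵐᵒᵖ} {N N' : ModuleCat.{u} R}
    (f : M ⟶ M') (g : N ⟶ N') :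
    balancing k M N ≤ (balancing k M' N').comap (tensorHom k f g) := by
  refine Submodule.span_le.2 ?_
  rintro _ ⟨m, r, n, rfl⟩
  refine Submodule.subset_span ⟨f.hom m, r, g.hom n, ?_⟩
  simp [tensorHom]

/-- The tensor product `M ⊗_R N` of a right `R`-module and a left `R`-module, as the
quotient of `M ⊗_k N` by the balancing relations. -/
noncomputable def tensor (M : ModuleCat.{u} Rᵐᵒᵖ) (N : ModuleCat.{u} R) : ModuleCat.{u} k :=
  ModuleCat.of k ((M ⊗[k] N) ⧸ balancing k M N)

/-- Functoriality of `M ⊗_R N`. -/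
noncomputable def tensorMap {M M' : ModuleCat.{u} Rᵐᵒᵖ} {N N' : ModuleCat.{u} R}
    (f : M ⟶ M') (g : N ⟶ N') : tensor k M N ⟶ tensor k M' N' :=
  ModuleCat.ofHom (Submodule.mapQ _ _ (tensorHom k f g) (balancing_le k f g))

lemma tensor_hom_ext {M : ModuleCat.{u} Rᵐᵒᵖ} {N : ModuleCat.{u} R} {X : ModuleCat.{u} k}
    {φ ψ : tensor k M N ⟶ X}
    (h : ∀ (m : M) (n : N), φ.hom (Submodule.Quotient.mk (m ⊗ₜ[k] n)) =
      ψ.hom (Submodule.Quotient.mk (m ⊗ₜ[k] n))) : φ = ψ := by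
  refine ModuleCat.hom_ext (Submodule.linearMap_qext _ (TensorProduct.ext' fun m n ↦ h m n))

variable (R) in
/-- The bifunctor `(M, N) ↦ M ⊗_R N`. -/
noncomputable def tensorFunctor : ModuleCat.{u} Rᵐᵒᵖ ⥤ ModuleCat.{u} R ⥤ ModuleCat.{u} k where
  obj M :=
    { obj := fun N ↦ tensor k M N
      map := fun g ↦ tensorMap k (𝟙 M) g
      map_id := fun _ ↦ tensor_hom_ext k fun _ _ ↦ rfl
      map_comp := fun _ _ ↦ tensor_hom_ext k fun _ _ ↦ rfl }
  map f :=
    { app := fun N ↦ tensorMap k f (𝟙 N)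
      naturality := fun _ _ _ ↦ tensor_hom_ext k fun _ _ ↦ rfl }
  map_id _ := by
    ext N : 2
    exact tensor_hom_ext k fun _ _ ↦ rfl
  map_comp _ _ := by
    ext N : 2
    exact tensor_hom_ext k fun _ _ ↦ rfl

instance : (tensorFunctor k R).Additive where
  map_add {M M' f g} := by
    ext N : 2
    refine tensor_hom_ext k fun m n ↦ ?_
    change (balancing k M' N).mkQ ((f.hom m + g.hom m) ⊗ₜ[k] n) =
      (balancing k M' N).mkQ (f.hom m ⊗ₜ[k] n) + (balancing k M' N).mkQ (g.hom m ⊗ₜ[k] n)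
    rw [TensorProduct.add_tmul, map_add]

instance (M : ModuleCat.{u} Rᵐᵒᵖ) : ((tensorFunctor k R).obj M).Additive where
  map_add {N N' f g} := by
    refine tensor_hom_ext k fun m n ↦ ?_
    change (balancing k M N').mkQ (m ⊗ₜ[k] (f.hom n + g.hom n)) =
      (balancing k M N').mkQ (m ⊗ₜ[k] f.hom n) + (balancing k M N').mkQ (m ⊗ₜ[k] g.hom n)
    rw [TensorProduct.tmul_add, map_add]

/-- The total complex `M ⊗_R N` of two complexes, with
`(M ⊗_R N)^l = ⨁_{p + q = l} M^p ⊗_R N^q`. -/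
noncomputable def tensorComplex (M : CochainComplex (ModuleCat.{u} Rᵐᵒᵖ) ℤ)
    (N : CochainComplex (ModuleCat.{u} R) ℤ) : CochainComplex (ModuleCat.{u} k) ℤ :=
  HomologicalComplex.mapBifunctor M N (tensorFunctor k R) (ComplexShape.up ℤ)

/-- A homotopically projective resolution of a complex `M`: a homotopically projective complex
with a quasi-isomorphism to `M`. -/
structure ProjRes {S : Type u} [Ring S] (M : CochainComplex (ModuleCat.{u} S) ℤ) where
  /-- The resolving complex. -/
  P : CochainComplex (ModuleCat.{u} S) ℤ
  /-- The augmentation. -/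
  π : P ⟶ M
  isKProjective : P.IsKProjective
  quasiIso : QuasiIso π

/-- `Tor^R_l(M, N) = H_l(M ⊗^L_R N) = H^{-l}(P ⊗_R N)`, computed from a homotopically projective
resolution `P` of the complex of right modules `M`. -/
noncomputable def tor {M : CochainComplex (ModuleCat.{u} Rᵐᵒᵖ) ℤ} (ρ : ProjRes M)
    (N : CochainComplex (ModuleCat.{u} R) ℤ) (l : ℤ) : ModuleCat.{u} k :=
  (tensorComplex k ρ.P N).homology (-l)

/-! ### The regular bimodule -/

variable (R)

/-- `R` as a bimodule over itself, `(a ⊗ b) • x = a x b`, in degree `0`. -/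
noncomputable def diagLeft : CochainComplex (ModuleCat.{u} (R ⊗[k] Rᵐᵒᵖ)) ℤ :=
  letI : Module (R ⊗[k] Rᵐᵒᵖ) R := TensorProduct.Algebra.module
  (CochainComplex.singleFunctor _ 0).obj (ModuleCat.of (R ⊗[k] Rᵐᵒᵖ) R)

lemma diagLeft_smul (a b x : R) :
    letI : Module (R ⊗[k] Rᵐᵒᵖ) R := TensorProduct.Algebra.module
    (a ⊗ₜ[k] op b) • x = a * x * b := by
  simp [TensorProduct.Algebra.smul_def, mul_assoc]

/-- The isomorphism `(R ⊗ Rᵒᵖ)ᵒᵖ ≃ R ⊗ Rᵒᵖ`, `a ⊗ b ↦ b ⊗ a`. -/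
noncomputable def envSwap : (R ⊗[k] Rᵐᵒᵖ)ᵐᵒᵖ ≃ₐ[k] R ⊗[k] Rᵐᵒᵖ :=
  (Algebra.TensorProduct.opAlgEquiv k k R Rᵐᵒᵖ).symm.trans
    ((Algebra.TensorProduct.congr AlgEquiv.refl (AlgEquiv.opOp k R).symm).trans
      (Algebra.TensorProduct.comm k Rᵐᵒᵖ R))

lemma envSwap_tmul (a b : R) :
    envSwap k R (op (a ⊗ₜ[k] op b)) = b ⊗ₜ[k] op a := by
  simp [envSwap]

/-- `R` as a right module over the enveloping algebra `R ⊗ Rᵒᵖ`, `x • (a ⊗ b) = b x a`. -/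
noncomputable abbrev rightEnvModule : Module (R ⊗[k] Rᵐᵒᵖ)ᵐᵒᵖ R :=
  letI : Module (R ⊗[k] Rᵐᵒᵖ) R := TensorProduct.Algebra.module
  Module.compHom R (envSwap k R : (R ⊗[k] Rᵐᵒᵖ)ᵐᵒᵖ →+* R ⊗[k] Rᵐᵒᵖ)

lemma rightEnvModule_smul (a b x : R) :
    letI := rightEnvModule k R
    op (a ⊗ₜ[k] op b) • x = b * x * a := by
  let : Module (R ⊗[k] Rᵐᵒᵖ) R := TensorProduct.Algebra.module
  change envSwap k R (op (a ⊗ₜ[k] op b)) • x = b * x * a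
  rw [envSwap_tmul, TensorProduct.Algebra.smul_def]
  simp [mul_assoc]

/-- `R` as a right module over the enveloping algebra, in degree `0`. -/
noncomputable def diagRight : CochainComplex (ModuleCat.{u} (R ⊗[k] Rᵐᵒᵖ)ᵐᵒᵖ) ℤ :=
  letI := rightEnvModule k R
  (CochainComplex.singleFunctor _ 0).obj (ModuleCat.of (R ⊗[k] Rᵐᵒᵖ)ᵐᵒᵖ R)

/-- Hochschild cohomology `HH^l(R, M) = Ext_{R^e}^l(R, M)`. -/
noncomputable def hochschildCohomology (M : CochainComplex (ModuleCat.{u} (R ⊗[k] Rᵐᵒᵖ)) ℤ)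
    (l : ℤ) : ModuleCat.{u + 1} k :=
  ext k (diagLeft k R) M l

variable {R}

/-- Hochschild homology `HH_l(R, M) = Tor^{R^e}_l(R, M)`, computed from a homotopically projective
resolution of the right `R^e`-module `R`. -/
noncomputable def hochschildHomology (ρ : ProjRes (diagRight k R))
    (M : CochainComplex (ModuleCat.{u} (R ⊗[k] Rᵐᵒᵖ)) ℤ) (l : ℤ) : ModuleCat.{u} k :=
  tor k ρ M l

end Modules

end HRR

/-! Let S_a be the one dimensional module on which the algebra acts through the character χ_a dual
to the idempotent f_a. Every nonzero module contains some S_a, so an integer function r that is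
additive on short exact sequences of finite dimensional modules satisfies r(N) = ∑ r(S_a) dim(f_a N)
(`IsRank.eq_sum`). All the formulas are instances of this principle.

Let P be a bounded resolution of M by finite dimensional projectives over an algebra T. The Euler
characteristic of Ext(M, N) is the double alternating sum of dim Hom(P^p, N^q)
(`hasSuperDim_ext_of_projective`). Since Hom(P^p, -) is exact, this equals ∑ t_a dim(f_a N), where
t_a is the alternating sum of dim Hom(P^p, S_a). The injective module D(f_b T) satisfies Hom(P,
D(f_b T)) = D(f_b P); testing against it gives dim(f_b M) = ∑ dim(f_b T f_a) t_a
(`actionRank_eq_sum`). So t solves a linear system whose matrix is the Cartan matrix. Taking M = S_a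
yields every unit vector on the right hand side, hence an integral inverse
(`isUnit_det_idempotentMatrix`). Tor follows the same path because dim(P ⊗ N) = dim Hom(P, DN)
(`tensorRank_eq_homRank`).

Hochschild (co)homology is the case of the enveloping algebra, with the diagonal bimodule as first
argument. Its characters are products of characters of A and of its opposite. Its finite dimensional
modules have finite projective dimension because they are iterated extensions of external products
S_i ⊗ S_j, and projective dimension is subadditive for external products; for left A-modules
finiteness comes from vector space duality. The Cartan matrix of the enveloping algebra is a
Kronecker product, and the dimension matrix of the diagonal bimodule is C itself up to
transposition. The linear system therefore reads C X C = C, which forces X = C⁻¹ and gives the trace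
formulas. -/

namespace HRR

universe v w

/-! ### Alternating sums -/

/-- The alternating sum `∑ (-1)^l g l` of a finitely supported family. -/
noncomputable def altSum (g : ℤ → ℤ) : ℤ := ∑ᶠ l : ℤ, (l.negOnePow : ℤ) * g l

lemma negOnePow_mul_self (l : ℤ) : (l.negOnePow : ℤ) * (l.negOnePow : ℤ) = 1 := by
  rw [← Units.val_mul, Int.units_mul_self, Units.val_one]

lemma support_negOnePow_mul (g : ℤ → ℤ) :
    (Function.support fun l : ℤ ↦ (l.negOnePow : ℤ) * g l) = Function.support g := by
  ext l; simp

lemma altSum_add {g h : ℤ → ℤ} (hg : (Function.support g).Finite)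
    (hh : (Function.support h).Finite) :
    altSum (fun l ↦ g l + h l) = altSum g + altSum h := by
  unfold altSum
  rw [← finsum_add_distrib (by rwa [Function.HasFiniteSupport, support_negOnePow_mul])
    (by rwa [Function.HasFiniteSupport, support_negOnePow_mul])]
  simp only [mul_add]

lemma altSum_mul_left (c : ℤ) (g : ℤ → ℤ) : altSum (fun l ↦ c * g l) = c * altSum g := by
  unfold altSum
  rw [mul_finsum]
  exact finsum_congr fun l ↦ by ring

lemma altSum_comp_add (c : ℤ) (g : ℤ → ℤ) :
    altSum (fun l ↦ g (l + c)) = (c.negOnePow : ℤ) * altSum g := by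
  unfold altSum
  rw [mul_finsum, ← finsum_comp_equiv (Equiv.addRight c)
    (f := fun l ↦ (c.negOnePow : ℤ) * ((l.negOnePow : ℤ) * g l))]
  refine finsum_congr fun l ↦ ?_
  rw [Equiv.coe_addRight, Int.negOnePow_add, Units.val_mul]
  linear_combination (-(l.negOnePow : ℤ) * g (l + c)) * negOnePow_mul_self c

lemma altSum_comp_neg (g : ℤ → ℤ) : altSum (fun l ↦ g (-l)) = altSum g := by
  unfold altSum
  rw [← finsum_comp_equiv (Equiv.neg ℤ)]
  simp

lemma altSum_eq_of_support_subset_singleton (g : ℤ → ℤ) (b : ℤ) (hg : ∀ l ≠ b, g l = 0) :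
    altSum g = (b.negOnePow : ℤ) * g b := by
  unfold altSum
  exact finsum_eq_single _ b fun l hl ↦ by rw [hg l hl, mul_zero]

lemma altSum_eq_sum (g : ℤ → ℤ) (s : Finset ℤ) (hg : ∀ l ∉ s, g l = 0) :
    altSum g = ∑ l ∈ s, (l.negOnePow : ℤ) * g l := by
  unfold altSum
  refine finsum_eq_sum_of_support_subset _ fun l hl ↦ ?_
  by_contra h
  exact hl (by simp [hg l h])

/-! ### Graded vector spaces of finite total dimension -/

section HasSuperDim

variable {k : Type u} [Field k]

lemma support_finrank_finite {V : ℤ → ModuleCat.{v} k}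
    (h : {l : ℤ | Nontrivial (V l)}.Finite) :
    (Function.support fun l ↦ (Module.finrank k (V l) : ℤ)).Finite := by
  refine h.subset fun l hl ↦ ?_
  by_contra hn
  rw [Set.mem_ofPred_eq, not_nontrivial_iff_subsingleton] at hn
  exact hl (by simp [Module.finrank_zero_of_subsingleton])



lemma HasSuperDim.of_linearEquiv {V : ℤ → ModuleCat.{w} k} {W : ℤ → ModuleCat.{v} k} {χ : ℤ}
    (h : HasSuperDim k V χ) (φ : ∀ l, Nonempty (V l ≃ₗ[k] W l)) : HasSuperDim k W χ := by
  obtain ⟨h1, h2, h3⟩ := h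
  refine ⟨fun l ↦ ?_, h2.subset fun l hl ↦ ?_, ?_⟩
  · have := h1 l
    exact Module.Finite.equiv (φ l).some
  · exact (φ l).some.toEquiv.nontrivial_congr.2 hl
  · rw [← h3]
    exact finsum_congr fun l ↦ by rw [(φ l).some.finrank_eq]

lemma HasSuperDim.comp_neg {V : ℤ → ModuleCat.{v} k} {χ : ℤ} (h : HasSuperDim k V χ) :
    HasSuperDim k (fun l ↦ V (-l)) χ := by
  obtain ⟨h1, h2, h3⟩ := h
  exact ⟨fun l ↦ h1 _, Set.Finite.preimage (f := fun l : ℤ ↦ -l) neg_injective.injOn h2,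
    (altSum_comp_neg fun l ↦ (Module.finrank k (V l) : ℤ)).trans h3⟩

lemma hasSuperDim_zero {V : ℤ → ModuleCat.{v} k} (h : ∀ l, Subsingleton (V l)) :
    HasSuperDim k V 0 := by
  refine ⟨fun l ↦ ?_, ?_, ?_⟩
  · have := h l
    infer_instance
  · convert Set.finite_empty (α := ℤ)
    ext l
    simpa [not_nontrivial_iff_subsingleton] using h l
  · simp [Module.finrank_zero_of_subsingleton]

lemma hasSuperDim_of_concentrated {V : ℤ → ModuleCat.{v} k} (b : ℤ) [Module.Finite k (V b)]
    (h : ∀ l ≠ b, Subsingleton (V l)) :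
    HasSuperDim k V ((b.negOnePow : ℤ) * (Module.finrank k (V b) : ℤ)) := by
  refine ⟨fun l ↦ ?_, (Set.finite_singleton b).subset fun l hl ↦ ?_, ?_⟩
  · by_cases hl : l = b
    · subst hl; infer_instance
    · have := h l hl
      infer_instance
  · by_contra hn
    exact not_nontrivial_iff_subsingleton.2 (h l hn) hl
  · refine altSum_eq_of_support_subset_singleton (fun l ↦ (Module.finrank k (V l) : ℤ)) b
      fun l hl ↦ ?_
    have := h l hl
    simp [Module.finrank_zero_of_subsingleton]

/-- Additivity of the super dimension along a long exact sequence. -/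
theorem HasSuperDim.of_exact {V₁ V₂ V₃ : ℤ → ModuleCat.{v} k} {χ₁ χ₃ : ℤ}
    (α : ∀ l, V₁ l →ₗ[k] V₂ l) (β : ∀ l, V₂ l →ₗ[k] V₃ l) (γ : ∀ l, V₃ l →ₗ[k] V₁ (l + 1))
    (h₁ : ∀ l, Function.Exact (γ l) (α (l + 1))) (h₂ : ∀ l, Function.Exact (α l) (β l))
    (h₃ : ∀ l, Function.Exact (β l) (γ l))
    (H₁ : HasSuperDim k V₁ χ₁) (H₃ : HasSuperDim k V₃ χ₃) : HasSuperDim k V₂ (χ₁ + χ₃) := by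
  obtain ⟨a1, b1, c1⟩ := H₁
  obtain ⟨a3, b3, c3⟩ := H₃
  have fin2 : ∀ l, Module.Finite k (V₂ l) := fun l ↦ by
    have := a1 l
    have := a3 l
    have : Module.Finite k (LinearMap.ker (β l)) := by
      rw [(h₂ l).linearMap_ker_eq]; infer_instance
    have : Module.Finite k (V₂ l ⧸ LinearMap.ker (β l)) :=
      Module.Finite.equiv (β l).quotKerEquivRange.symm
    exact Module.Finite.of_submodule_quotient (LinearMap.ker (β l))
  -- By exactness and rank-nullity each dimension is a sum of the ranks of two adjacent maps. The
  -- rank of `γ l` occurs for V₃ in degree l and for V₁ in degree l + 1, hence with opposite signs,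
  -- and cancels from χ₁ + χ₃.
  have d2 : ∀ l, (Module.finrank k (V₂ l) : ℤ) =
      Module.finrank k (LinearMap.range (α l)) + Module.finrank k (LinearMap.range (β l)) :=
    fun l ↦ by
    have := fin2 l
    rw [← (β l).finrank_range_add_finrank_ker, (h₂ l).linearMap_ker_eq]
    push_cast; ring
  have d3 : ∀ l, (Module.finrank k (V₃ l) : ℤ) =
      Module.finrank k (LinearMap.range (β l)) + Module.finrank k (LinearMap.range (γ l)) :=
    fun l ↦ by
    have := a3 l
    rw [← (γ l).finrank_range_add_finrank_ker, (h₃ l).linearMap_ker_eq]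
    push_cast; ring
  have d1 : ∀ l, (Module.finrank k (V₁ (l + 1)) : ℤ) =
      Module.finrank k (LinearMap.range (γ l)) +
        Module.finrank k (LinearMap.range (α (l + 1))) := fun l ↦ by
    have := a1 (l + 1)
    rw [← (α (l + 1)).finrank_range_add_finrank_ker, (h₁ l).linearMap_ker_eq]
    push_cast; ring
  have s1 := support_finrank_finite b1
  have s3 := support_finrank_finite b3
  have sβ : (Function.support fun l ↦
      (Module.finrank k (LinearMap.range (β l)) : ℤ)).Finite :=
    s3.subset fun l hl ↦ by have := d3 l; rw [Function.mem_support] at hl ⊢; omega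
  have sγ : (Function.support fun l ↦
      (Module.finrank k (LinearMap.range (γ l)) : ℤ)).Finite :=
    s3.subset fun l hl ↦ by have := d3 l; rw [Function.mem_support] at hl ⊢; omega
  have sα : (Function.support fun l ↦
      (Module.finrank k (LinearMap.range (α l)) : ℤ)).Finite :=
    s1.subset fun l hl ↦ by
      obtain ⟨m, rfl⟩ : ∃ m, l = m + 1 := ⟨l - 1, by ring⟩
      have := d1 m
      rw [Function.mem_support] at hl ⊢; omega
  refine ⟨fin2, (b1.union b3).subset fun l hl ↦ ?_, ?_⟩
  · by_contra hn
    rw [Set.mem_union, not_or, Set.mem_ofPred_eq, Set.mem_ofPred_eq,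
      not_nontrivial_iff_subsingleton, not_nontrivial_iff_subsingleton] at hn
    have := hn.1
    have := hn.2
    refine not_nontrivial_iff_subsingleton.2 (subsingleton_of_forall_eq 0 fun x ↦ ?_) hl
    obtain ⟨y, rfl⟩ := (h₂ l x).1 (Subsingleton.elim _ _)
    rw [Subsingleton.elim y 0, map_zero]
  · change altSum (fun l ↦ (Module.finrank k (V₂ l) : ℤ)) = χ₁ + χ₃
    have e1 : altSum (fun l ↦ (Module.finrank k (V₁ (l + 1)) : ℤ)) = -χ₁ := by
      rw [altSum_comp_add 1 fun l ↦ (Module.finrank k (V₁ l) : ℤ), ← c1]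
      simp [altSum]
    have e2 := altSum_comp_add 1 fun l ↦ (Module.finrank k (LinearMap.range (α l)) : ℤ)
    have e3 : altSum (fun l ↦ (Module.finrank k (V₃ l) : ℤ)) = χ₃ := c3
    rw [funext d1, altSum_add sγ (sα.preimage (f := fun l : ℤ ↦ l + 1)
      (add_left_injective 1).injOn), e2] at e1
    rw [funext d3, altSum_add sβ sγ] at e3
    rw [funext d2, altSum_add sα sβ]
    simp at e1
    linarith

end HasSuperDim

/-! ### Additive rank functions -/

section Rank

open scoped ModuleCat

variable (k : Type u) [Field k] {S : Type u} [Ring S] [Algebra k S]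

/-- A class of modules closed under isomorphisms and containing the zero modules. -/
structure IsReplete {R : Type u} [Ring R] (c : ModuleCat.{u} R → Prop) : Prop where
  zero : ∀ X, Limits.IsZero X → c X
  iso : ∀ ⦃X Y⦄, (X ≅ Y) → c X → c Y

/-- A bounded complex with terms in a class `c` of modules. -/
def BoundedIn {R : Type u} [Ring R] (c : ModuleCat.{u} R → Prop)
    (M : CochainComplex (ModuleCat.{u} R) ℤ) : Prop :=
  (∃ a b : ℤ, M.IsStrictlyGE a ∧ M.IsStrictlyLE b) ∧ ∀ l, c (M.X l)

/-- An integer valued function on modules which is additive on short exact sequences of modules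
in a class `c`. -/
structure IsRank {R : Type u} [Ring R] (c : ModuleCat.{u} R → Prop) (r : ModuleCat.{u} R → ℤ) :
    Prop where
  add : ∀ ⦃Z : ShortComplex (ModuleCat.{u} R)⦄, Z.ShortExact → c Z.X₁ → c Z.X₂ → c Z.X₃ →
    r Z.X₂ = r Z.X₁ + r Z.X₃

section

variable {R : Type u} [Ring R] {c : ModuleCat.{u} R → Prop} {r : ModuleCat.{u} R → ℤ}

/-- For zero X the sequence 0 → X → X → X → 0 is short exact, so r(X) = 2 r(X). -/
lemma IsRank.eq_zero (hr : IsRank c r) (hc : IsReplete c) {X : ModuleCat.{u} R}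
    (hX : Limits.IsZero X) : r X = 0 := by
  have h : (ShortComplex.mk (0 : X ⟶ X) (0 : X ⟶ X) (by simp)).ShortExact :=
    { exact := ShortComplex.exact_of_isZero_X₂ _ hX
      mono_f := ⟨fun _ _ _ ↦ hX.eq_of_tgt _ _⟩
      epi_g := ⟨fun _ _ _ ↦ hX.eq_of_src _ _⟩ }
  have := hr.add h (hc.zero _ hX) (hc.zero _ hX) (hc.zero _ hX)
  dsimp at this
  omega

lemma IsRank.eq_of_iso (hr : IsRank c r) (hc : IsReplete c) {X Y : ModuleCat.{u} R}
    (φ : X ≅ Y) (hX : c X) : r X = r Y := by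
  let Z : ModuleCat.{u} R := ModuleCat.of R PUnit
  have hZ : Limits.IsZero Z := ModuleCat.isZero_of_subsingleton _
  have h : (ShortComplex.mk φ.hom (0 : Y ⟶ Z) (by simp)).ShortExact :=
    { exact := (ShortComplex.exact_iff_epi _ rfl).2 inferInstance
      mono_f := inferInstance
      epi_g := ⟨fun _ _ _ ↦ hZ.eq_of_src _ _⟩ }
  have := hr.add h hX (hc.iso φ hX) (hc.zero _ hZ)
  dsimp at this
  rw [this, hr.eq_zero hc hZ, add_zero]

/-- The alternating sum of an integer valued function on the terms of a complex. -/
noncomputable def eulerSum (r : ModuleCat.{u} R → ℤ) (M : CochainComplex (ModuleCat.{u} R) ℤ) :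
    ℤ :=
  altSum fun l ↦ r (M.X l)

lemma IsRank.support_finite (hr : IsRank c r) (hc : IsReplete c)
    {M : CochainComplex (ModuleCat.{u} R) ℤ} (hM : BoundedIn c M) :
    (Function.support fun l ↦ r (M.X l)).Finite := by
  obtain ⟨⟨a, b, _, _⟩, _⟩ := hM
  refine (Set.finite_Icc a b).subset fun l hl ↦ ?_
  by_contra h
  rw [Set.mem_Icc, not_and_or, not_le, not_le] at h
  refine hl (hr.eq_zero hc ?_)
  rcases h with h | h
  · exact M.isZero_of_isStrictlyGE a l h
  · exact M.isZero_of_isStrictlyLE b l h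

lemma shortExact_eval {Z : ShortComplex (CochainComplex (ModuleCat.{u} R) ℤ)}
    (hZ : Z.ShortExact) (l : ℤ) :
    (Z.map (HomologicalComplex.eval _ _ l)).ShortExact :=
  hZ.map_of_exact _

lemma IsRank.eulerSum_add (hr : IsRank c r) (hc : IsReplete c)
    {Z : ShortComplex (CochainComplex (ModuleCat.{u} R) ℤ)} (hZ : Z.ShortExact)
    (h₁ : BoundedIn c Z.X₁) (h₂ : BoundedIn c Z.X₂) (h₃ : BoundedIn c Z.X₃) :
    eulerSum r Z.X₂ = eulerSum r Z.X₁ + eulerSum r Z.X₃ := by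
  rw [eulerSum, eulerSum, eulerSum,
    ← altSum_add (hr.support_finite hc h₁) (hr.support_finite hc h₃)]
  congr 1
  funext l
  exact hr.add (shortExact_eval hZ l) (h₁.2 l) (h₂.2 l) (h₃.2 l)

lemma IsRank.eulerSum_single (hr : IsRank c r) (hc : IsReplete c) (b : ℤ)
    {X : ModuleCat.{u} R} (hX : c X) :
    eulerSum r ((CochainComplex.singleFunctor _ b).obj X) = (b.negOnePow : ℤ) * r X := by
  change altSum (fun l ↦ r (((HomologicalComplex.single _ (ComplexShape.up ℤ) b).obj X).X l)) = _
  rw [altSum_eq_of_support_subset_singleton _ b fun l hl ↦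
    hr.eq_zero hc (HomologicalComplex.isZero_single_obj_X (ComplexShape.up ℤ) b X l hl),
    hr.eq_of_iso hc (HomologicalComplex.singleObjXSelf (ComplexShape.up ℤ) b X).symm hX]

lemma IsRank.eulerSum_eq_zero (hr : IsRank c r) (hc : IsReplete c)
    {M : CochainComplex (ModuleCat.{u} R) ℤ} (hM : Limits.IsZero M) : eulerSum r M = 0 := by
  rw [eulerSum]
  have : (fun l ↦ r (M.X l)) = fun _ ↦ 0 := funext fun l ↦
    hr.eq_zero hc ((HomologicalComplex.eval _ _ l).map_isZero hM)
  rw [this]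
  simp [altSum]

lemma boundedIn_single (hc : IsReplete c) (b : ℤ) {X : ModuleCat.{u} R} (hX : c X) :
    BoundedIn c ((CochainComplex.singleFunctor _ b).obj X) := by
  refine ⟨⟨b, b, inferInstance, inferInstance⟩, fun l ↦ ?_⟩
  by_cases hl : l = b
  · subst hl
    exact hc.iso (HomologicalComplex.singleObjXSelf (ComplexShape.up ℤ) l X).symm hX
  · exact hc.zero _ (HomologicalComplex.isZero_single_obj_X (ComplexShape.up ℤ) b X l hl)

/-- Induction on bounded complexes with terms in a given class of modules: it suffices to treat
zero complexes, complexes concentrated in one degree, and extensions of the latter. -/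
theorem bounded_induction (hc : IsReplete c)
    {p : CochainComplex (ModuleCat.{u} R) ℤ → Prop}
    (zero : ∀ M, Limits.IsZero M → p M)
    (single : ∀ b X, c X → p ((CochainComplex.singleFunctor _ b).obj X))
    (ext : ∀ Z : ShortComplex (CochainComplex (ModuleCat.{u} R) ℤ), Z.ShortExact →
      BoundedIn c Z.X₁ → BoundedIn c Z.X₂ → BoundedIn c Z.X₃ → p Z.X₁ → p Z.X₃ → p Z.X₂)
    {M : CochainComplex (ModuleCat.{u} R) ℤ} (hM : BoundedIn c M) : p M := by
  obtain ⟨⟨a, b, hMa, hMb⟩, hM⟩ := hM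
  -- Induction on a bound n for the length of the interval [a, b]; for n = 0 the interval is empty
  -- and the complex is zero.
  suffices ∀ (n : ℕ) (b : ℤ) (M : CochainComplex (ModuleCat.{u} R) ℤ), b < a + n →
      M.IsStrictlyGE a → M.IsStrictlyLE b → (∀ l, c (M.X l)) → p M from
    this (b + 1 - a).toNat b M (by omega) hMa hMb hM
  intro n
  induction n with
  | zero =>
    intro b M hb hMa hMb _
    refine zero M ?_
    rw [Limits.IsZero.iff_id_eq_zero]
    ext l : 1
    by_cases hl : l < a
    · exact (M.isZero_of_isStrictlyGE a l hl).eq_of_src _ _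
    · exact (M.isZero_of_isStrictlyLE b l (by push_cast at hb; omega)).eq_of_src _ _
  | succ n ih =>
    intro b M hb hMa hMb hM
    -- The top term is a subcomplex because the differential leaving degree b vanishes. The quotient
    -- agrees with M below degree b and is zero from b on, so the induction hypothesis applies with
    -- b - 1.
    let φ : (CochainComplex.singleFunctor _ b).obj (M.X b) ⟶ M :=
      HomologicalComplex.mkHomFromSingle (𝟙 (M.X b)) fun j hj ↦
        (M.isZero_of_isStrictlyLE b j (by simp at hj; omega)).eq_of_tgt _ _
    have hφ : IsIso (φ.f b) := by
      have : φ.f b = (HomologicalComplex.singleObjXSelf (ComplexShape.up ℤ) b (M.X b)).hom ≫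
          𝟙 _ := HomologicalComplex.mkHomFromSingle_f _ _
      rw [this]
      exact (HomologicalComplex.singleObjXSelf (ComplexShape.up ℤ) b (M.X b) ≪≫
        Iso.refl _).isIso_hom
    have h0 : ∀ l ≠ b, Limits.IsZero (((CochainComplex.singleFunctor _ b).obj (M.X b)).X l) :=
      fun l hl ↦ HomologicalComplex.isZero_single_obj_X (ComplexShape.up ℤ) b (M.X b) l hl
    have : ∀ l, Mono (φ.f l) := fun l ↦ by
      by_cases hl : l = b
      · subst hl; infer_instance
      · exact ⟨fun _ _ _ ↦ (h0 l hl).eq_of_tgt _ _⟩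
    have : Mono φ := HomologicalComplex.mono_of_mono_f φ inferInstance
    let Z := ShortComplex.mk φ (Limits.cokernel.π φ) (Limits.cokernel.condition φ)
    have hZ : Z.ShortExact := { exact := ShortComplex.exact_cokernel φ }
    have i1 : ∀ l ≠ b, IsIso (Z.g.f l) := fun l hl ↦
      (shortExact_eval hZ l).isIso_g_iff.2 (h0 l hl)
    have i2 : Limits.IsZero (Z.X₃.X b) := (shortExact_eval hZ b).isIso_f_iff.1 hφ
    have c3 : ∀ l, c (Z.X₃.X l) := fun l ↦ by
      by_cases hl : l = b
      · subst hl; exact hc.zero _ i2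
      · have := i1 l hl
        exact hc.iso (asIso (Z.g.f l)) (hM l)
    have g3 : Z.X₃.IsStrictlyGE a := by
      rw [CochainComplex.isStrictlyGE_iff]
      intro l hl
      by_cases hlb : l = b
      · subst hlb; exact i2
      · have := i1 l hlb
        exact (M.isZero_of_isStrictlyGE a l hl).of_iso (asIso (Z.g.f l)).symm
    have l3 : Z.X₃.IsStrictlyLE (b - 1) := by
      rw [CochainComplex.isStrictlyLE_iff]
      intro l hl
      by_cases hlb : l = b
      · subst hlb; exact i2
      · have := i1 l hlb
        exact (M.isZero_of_isStrictlyLE b l (by omega)).of_iso (asIso (Z.g.f l)).symm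
    exact ext Z hZ (boundedIn_single hc b (hM b)) ⟨⟨a, b, hMa, hMb⟩, hM⟩
      ⟨⟨a, b - 1, g3, l3⟩, c3⟩ (single b _ (hM b))
      (ih (b - 1) _ (by push_cast at hb; omega) g3 l3 c3)

end

variable {k}

lemma isReplete_finite : IsReplete fun X : ModuleCat.{u} S ↦ Module.Finite k X where
  zero X hX := by
    have : Subsingleton X := ModuleCat.subsingleton_of_isZero hX
    infer_instance
  iso _ _ φ _ := Module.Finite.equiv (φ.toLinearEquiv.restrictScalars k)

/-- For idempotent f the functor X ↦ f X is exact. Idempotency enters at the middle term: if f y =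
i(x), with i the injection of the sequence, then f y = f f y = i(f x), so the preimage can be taken
in f X₁. -/
lemma isRank_actionRank {f : S} (hf : IsIdempotentElem f) :
    IsRank (fun X : ModuleCat.{u} S ↦ Module.Finite k X) fun X ↦ (actionRank k f X : ℤ) := by
  constructor
  intro Z hZ h1 h2 h3
  have hex := (ShortComplex.ShortExact.moduleCat_exact_iff_function_exact Z).1 hZ.exact
  have hinj : Function.Injective Z.f.hom := hZ.moduleCat_injective_f
  have hsurj : Function.Surjective Z.g.hom := hZ.moduleCat_surjective_g
  let F : LinearMap.range (Algebra.lsmul k k Z.X₁ f) →ₗ[k] Z.X₂ :=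
    Z.f.hom.restrictScalars k ∘ₗ Submodule.subtype _
  let G : LinearMap.range (Algebra.lsmul k k Z.X₂ f) →ₗ[k] Z.X₃ :=
    Z.g.hom.restrictScalars k ∘ₗ Submodule.subtype _
  have hG : LinearMap.range G = LinearMap.range (Algebra.lsmul k k Z.X₃ f) := by
    ext y
    constructor
    · rintro ⟨⟨_, x, rfl⟩, rfl⟩
      exact ⟨Z.g.hom x, (map_smul Z.g.hom f x).symm⟩
    · rintro ⟨y, rfl⟩
      obtain ⟨x, rfl⟩ := hsurj y
      exact ⟨⟨_, x, rfl⟩, map_smul Z.g.hom f x⟩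
  have hF : LinearMap.range F = (LinearMap.ker G).map (Submodule.subtype _) := by
    ext y
    constructor
    · rintro ⟨⟨_, x, rfl⟩, rfl⟩
      exact ⟨⟨_, Z.f.hom x, (map_smul Z.f.hom f x).symm⟩, hex.apply_apply_eq_zero _, rfl⟩
    · rintro ⟨⟨_, y, rfl⟩, hy, rfl⟩
      obtain ⟨x, hx⟩ := (hex _).1 hy
      refine ⟨⟨_, x, rfl⟩, (map_smul Z.f.hom f x).trans ?_⟩
      rw [hx]
      change f • f • y = f • y
      rw [smul_smul, hf.eq]
  have hFi : Function.Injective F := hinj.comp Subtype.val_injective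
  have e1 : Module.finrank k (LinearMap.ker G) = actionRank k f Z.X₁ := by
    rw [actionRank, ← LinearMap.finrank_range_of_inj hFi, hF]
    exact (Submodule.equivMapOfInjective _ Subtype.val_injective _).finrank_eq
  have e2 := G.finrank_range_add_finrank_ker
  rw [hG, e1] at e2
  change actionRank k f Z.X₃ + _ = actionRank k f Z.X₂ at e2
  omega

end Rank

/-! ### Graded morphism spaces in triangulated categories -/

section ShiftHom

open Limits Pretriangulated

variable (k : Type u) [Field k] {C : Type w} [Category.{v} C] [Preadditive C]
  [HasShift C ℤ] [Linear k C]

/-- The graded vector space with components `X ⟶ Y⟦l⟧`. -/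
noncomputable def shiftHom (X Y : C) (l : ℤ) : ModuleCat.{v} k := ModuleCat.of k (X ⟶ Y⟦l⟧)

variable {k} in
lemma HasSuperDim.shiftHom_of_iso {X X' Y Y' : C} (φ : X ≅ X') (ψ : Y ≅ Y') {χ : ℤ}
    (h : HasSuperDim k (shiftHom k X Y) χ) : HasSuperDim k (shiftHom k X' Y') χ :=
  h.of_linearEquiv (W := shiftHom k X' Y') fun l ↦
    ⟨(Linear.homCongr k φ ((shiftFunctor C l).mapIso ψ) : (X ⟶ Y⟦l⟧) ≃ₗ[k] (X' ⟶ Y'⟦l⟧))⟩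

variable [HasZeroObject C] [∀ n : ℤ, (shiftFunctor C n).Additive] [Pretriangulated C]

/-- The l-th shift of a distinguished triangle carries the sign (-1)^l on its morphisms. The sign is
a unit, so it can be moved into the lift. -/
lemma exists_lift_shift (T : Triangle C) (hT : T ∈ distTriang C) {X : C} (l : ℤ)
    (f : X ⟶ T.obj₂⟦l⟧) (hf : f ≫ T.mor₂⟦l⟧' = 0) : ∃ g : X ⟶ T.obj₁⟦l⟧, f = g ≫ T.mor₁⟦l⟧' := by
  obtain ⟨g, hg⟩ : ∃ g : X ⟶ T.obj₁⟦l⟧, f = g ≫ (l.negOnePow • T.mor₁⟦l⟧') :=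
    Triangle.coyoneda_exact₂ _ (Triangle.shift_distinguished T hT l) f (by
      change f ≫ (l.negOnePow • T.mor₂⟦l⟧') = 0
      rw [Linear.comp_units_smul, hf, smul_zero])
  refine ⟨l.negOnePow • g, ?_⟩
  rw [hg, Linear.units_smul_comp, Linear.comp_units_smul]

variable {k}

/-- Additivity in the second variable of the super dimension of graded morphism spaces. -/
theorem hasSuperDim_shiftHom_right (T : Triangle C) (hT : T ∈ distTriang C) (X : C) {χ₁ χ₃ : ℤ}
    (H₁ : HasSuperDim k (shiftHom k X T.obj₁) χ₁) (H₃ : HasSuperDim k (shiftHom k X T.obj₃) χ₃) :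
    HasSuperDim k (shiftHom k X T.obj₂) (χ₁ + χ₃) := by
  let σ (l : ℤ) : T.obj₁⟦(1 : ℤ)⟧⟦l⟧ ≅ T.obj₁⟦l + 1⟧ :=
    ((shiftFunctorAdd' C 1 l (l + 1) (by omega)).app T.obj₁).symm
  have hσ (l : ℤ) : (σ l).hom ≫ T.mor₁⟦l + 1⟧' = T.mor₁⟦(1 : ℤ)⟧'⟦l⟧' ≫
      (shiftFunctorAdd' C 1 l (l + 1) (by omega)).inv.app T.obj₂ :=
    ((shiftFunctorAdd' C 1 l (l + 1) (by omega)).inv.naturality T.mor₁).symm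
  refine HasSuperDim.of_exact (fun l ↦ Linear.rightComp k X (T.mor₁⟦l⟧'))
    (fun l ↦ Linear.rightComp k X (T.mor₂⟦l⟧'))
    (fun l ↦ Linear.rightComp k X (T.mor₃⟦l⟧' ≫ (σ l).hom)) ?_ ?_ ?_ H₁ H₃
  · intro l (f : X ⟶ T.obj₁⟦l + 1⟧)
    constructor
    · intro hf
      have hf' : f ≫ T.mor₁⟦l + 1⟧' = 0 := hf
      -- Exactness at the shifted first object is exactness at the middle of the triangle rotated
      -- twice, whose second morphism is -T.mor₁⟦1⟧. The isomorphism σ identifies the two ways of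
      -- shifting by l + 1.
      obtain ⟨g, hg⟩ : ∃ g : X ⟶ T.obj₃⟦l⟧, f ≫ (σ l).inv = g ≫ T.mor₃⟦l⟧' := exists_lift_shift _ (rot_of_distTriang _ (rot_of_distTriang _ hT)) l
        (f ≫ (σ l).inv) (by
          have : (σ l).inv ≫ T.mor₁⟦(1 : ℤ)⟧'⟦l⟧' = T.mor₁⟦l + 1⟧' ≫
              ((shiftFunctorAdd' C 1 l (l + 1) (by omega)).app T.obj₂).hom := by
            rw [Iso.inv_comp_eq, reassoc_of% (hσ l)]
            simp
          change (f ≫ (σ l).inv) ≫ (-T.mor₁⟦(1 : ℤ)⟧')⟦l⟧' = 0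
          rw [Functor.map_neg, Preadditive.comp_neg, Category.assoc, this, reassoc_of% hf',
            zero_comp, neg_zero])
      refine ⟨g, ?_⟩
      change g ≫ T.mor₃⟦l⟧' ≫ (σ l).hom = f
      rw [← Category.assoc]
      refine ((Iso.eq_comp_inv _).1 ?_)
      exact hg.symm
    · rintro ⟨(g : X ⟶ T.obj₃⟦l⟧), rfl⟩
      change (g ≫ T.mor₃⟦l⟧' ≫ (σ l).hom) ≫ T.mor₁⟦l + 1⟧' = 0
      rw [Category.assoc, Category.assoc, hσ, ← Functor.map_comp_assoc,
        comp_distTriang_mor_zero₃₁ _ hT]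
      simp
  · intro l (f : X ⟶ T.obj₂⟦l⟧)
    constructor
    · intro hf
      obtain ⟨g, hg⟩ := exists_lift_shift T hT l f hf
      exact ⟨g, hg.symm⟩
    · rintro ⟨(g : X ⟶ T.obj₁⟦l⟧), rfl⟩
      change (g ≫ T.mor₁⟦l⟧') ≫ T.mor₂⟦l⟧' = 0
      rw [Category.assoc, ← Functor.map_comp, comp_distTriang_mor_zero₁₂ _ hT]
      simp
  · intro l f
    constructor
    · intro hf
      have hf' : (f ≫ T.mor₃⟦l⟧') ≫ (σ l).hom = 0 := (Category.assoc _ _ _).trans hf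
      obtain ⟨g, hg⟩ := exists_lift_shift _ (rot_of_distTriang _ hT) l f
        ((cancel_mono (σ l).hom).1 (hf'.trans zero_comp.symm))
      exact ⟨g, hg.symm⟩
    · rintro ⟨(g : X ⟶ T.obj₂⟦l⟧), rfl⟩
      change (g ≫ T.mor₂⟦l⟧') ≫ T.mor₃⟦l⟧' ≫ (σ l).hom = 0
      rw [Category.assoc, ← Functor.map_comp_assoc, comp_distTriang_mor_zero₂₃ _ hT]
      simp

/-- Additivity in the first variable of the super dimension of graded morphism spaces. -/
theorem hasSuperDim_shiftHom_left [∀ n : ℤ, (shiftFunctor C n).Linear k] (T : Triangle C) (hT : T ∈ distTriang C) (Y : C) {χ₁ χ₃ : ℤ}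
    (H₁ : HasSuperDim k (shiftHom k T.obj₁ Y) χ₁) (H₃ : HasSuperDim k (shiftHom k T.obj₃ Y) χ₃) :
    HasSuperDim k (shiftHom k T.obj₂ Y) (χ₃ + χ₁) := by
  let σ (l : ℤ) : Y⟦l⟧⟦(1 : ℤ)⟧ ≅ Y⟦l + 1⟧ :=
    ((shiftFunctorAdd' C l 1 (l + 1) rfl).app Y).symm
  refine HasSuperDim.of_exact (fun l ↦ Linear.leftComp k (Y⟦l⟧) T.mor₂)
    (fun l ↦ Linear.leftComp k (Y⟦l⟧) T.mor₁)
    (fun l ↦ Linear.leftComp k _ T.mor₃ ∘ₗ Linear.rightComp k _ (σ l).hom ∘ₗ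
      (shiftFunctor C (1 : ℤ)).mapLinearMap k) ?_ ?_ ?_ H₃ H₁
  · intro l f
    constructor
    · intro hf
      obtain ⟨g, hg⟩ := Triangle.yoneda_exact₃ T hT f hf
      obtain ⟨g', hg'⟩ := (shiftFunctor C (1 : ℤ)).map_surjective (g ≫ (σ l).inv)
      refine ⟨g', ?_⟩
      change T.mor₃ ≫ g'⟦(1 : ℤ)⟧' ≫ (σ l).hom = f
      rw [hg', hg]
      simp
    · rintro ⟨g, rfl⟩
      change T.mor₂ ≫ T.mor₃ ≫ _ = 0
      rw [reassoc_of% (comp_distTriang_mor_zero₂₃ _ hT), zero_comp]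
  · intro l f
    constructor
    · intro hf
      obtain ⟨g, hg⟩ := Triangle.yoneda_exact₂ T hT f hf
      exact ⟨g, hg.symm⟩
    · rintro ⟨(g : T.obj₃ ⟶ Y⟦l⟧), rfl⟩
      change T.mor₁ ≫ T.mor₂ ≫ _ = 0
      rw [reassoc_of% (comp_distTriang_mor_zero₁₂ _ hT), zero_comp]
  · intro l (f : T.obj₁ ⟶ Y⟦l⟧)
    constructor
    · intro hf
      have hf' : (T.mor₃ ≫ f⟦(1 : ℤ)⟧') ≫ (σ l).hom = 0 := (Category.assoc _ _ _).trans hf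
      obtain ⟨g, hg⟩ : ∃ g : T.obj₂⟦(1 : ℤ)⟧ ⟶ Y⟦l⟧⟦(1 : ℤ)⟧,
          f⟦(1 : ℤ)⟧' = (-T.mor₁⟦(1 : ℤ)⟧') ≫ g :=
        Triangle.yoneda_exact₃ _ (rot_of_distTriang _ hT) (f⟦(1 : ℤ)⟧')
        ((cancel_mono (σ l).hom).1 (hf'.trans zero_comp.symm))
      -- The shift is full and faithful, so the factorization descends from T⟦1⟧ to T. The sign of
      -- the rotated triangle is absorbed in -g'.
      obtain ⟨g', rfl⟩ := (shiftFunctor C (1 : ℤ)).map_surjective g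
      refine ⟨-g', (shiftFunctor C (1 : ℤ)).map_injective ?_⟩
      change (T.mor₁ ≫ (-g'))⟦(1 : ℤ)⟧' = f⟦(1 : ℤ)⟧'
      rw [hg]
      simp
    · rintro ⟨(g : T.obj₂ ⟶ Y⟦l⟧), rfl⟩
      change T.mor₃ ≫ (T.mor₁ ≫ g)⟦(1 : ℤ)⟧' ≫ (σ l).hom = 0
      rw [Functor.map_comp, Category.assoc,
        reassoc_of% (comp_distTriang_mor_zero₃₁ _ hT), zero_comp]

end ShiftHom

/-! ### Euler characteristics -/

section Euler

open scoped ModuleCat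

variable {k : Type u} [Field k]

lemma isRank_finrank : IsRank (fun X : ModuleCat.{u} k ↦ Module.Finite k X)
    fun X ↦ (Module.finrank k X : ℤ) where
  add Z hZ h1 h2 h3 := by
    have hex := (ShortComplex.ShortExact.moduleCat_exact_iff_function_exact Z).1 hZ.exact
    have hinj : Function.Injective Z.f.hom := hZ.moduleCat_injective_f
    have hsurj : Function.Surjective Z.g.hom := hZ.moduleCat_surjective_g
    rw [← Z.g.hom.finrank_range_add_finrank_ker, LinearMap.range_eq_top.2 hsurj, finrank_top,
      hex.linearMap_ker_eq, LinearMap.finrank_range_of_inj hinj]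
    push_cast
    ring

lemma isReplete_finite_base : IsReplete fun X : ModuleCat.{u} k ↦ Module.Finite k X where
  zero X hX := by
    have : Subsingleton X := ModuleCat.subsingleton_of_isZero hX
    infer_instance
  iso _ _ φ _ := Module.Finite.equiv φ.toLinearEquiv

/-- The Euler-Poincaré formula. -/
theorem hasSuperDim_homology {K : CochainComplex (ModuleCat.{u} k) ℤ}
    (hK : BoundedIn (fun X ↦ Module.Finite k X) K) :
    HasSuperDim k (fun l ↦ K.homology l) (eulerSum (fun X ↦ (Module.finrank k X : ℤ)) K) := by
  refine bounded_induction isReplete_finite_base (p := fun K ↦ HasSuperDim k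
    (fun l ↦ K.homology l) (eulerSum (fun X ↦ (Module.finrank k X : ℤ)) K)) ?_ ?_ ?_ hK
  · intro M hM
    rw [isRank_finrank.eulerSum_eq_zero isReplete_finite_base hM]
    exact hasSuperDim_zero fun l ↦ ModuleCat.subsingleton_of_isZero
      ((HomologicalComplex.homologyFunctor _ _ l).map_isZero hM)
  · intro b X hX
    rw [isRank_finrank.eulerSum_single isReplete_finite_base b hX]
    let φ : ((HomologicalComplex.single (ModuleCat.{u} k) (ComplexShape.up ℤ) b).obj X).homology b
      ≅ X := (HomologicalComplex.homologyFunctorSingleIso _ (ComplexShape.up ℤ) b).app X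
    have : Module.Finite k (((HomologicalComplex.single (ModuleCat.{u} k)
        (ComplexShape.up ℤ) b).obj X).homology b) := Module.Finite.equiv φ.symm.toLinearEquiv
    rw [← φ.toLinearEquiv.finrank_eq]
    exact hasSuperDim_of_concentrated (V := fun l ↦ ((HomologicalComplex.single (ModuleCat.{u} k)
      (ComplexShape.up ℤ) b).obj X).homology l) b fun l hl ↦ ModuleCat.subsingleton_of_isZero
      (HomologicalComplex.isZero_single_obj_homology _ _ _ _ hl)
  · intro Z hZ h1 h2 h3 ih1 ih3
    rw [isRank_finrank.eulerSum_add isReplete_finite_base hZ h1 h2 h3]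
    exact HasSuperDim.of_exact (fun l ↦ (HomologicalComplex.homologyMap Z.f l).hom)
      (fun l ↦ (HomologicalComplex.homologyMap Z.g l).hom) (fun l ↦ (hZ.δ l (l + 1) rfl).hom)
      (fun l ↦ (ShortComplex.ShortExact.moduleCat_exact_iff_function_exact _).1
        (hZ.homology_exact₁ l (l + 1) rfl))
      (fun l ↦ (ShortComplex.ShortExact.moduleCat_exact_iff_function_exact _).1
        (hZ.homology_exact₂ l))
      (fun l ↦ (ShortComplex.ShortExact.moduleCat_exact_iff_function_exact _).1
        (hZ.homology_exact₃ l (l + 1) rfl)) ih1 ih3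

end Euler

/-! ### Ext of bounded complexes computed from projective terms -/

section Ext

open scoped ModuleCat

attribute [local instance] HasDerivedCategory.standard

variable (k : Type u) [Field k] {R : Type u} [Ring R] [Algebra k R]

/-- The class of finite dimensional projective modules. -/
def FDProjective (X : ModuleCat.{u} R) : Prop := Module.Finite k X ∧ Projective X

lemma isReplete_fdProjective : IsReplete (FDProjective (R := R) k) where
  zero X hX := ⟨isReplete_finite.zero X hX, hX.projective⟩
  iso _ _ φ hX := ⟨isReplete_finite.iso φ hX.1, Projective.of_iso φ hX.2⟩

/-- The dimension of the space of morphisms `X ⟶ Y`. -/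
noncomputable def homRank (X Y : ModuleCat.{u} R) : ℤ := Module.finrank k (X ⟶ Y)

lemma finite_hom (X Y : ModuleCat.{u} R) (hX : Module.Finite k X) (hY : Module.Finite k Y) :
    Module.Finite k (X ⟶ Y) := by
  let F : (X ⟶ Y) →ₗ[k] (X →ₗ[k] Y) :=
    { toFun := fun f ↦ f.hom.restrictScalars k
      map_add' := fun _ _ ↦ rfl
      map_smul' := fun _ _ ↦ rfl }
  exact Module.Finite.of_injective F fun f g h ↦ by
    ext x
    exact LinearMap.congr_fun h x

lemma isRank_homRank_right {P : ModuleCat.{u} R} (hP : FDProjective k P) :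
    IsRank (fun X : ModuleCat.{u} R ↦ Module.Finite k X) (homRank k P) where
  add Z hZ h1 h2 h3 := by
    have := hP.2
    have := finite_hom k P _ hP.1 h2
    have := hZ.mono_f
    have := hZ.epi_g
    have e := (Linear.rightComp k P Z.g).finrank_range_add_finrank_ker
    have er : LinearMap.range (Linear.rightComp k P Z.g) = ⊤ :=
      LinearMap.range_eq_top.2 fun f ↦
        ⟨Projective.factorThru f Z.g, Projective.factorThru_comp f Z.g⟩
    have ek : LinearMap.ker (Linear.rightComp k P Z.g) =
        LinearMap.range (Linear.rightComp k P Z.f) := by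
      ext f
      constructor
      · intro hf
        exact ⟨hZ.exact.lift f hf, hZ.exact.lift_f f hf⟩
      · rintro ⟨g, rfl⟩
        change (g ≫ Z.f) ≫ Z.g = 0
        rw [Category.assoc, Z.zero, Limits.comp_zero]
    rw [er, ek, finrank_top, LinearMap.finrank_range_of_inj fun f g h ↦
      (cancel_mono Z.f).1 h] at e
    unfold homRank
    omega

/-- A short exact sequence of projectives splits, so Hom(-, Y) keeps it exact without any assumption
of injectivity on Y. -/
lemma isRank_homRank_left {Y : ModuleCat.{u} R} (hY : Module.Finite k Y) :
    IsRank (FDProjective (R := R) k) fun X ↦ homRank k X Y where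
  add Z hZ h1 h2 h3 := by
    have := h3.2
    have := finite_hom k _ Y h2.1 hY
    have := hZ.mono_f
    have := hZ.epi_g
    let s := hZ.splittingOfProjective
    have e := (Linear.leftComp k Y Z.f).finrank_range_add_finrank_ker
    have er : LinearMap.range (Linear.leftComp k Y Z.f) = ⊤ :=
      LinearMap.range_eq_top.2 fun f ↦ ⟨s.r ≫ f, by
        change Z.f ≫ s.r ≫ f = f
        rw [s.f_r_assoc]⟩
    have ek : LinearMap.ker (Linear.leftComp k Y Z.f) =
        LinearMap.range (Linear.leftComp k Y Z.g) := by
      ext f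
      constructor
      · intro hf
        exact ⟨hZ.exact.desc f hf, hZ.exact.g_desc f hf⟩
      · rintro ⟨g, rfl⟩
        change Z.f ≫ Z.g ≫ g = 0
        rw [reassoc_of% Z.zero, Limits.zero_comp]
    rw [er, ek, finrank_top, LinearMap.finrank_range_of_inj fun f g h ↦
      (cancel_epi Z.g).1 h] at e
    unfold homRank
    omega

/-- The only nonzero Ext sits in degree q - p, where it is Hom(P, X). In any other degree a morphism
in the derived category comes from a chain map, by K-projectivity of P, and chain maps between
complexes concentrated in different degrees vanish. -/
lemma hasSuperDim_ext_single {P X : ModuleCat.{u} R} (hP : FDProjective k P)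
    (hX : Module.Finite k X) (p q : ℤ) :
    HasSuperDim k (ext k ((CochainComplex.singleFunctor _ p).obj P)
      ((CochainComplex.singleFunctor _ q).obj X))
      ((p.negOnePow : ℤ) * ((q.negOnePow : ℤ) * homRank k P X)) := by
  have := hP.2
  let D := DerivedCategory (ModuleCat.{u} R)
  let Y := (DerivedCategory.singleFunctor (ModuleCat.{u} R) q).obj X
  let σ (l m : ℤ) (h : l + m = q) :
      Y⟦l⟧ ≅ (DerivedCategory.singleFunctor (ModuleCat.{u} R) m).obj X :=
    ((DerivedCategory.singleFunctors (ModuleCat.{u} R)).shiftIso l m q h).app X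
  let Φ : (P ⟶ X) ≃ₗ[k] ext k ((CochainComplex.singleFunctor _ p).obj P)
      ((CochainComplex.singleFunctor _ q).obj X) (q - p) :=
    (LinearEquiv.ofBijective ((DerivedCategory.singleFunctor (ModuleCat.{u} R) p).mapLinearMap k)
      ⟨(DerivedCategory.singleFunctor (ModuleCat.{u} R) p).map_injective,
        (DerivedCategory.singleFunctor (ModuleCat.{u} R) p).map_surjective⟩).trans
      (Linear.homCongr k (Iso.refl _) (σ (q - p) p (by omega)).symm)
  have fin := finite_hom k P X hP.1 hX
  have : Module.Finite k (ext k ((CochainComplex.singleFunctor _ p).obj P)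
      ((CochainComplex.singleFunctor _ q).obj X) (q - p)) := Module.Finite.equiv Φ
  have e : (p.negOnePow : ℤ) * ((q.negOnePow : ℤ) * homRank k P X) =
      ((q - p).negOnePow : ℤ) * (Module.finrank k
        (ext k ((CochainComplex.singleFunctor _ p).obj P)
          ((CochainComplex.singleFunctor _ q).obj X) (q - p)) : ℤ) := by
    rw [← Φ.finrank_eq, Int.negOnePow_sub, Units.val_mul, homRank]
    ring
  rw [e]
  refine hasSuperDim_of_concentrated (q - p) fun l hl ↦ ?_
  refine subsingleton_of_forall_eq 0 fun f ↦ ?_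
  have hP' : ((CochainComplex.singleFunctor _ p).obj P).IsKProjective := by
    have (n : ℤ) : Projective (((CochainComplex.singleFunctor _ p).obj P).X n) :=
      ((boundedIn_single (isReplete_fdProjective k) p hP).2 n).2
    exact CochainComplex.isKProjective_of_projective _ p
  have key : ∀ g : DerivedCategory.Q.obj ((CochainComplex.singleFunctor _ p).obj P) ⟶
      DerivedCategory.Q.obj ((CochainComplex.singleFunctor _ (q - l)).obj X), g = 0 := by
    intro g
    obtain ⟨g', rfl⟩ := (CochainComplex.IsKProjective.Qh_map_bijective
      ((CochainComplex.singleFunctor _ p).obj P)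
      ((HomotopyCategory.quotient _ _).obj
        ((CochainComplex.singleFunctor _ (q - l)).obj X))).surjective g
    obtain ⟨g'', rfl⟩ := (HomotopyCategory.quotient _ _).map_surjective g'
    have : g'' = 0 := HomologicalComplex.from_single_hom_ext
      ((HomologicalComplex.isZero_single_obj_X (ComplexShape.up ℤ) (q - l) X p
        (by omega)).eq_of_tgt _ _)
    rw [this, Functor.map_zero, Functor.map_zero]
    rfl
  have := key ((show DerivedCategory.Q.obj ((CochainComplex.singleFunctor _ p).obj P) ⟶ Y⟦l⟧
    from f) ≫ (σ l (q - l) (by omega)).hom)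
  exact (cancel_mono (σ l (q - l) (by omega)).hom).1 (this.trans Limits.zero_comp.symm)

/-- The Euler form of a bounded complex of projective modules and a bounded complex, computed
from the terms. -/
theorem hasSuperDim_ext_of_projective {P N : CochainComplex (ModuleCat.{u} R) ℤ}
    (hP : BoundedIn (FDProjective k) P) (hN : IsBoundedFD k N) :
    HasSuperDim k (ext k P N) (eulerSum (fun X ↦ eulerSum (homRank k X) N) P) := by
  have hc := isReplete_fdProjective (R := R) k
  -- For fixed N the inner alternating sum is itself additive on projectives. This is what the outer
  -- induction on P needs; the case of one projective is then an induction on N.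
  have hr : IsRank (FDProjective (R := R) k) fun X ↦ eulerSum (homRank k X) N :=
    ⟨fun Z hZ h1 h2 h3 ↦ by
      rw [eulerSum, eulerSum, eulerSum, ← altSum_add
        ((isRank_homRank_right k h1).support_finite isReplete_finite hN)
        ((isRank_homRank_right k h3).support_finite isReplete_finite hN)]
      congr 1
      funext l
      exact (isRank_homRank_left k (hN.2 l)).add hZ h1 h2 h3⟩
  refine bounded_induction hc (p := fun P ↦ HasSuperDim k (ext k P N)
    (eulerSum (fun X ↦ eulerSum (homRank k X) N) P)) ?_ ?_ ?_ hP
  · intro P hP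
    rw [hr.eulerSum_eq_zero hc hP]
    exact hasSuperDim_zero fun l ↦ subsingleton_of_forall_eq 0 fun f ↦
      (DerivedCategory.Q.map_isZero hP).eq_of_src _ _
  · intro p X hX
    rw [hr.eulerSum_single hc p hX]
    have hrX := isRank_homRank_right k hX
    refine bounded_induction isReplete_finite (c := fun Y ↦ Module.Finite k Y) (p := fun N ↦
      HasSuperDim k (ext k ((CochainComplex.singleFunctor _ p).obj X) N)
      ((p.negOnePow : ℤ) * eulerSum (homRank k X) N)) ?_ ?_ ?_ hN
    · intro N hN
      rw [hrX.eulerSum_eq_zero isReplete_finite hN, mul_zero]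
      exact hasSuperDim_zero fun l ↦ subsingleton_of_forall_eq 0 fun f ↦
        (Functor.map_isZero (shiftFunctor _ l) (DerivedCategory.Q.map_isZero hN)).eq_of_tgt _ _
    · intro q Y hY
      rw [hrX.eulerSum_single isReplete_finite q hY]
      exact hasSuperDim_ext_single k hX hY p q
    · intro Z hZ h1 h2 h3 ih1 ih3
      rw [hrX.eulerSum_add isReplete_finite hZ h1 h2 h3, mul_add]
      exact hasSuperDim_shiftHom_right _ (DerivedCategory.triangleOfSES_distinguished hZ) _ ih1 ih3
  · intro Z hZ h1 h2 h3 ih1 ih3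
    rw [hr.eulerSum_add hc hZ h1 h2 h3, add_comm]
    exact hasSuperDim_shiftHom_left _ (DerivedCategory.triangleOfSES_distinguished hZ) _
      ih1 ih3

end Ext

/-! ### Resolutions by bounded complexes of finite dimensional projective modules -/

section Perfect

open scoped ModuleCat
open Pretriangulated

attribute [local instance] HasDerivedCategory.standard

variable (k : Type u) [Field k] {R : Type u} [Ring R] [Algebra k R] {ι : Type}

lemma BoundedIn.isKProjective {P : CochainComplex (ModuleCat.{u} R) ℤ}
    (hP : BoundedIn (FDProjective k) P) : P.IsKProjective := by
  obtain ⟨⟨_, b, _, _⟩, h⟩ := hP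
  have (n : ℤ) : Projective (P.X n) := (h n).2
  exact CochainComplex.isKProjective_of_projective P b

variable {k} in
lemma finite_of_shortExact {Z : ShortComplex (ModuleCat.{u} R)} (hZ : Z.ShortExact)
    (h₁ : Module.Finite k Z.X₁) (h₃ : Module.Finite k Z.X₃) : Module.Finite k Z.X₂ := by
  have hex := (ShortComplex.ShortExact.moduleCat_exact_iff_function_exact Z).1 hZ.exact
  let f : Z.X₁ →ₗ[k] Z.X₂ := Z.f.hom.restrictScalars k
  let g : Z.X₂ →ₗ[k] Z.X₃ := Z.g.hom.restrictScalars k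
  have hfg : Function.Exact f g := hex
  have : Module.Finite k (LinearMap.ker g) := by
    rw [hfg.linearMap_ker_eq]; infer_instance
  have : Module.Finite k (Z.X₂ ⧸ LinearMap.ker g) :=
    Module.Finite.equiv g.quotKerEquivRange.symm
  exact Module.Finite.of_submodule_quotient (LinearMap.ker g)

variable {k} in
lemma FDProjective.of_shortExact {Z : ShortComplex (ModuleCat.{u} R)} (hZ : Z.ShortExact)
    (h₁ : FDProjective k Z.X₁) (h₃ : FDProjective k Z.X₃) : FDProjective k Z.X₂ := by
  have := h₁.2
  have := h₃.2
  exact ⟨finite_of_shortExact hZ h₁.1 h₃.1,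
    Projective.of_iso hZ.splittingOfProjective.isoBinaryBiproduct.symm inferInstance⟩

lemma finite_of_finite [Module.Finite k R] (X : ModuleCat.{u} R) (hX : Module.Finite R X) :
    Module.Finite k X :=
  Module.Finite.trans R X

variable {k} in
/-- Every finite dimensional module over a finite dimensional algebra is a quotient of a finite
dimensional projective module. -/
lemma exists_fdProjective_cover [Module.Finite k R] (X : ModuleCat.{u} R)
    (hX : Module.Finite k X) :
    ∃ (K F : ModuleCat.{u} R) (i : K ⟶ F) (p : F ⟶ X) (w : i ≫ p = 0),
      (ShortComplex.mk i p w).ShortExact ∧ FDProjective k F ∧ Module.Finite k K := by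
  have : Module.Finite R X := Module.Finite.of_restrictScalars_finite k R X
  obtain ⟨F, hFR, hFp, p, hp⟩ : ∃ F : ModuleCat.{u} R, Module.Finite R F ∧ Projective F ∧
      ∃ p : F ⟶ X, Epi p := by
    obtain ⟨m, f, hf⟩ := Module.Finite.exists_fin' R X
    refine ⟨ModuleCat.of R (Fin m → R), inferInstanceAs (Module.Finite R (Fin m → R)), ?_,
      ModuleCat.ofHom f, (ModuleCat.epi_iff_surjective _).2 hf⟩
    rw [← IsProjective.iff_projective]
    exact inferInstanceAs (Module.Projective R (Fin m → R))
  have hF := finite_of_finite k F hFR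
  refine ⟨_, F, Limits.kernel.ι p, p, Limits.kernel.condition p,
    { exact := ShortComplex.exact_kernel p }, ⟨hF, hFp⟩, ?_⟩
  have hi : Function.Injective (Limits.kernel.ι p).hom :=
    (ModuleCat.mono_iff_injective _).1 inferInstance
  exact Module.Finite.of_injective ((Limits.kernel.ι p).hom.restrictScalars k) hi

/-- The object `Y` of the derived category is isomorphic to a bounded complex of finite dimensional
projective modules with Euler sums `d` with respect to the functions `r`. -/
def IsPerfect (r : ι → ModuleCat.{u} R → ℤ) (Y : DerivedCategory (ModuleCat.{u} R)) (d : ι → ℤ) :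
    Prop :=
  ∃ P, BoundedIn (FDProjective k) P ∧ Nonempty (DerivedCategory.Q.obj P ≅ Y) ∧
    ∀ i, eulerSum (r i) P = d i

variable {k} {r : ι → ModuleCat.{u} R → ℤ}

lemma IsPerfect.shift {Y : DerivedCategory (ModuleCat.{u} R)} {d : ι → ℤ}
    (h : IsPerfect k r Y d) (n : ℤ) : IsPerfect k r (Y⟦n⟧) fun i ↦ (n.negOnePow : ℤ) * d i := by
  obtain ⟨P, ⟨⟨a, b, _, _⟩, hP⟩, ⟨ψ⟩, hd⟩ := h
  refine ⟨P⟦n⟧, ⟨⟨a - n, b - n, P.isStrictlyGE_shift a n (a - n) (by omega),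
    P.isStrictlyLE_shift b n (b - n) (by omega)⟩, fun l ↦ hP _⟩,
    ⟨(DerivedCategory.Q.commShiftIso n).app P ≪≫ (shiftFunctor _ n).mapIso ψ⟩, fun i ↦ ?_⟩
  refine Eq.trans ?_ (congrArg _ (hd i))
  exact altSum_comp_add n fun l ↦ r i (P.X l)

/-- K-projectivity of the first resolution lifts the morphism T.mor₁ to a chain map φ between the
resolutions. Its mapping cone is isomorphic to the third object and is degreewise an extension of
P₁⟦1⟧ by P₂. -/
lemma IsPerfect.cone (hr : ∀ i, IsRank (fun X ↦ Module.Finite k X) (r i))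
    {T : Triangle (DerivedCategory (ModuleCat.{u} R))} (hT : T ∈ distTriang _) {d₁ d₂ : ι → ℤ}
    (h₁ : IsPerfect k r T.obj₁ d₁) (h₂ : IsPerfect k r T.obj₂ d₂) :
    IsPerfect k r T.obj₃ fun i ↦ d₂ i - d₁ i := by
  obtain ⟨P₁, hP₁, ⟨ψ₁⟩, hd₁⟩ := h₁
  obtain ⟨P₂, hP₂, ⟨ψ₂⟩, hd₂⟩ := h₂
  have := hP₁.isKProjective
  obtain ⟨φ', hφ'⟩ := (CochainComplex.IsKProjective.Qh_map_bijective P₁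
    ((HomotopyCategory.quotient _ _).obj P₂)).surjective (ψ₁.hom ≫ T.mor₁ ≫ ψ₂.inv)
  obtain ⟨φ, rfl⟩ := (HomotopyCategory.quotient _ _).map_surjective φ'
  have hφ : DerivedCategory.Q.map φ = ψ₁.hom ≫ T.mor₁ ≫ ψ₂.inv := hφ'
  let T' := DerivedCategory.Q.mapTriangle.obj (CochainComplex.mappingCone.triangle φ)
  have hT' : T' ∈ distTriang _ := by
    rw [DerivedCategory.mem_distTriang_iff]
    exact ⟨_, _, φ, ⟨Iso.refl _⟩⟩
  obtain ⟨e, -⟩ := exists_iso_of_arrow_iso T' T hT' hT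
    (Arrow.isoMk ψ₁ ψ₂ (by
      change ψ₁.hom ≫ T.mor₁ = DerivedCategory.Q.map φ ≫ ψ₂.hom
      rw [hφ]
      simp))
  have ses (l : ℤ) := (CochainComplex.mappingCone.triangleRotateShortComplexSplitting φ l).shortExact
  obtain ⟨⟨a₁, b₁, _, _⟩, h₁⟩ := hP₁
  obtain ⟨⟨a₂, b₂, _, _⟩, h₂⟩ := hP₂
  have s1 : BoundedIn (FDProjective k) (P₁⟦(1 : ℤ)⟧) :=
    ⟨⟨a₁ - 1, b₁ - 1, P₁.isStrictlyGE_shift a₁ 1 (a₁ - 1) (by omega),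
      P₁.isStrictlyLE_shift b₁ 1 (b₁ - 1) (by omega)⟩, fun l ↦ h₁ _⟩
  have s3 (l : ℤ) : FDProjective k ((CochainComplex.mappingCone φ).X l) :=
    FDProjective.of_shortExact (ses l) (h₂ l) (s1.2 l)
  have s2 : BoundedIn (FDProjective k) (CochainComplex.mappingCone φ) := by
    refine ⟨⟨min (a₁ - 1) a₂, max (b₁ - 1) b₂, ?_, ?_⟩, s3⟩
    · rw [CochainComplex.isStrictlyGE_iff]
      intro l hl
      rw [CochainComplex.mappingCone.isZero_X_iff]
      exact ⟨P₁.isZero_of_isStrictlyGE a₁ _ (by omega), P₂.isZero_of_isStrictlyGE a₂ _ (by omega)⟩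
    · rw [CochainComplex.isStrictlyLE_iff]
      intro l hl
      rw [CochainComplex.mappingCone.isZero_X_iff]
      exact ⟨P₁.isZero_of_isStrictlyLE b₁ _ (by omega), P₂.isZero_of_isStrictlyLE b₂ _ (by omega)⟩
  refine ⟨CochainComplex.mappingCone φ, s2, ⟨Triangle.π₃.mapIso e⟩, fun i ↦ ?_⟩
  have hb₁ : BoundedIn (fun X ↦ Module.Finite k X) (P₁⟦(1 : ℤ)⟧) := ⟨s1.1, fun l ↦ (s1.2 l).1⟩
  have hb₂ : BoundedIn (fun X ↦ Module.Finite k X) P₂ :=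
    ⟨⟨a₂, b₂, ‹_›, ‹_›⟩, fun l ↦ (h₂ l).1⟩
  have e1 : eulerSum (r i) (P₁⟦(1 : ℤ)⟧) = -d₁ i := by
    refine (altSum_comp_add 1 fun l ↦ r i (P₁.X l)).trans ?_
    rw [← hd₁ i]
    simp [eulerSum]
  change _ = d₂ i - d₁ i
  rw [← hd₂ i, sub_eq_add_neg, ← e1]
  unfold eulerSum
  rw [← altSum_add ((hr i).support_finite isReplete_finite hb₂)
    ((hr i).support_finite isReplete_finite hb₁)]
  congr 1
  funext l
  exact (hr i).add (ses l) (h₂ l).1 (s3 l).1 (s1.2 l).1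

/-- The middle object is the cone of T.obj₃⟦-1⟧ ⟶ T.obj₁; the shift turns the difference of Euler
sums into a sum. -/
lemma IsPerfect.extension (hr : ∀ i, IsRank (fun X ↦ Module.Finite k X) (r i))
    {T : Triangle (DerivedCategory (ModuleCat.{u} R))} (hT : T ∈ distTriang _) {d₁ d₃ : ι → ℤ}
    (h₁ : IsPerfect k r T.obj₁ d₁) (h₃ : IsPerfect k r T.obj₃ d₃) :
    IsPerfect k r T.obj₂ fun i ↦ d₁ i + d₃ i := by
  have h := IsPerfect.cone hr (inv_rot_of_distTriang _ hT) (h₃.shift (-1)) h₁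
  refine cast ?_ h
  congr 1
  funext i
  simp

lemma isPerfect_single_of_projective (hr : ∀ i, IsRank (fun X ↦ Module.Finite k X) (r i))
    {X : ModuleCat.{u} R} (hX : FDProjective k X) (b : ℤ) :
    IsPerfect k r (DerivedCategory.Q.obj ((CochainComplex.singleFunctor _ b).obj X))
      fun i ↦ (b.negOnePow : ℤ) * r i X :=
  ⟨_, boundedIn_single (isReplete_fdProjective k) b hX, ⟨Iso.refl _⟩,
    fun i ↦ (hr i).eulerSum_single isReplete_finite b hX.1⟩

/-- Dimension shifting: X is the cone of K → F, where F is a finite dimensional projective cover in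
the weak sense and the kernel K has smaller projective dimension. -/
lemma isPerfect_single [Module.Finite k R] (hr : ∀ i, IsRank (fun X ↦ Module.Finite k X) (r i))
    (d : ℕ) (X : ModuleCat.{u} R) (hX : Module.Finite k X) (hd : HasProjectiveDimensionLT X d)
    (b : ℤ) : IsPerfect k r (DerivedCategory.Q.obj ((CochainComplex.singleFunctor _ b).obj X))
      fun i ↦ (b.negOnePow : ℤ) * r i X := by
  induction d generalizing X with
  | zero =>
    exact isPerfect_single_of_projective hr
      ((isReplete_fdProjective k).zero X (isZero_of_hasProjectiveDimensionLT_zero X)) b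
  | succ d ih =>
    -- Projective dimension < 1 means that X is projective. Only from the bound 2 on does passing to
    -- the kernel lower it.
    obtain _ | d := d
    · exact isPerfect_single_of_projective hr
        ⟨hX, projective_iff_hasProjectiveDimensionLT_one.2 hd⟩ b
    · obtain ⟨K, F, i, p, w, hZ, hF, hK⟩ := exists_fdProjective_cover X hX
      have := hF.2
      have h1 := ih K hK ((hZ.hasProjectiveDimensionLT_X₃_iff d this).1 hd)
      have h2 := isPerfect_single_of_projective hr hF b
      have h3 := IsPerfect.cone hr (DerivedCategory.triangleOfSES_distinguished
        (hZ.map_of_exact (HomologicalComplex.single _ (ComplexShape.up ℤ) b))) h1 h2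
      refine cast ?_ h3
      congr 1
      funext i
      have := (hr i).add hZ hK hF.1 hX
      dsimp only at this
      rw [this]
      ring

/-- Bounded complexes of finite dimensional modules of finite projective dimension have
bounded resolutions by finite dimensional projective modules. -/
theorem isPerfect_of_bounded [Module.Finite k R]
    (hr : ∀ i, IsRank (fun X ↦ Module.Finite k X) (r i)) {M : CochainComplex (ModuleCat.{u} R) ℤ}
    (hM : IsBoundedFD k M) (hd : ∀ l, ∃ d, HasProjectiveDimensionLT (M.X l) d) :
    IsPerfect k r (DerivedCategory.Q.obj M) fun i ↦ eulerSum (r i) M := by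
  refine bounded_induction
    (c := fun X ↦ Module.Finite k X ∧ ∃ d, HasProjectiveDimensionLT X d)
    (p := fun M ↦ IsPerfect k r (DerivedCategory.Q.obj M) fun i ↦ eulerSum (r i) M)
    ⟨fun X hX ↦ ⟨isReplete_finite.zero X hX, 0, hX.hasProjectiveDimensionLT_zero⟩,
      fun X Y φ ⟨h, d, hd⟩ ↦ ⟨isReplete_finite.iso φ h, d,
        hasProjectiveDimensionLT_of_iso φ d⟩⟩ ?_ ?_ ?_ ⟨hM.1, fun l ↦ ⟨hM.2 l, hd l⟩⟩
  · intro M hM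
    refine ⟨M, ⟨⟨0, 0, ?_, ?_⟩, fun l ↦ (isReplete_fdProjective k).zero _
      ((HomologicalComplex.eval _ _ l).map_isZero hM)⟩, ⟨Iso.refl _⟩, fun i ↦ rfl⟩
    · rw [CochainComplex.isStrictlyGE_iff]
      exact fun l _ ↦ (HomologicalComplex.eval _ _ l).map_isZero hM
    · rw [CochainComplex.isStrictlyLE_iff]
      exact fun l _ ↦ (HomologicalComplex.eval _ _ l).map_isZero hM
  · rintro b X ⟨hX, d, hd⟩
    refine cast ?_ (isPerfect_single hr d X hX hd b)
    congr 1
    funext i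
    exact ((hr i).eulerSum_single isReplete_finite b hX).symm
  · intro Z hZ h1 h2 h3 ih1 ih3
    refine cast ?_ (IsPerfect.extension hr (DerivedCategory.triangleOfSES_distinguished hZ) ih1 ih3)
    congr 1
    funext i
    exact ((hr i).eulerSum_add isReplete_finite hZ ⟨h1.1, fun l ↦ (h1.2 l).1⟩
      ⟨h2.1, fun l ↦ (h2.2 l).1⟩ ⟨h3.1, fun l ↦ (h3.2 l).1⟩).symm

/-- A perfect complex has a resolution. -/
theorem IsPerfect.exists_projRes {M : CochainComplex (ModuleCat.{u} R) ℤ} {d : ι → ℤ}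
    (h : IsPerfect k r (DerivedCategory.Q.obj M) d) :
    ∃ ρ : ProjRes M, BoundedIn (FDProjective k) ρ.P ∧ ∀ i, eulerSum (r i) ρ.P = d i := by
  obtain ⟨P, hP, ⟨ψ⟩, hd⟩ := h
  have hK := hP.isKProjective
  obtain ⟨φ', hφ'⟩ := (CochainComplex.IsKProjective.Qh_map_bijective P
    ((HomotopyCategory.quotient _ _).obj M)).surjective ψ.hom
  obtain ⟨φ, rfl⟩ := (HomotopyCategory.quotient _ _).map_surjective φ'
  have hφ : DerivedCategory.Q.map φ = ψ.hom := hφ'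
  refine ⟨⟨P, φ, hK, ?_⟩, hP, hd⟩
  rw [← DerivedCategory.isIso_Q_map_iff_quasiIso, hφ]
  infer_instance

end Perfect

/-! ### Euler characteristics of tensor products of complexes -/

section TensorEuler

open scoped ModuleCat

variable (k : Type u) [Field k] {R : Type u} [Ring R] [Algebra k R]

variable {k} in
-- The terms of a total complex over ℤ are coproducts over the infinite index set p + q = l.
-- Boundedness leaves only finitely many nonzero summands, so the coproduct is a finite product.
lemma finrank_sigma {J : Type} (Z : J → ModuleCat.{u} k) (s : Finset J)
    (hs : ∀ i ∉ s, Subsingleton (Z i)) (hf : ∀ i, Module.Finite k (Z i)) :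
    Module.Finite k (∐ Z : ModuleCat.{u} k) ∧
      Module.finrank k (∐ Z : ModuleCat.{u} k) = ∑ i ∈ s, Module.finrank k (Z i) := by
  classical
  let F : (DirectSum J fun i ↦ Z i) →ₗ[k] ((i : s) → Z i) :=
    LinearMap.pi fun i ↦ DirectSum.component k J (fun i ↦ Z i) i
  have hF : Function.Bijective F := by
    constructor
    · intro f g h
      refine DFinsupp.ext fun i ↦ ?_
      by_cases hi : i ∈ s
      · exact congrFun h ⟨i, hi⟩
      · have := hs i hi
        exact Subsingleton.elim _ _
    · intro g
      refine ⟨DirectSum.mk (fun i ↦ Z i) s g, funext fun i ↦ ?_⟩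
      exact DFinsupp.mk_of_mem (β := fun i ↦ Z i) i.2
  let φ : (∐ Z : ModuleCat.{u} k) ≃ₗ[k] ((i : s) → Z i) :=
    (ModuleCat.coprodIsoDirectSum Z).toLinearEquiv.trans (LinearEquiv.ofBijective F hF)
  refine ⟨Module.Finite.equiv φ.symm, ?_⟩
  rw [φ.finrank_eq, Module.finrank_pi_fintype, Finset.sum_coe_sort s fun i ↦ Module.finrank k (Z i)]

/-- The dimension of the tensor product. -/
noncomputable def tensorRank (M : ModuleCat.{u} Rᵐᵒᵖ) (N : ModuleCat.{u} R) : ℤ :=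
  Module.finrank k (tensor k M N)

variable {k}

lemma finite_tensor {M : ModuleCat.{u} Rᵐᵒᵖ} {N : ModuleCat.{u} R} (hM : Module.Finite k M)
    (hN : Module.Finite k N) : Module.Finite k (tensor k M N) :=
  inferInstanceAs (Module.Finite k ((M ⊗[k] N) ⧸ balancing k M N))

lemma subsingleton_tensor_of_left {M : ModuleCat.{u} Rᵐᵒᵖ} (N : ModuleCat.{u} R)
    (hM : Limits.IsZero M) : Subsingleton (tensor k M N) := by
  have : Subsingleton M := ModuleCat.subsingleton_of_isZero hM
  have : Subsingleton (M ⊗[k] N) := inferInstance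
  exact inferInstanceAs (Subsingleton ((M ⊗[k] N) ⧸ balancing k M N))

lemma subsingleton_tensor_of_right (M : ModuleCat.{u} Rᵐᵒᵖ) {N : ModuleCat.{u} R}
    (hN : Limits.IsZero N) : Subsingleton (tensor k M N) := by
  have : Subsingleton N := ModuleCat.subsingleton_of_isZero hN
  have : Subsingleton (M ⊗[k] N) := inferInstance
  exact inferInstanceAs (Subsingleton ((M ⊗[k] N) ⧸ balancing k M N))

lemma altSum_finsetSum {J : Type} (s : Finset J) (g : J → ℤ → ℤ)
    (hg : ∀ i ∈ s, (Function.support (g i)).Finite) :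
    altSum (fun l ↦ ∑ i ∈ s, g i l) = ∑ i ∈ s, altSum (g i) := by
  classical
  induction s using Finset.induction_on with
  | empty => simp [altSum]
  | insert i s hi ih =>
    simp only [Finset.sum_insert hi]
    rw [altSum_add (hg i (by simp)), ih fun j hj ↦ hg j (by simp [hj])]
    refine (s.finite_toSet.biUnion (t := fun j ↦ Function.support (g j))
      fun j hj ↦ hg j (by simp [Finset.mem_coe.1 hj])).subset fun l hl ↦ ?_
    by_contra h
    simp only [Finset.mem_coe, Set.mem_iUnion, Function.mem_support, not_exists, ne_eq,
      not_not] at h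
    exact hl (Finset.sum_eq_zero fun j hj ↦ h j hj)

lemma finrank_tensorComplex {P : CochainComplex (ModuleCat.{u} Rᵐᵒᵖ) ℤ}
    {N : CochainComplex (ModuleCat.{u} R) ℤ} (hP : ∀ l, Module.Finite k (P.X l))
    (hN : ∀ l, Module.Finite k (N.X l)) (a b : ℤ) (hPa : P.IsStrictlyGE a)
    (hPb : P.IsStrictlyLE b) (l : ℤ) :
    Module.Finite k ((tensorComplex k P N).X l) ∧
      (Module.finrank k ((tensorComplex k P N).X l) : ℤ) =
        ∑ p ∈ Finset.Icc a b, tensorRank k (P.X p) (N.X (l - p)) := by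
  classical
  let J := ComplexShape.π (ComplexShape.up ℤ) (ComplexShape.up ℤ) (ComplexShape.up ℤ) ⁻¹' {l}
  let Z : J → ModuleCat.{u} k := fun i ↦ tensor k (P.X i.1.1) (N.X i.1.2)
  let ψ : ℤ ↪ J := ⟨fun p ↦ ⟨(p, l - p), by
    change p + (l - p) = l
    omega⟩, fun p q h ↦ congrArg (fun x : J ↦ x.1.1) h⟩
  obtain ⟨h1, h2⟩ := finrank_sigma Z ((Finset.Icc a b).map ψ) (fun i hi ↦ by
      refine subsingleton_tensor_of_left _ ?_
      have hi' : i.1.1 ∉ Finset.Icc a b := fun h ↦ hi (Finset.mem_map.2 ⟨i.1.1, h, by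
        have : i.1.1 + i.1.2 = l := i.2
        refine Subtype.ext (Prod.ext rfl ?_)
        change l - i.1.1 = i.1.2
        omega⟩)
      rw [Finset.mem_Icc, not_and_or, not_le, not_le] at hi'
      rcases hi' with h | h
      · exact P.isZero_of_isStrictlyGE a _ h
      · exact P.isZero_of_isStrictlyLE b _ h)
    (fun i ↦ finite_tensor (hP _) (hN _))
  refine ⟨h1, (congrArg Nat.cast h2).trans ?_⟩
  rw [Finset.sum_map]
  push_cast
  rfl

/-- The Euler characteristic of the tensor product of bounded complexes, computed from the terms. -/
theorem hasSuperDim_tensorComplex {P : CochainComplex (ModuleCat.{u} Rᵐᵒᵖ) ℤ}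
    {N : CochainComplex (ModuleCat.{u} R) ℤ} (hP : IsBoundedFD k P) (hN : IsBoundedFD k N) :
    HasSuperDim k (fun l ↦ (tensorComplex k P N).homology (-l))
      (eulerSum (fun X ↦ eulerSum (tensorRank k X) N) P) := by
  obtain ⟨⟨a, b, ha, hb⟩, hP⟩ := hP
  obtain ⟨⟨c, d, hc, hd⟩, hN⟩ := hN
  have hl := finrank_tensorComplex hP hN a b ha hb
  have hz : ∀ p q, q < c ∨ d < q → tensorRank k (P.X p) (N.X q) = 0 := fun p q h ↦ by
    have : Subsingleton (tensor k (P.X p) (N.X q)) := subsingleton_tensor_of_right _ (by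
      rcases h with h | h
      · exact N.isZero_of_isStrictlyGE c _ h
      · exact N.isZero_of_isStrictlyLE d _ h)
    rw [tensorRank, Module.finrank_zero_of_subsingleton, Nat.cast_zero]
  have hz' : ∀ l, l < a + c ∨ b + d < l → Limits.IsZero ((tensorComplex k P N).X l) :=
    fun l h ↦ by
    have := (hl l).1
    have e := (hl l).2
    rw [Finset.sum_eq_zero fun p hp ↦ hz p (l - p) (by rw [Finset.mem_Icc] at hp; omega),
      Nat.cast_eq_zero] at e
    have := Module.finrank_zero_iff.1 e
    exact ModuleCat.isZero_of_subsingleton _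
  have hb : BoundedIn (fun X ↦ Module.Finite k X) (tensorComplex k P N) := by
    refine ⟨⟨a + c, b + d, ?_, ?_⟩, fun l ↦ (hl l).1⟩
    · rw [CochainComplex.isStrictlyGE_iff]
      exact fun l h ↦ hz' l (Or.inl h)
    · rw [CochainComplex.isStrictlyLE_iff]
      exact fun l h ↦ hz' l (Or.inr h)
  refine cast ?_ (hasSuperDim_homology hb).comp_neg
  congr 1
  change altSum _ = altSum _
  rw [altSum_eq_sum (fun l ↦ eulerSum (tensorRank k (P.X l)) N) (Finset.Icc a b),
    funext fun l ↦ (hl l).2, altSum_finsetSum]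
  · refine Finset.sum_congr rfl fun p _ ↦ ?_
    -- Substituting q = l - p splits the sign (-1)^l into (-1)^p (-1)^q, which turns the sum over
    -- total degree into the double alternating sum.
    have := altSum_comp_add (-p) fun q ↦ tensorRank k (P.X p) (N.X q)
    rw [Int.negOnePow_neg] at this
    exact this
  · intro p _
    refine (Set.finite_Icc (p + c) (p + d)).subset fun l hl ↦ ?_
    by_contra h
    rw [Set.mem_Icc] at h
    exact hl (hz _ _ (by omega))
  · intro p hp
    have h0 : Limits.IsZero (P.X p) := by
      rw [Finset.mem_Icc, not_and_or, not_le, not_le] at hp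
      rcases hp with h | h
      · exact P.isZero_of_isStrictlyGE a _ h
      · exact P.isZero_of_isStrictlyLE b _ h
    have : (fun q ↦ tensorRank k (P.X p) (N.X q)) = fun _ ↦ 0 := funext fun q ↦ by
      have := subsingleton_tensor_of_left (k := k) (N.X q) h0
      rw [tensorRank, Module.finrank_zero_of_subsingleton, Nat.cast_zero]
    rw [eulerSum, this]
    simp [altSum]

attribute [local instance] HasDerivedCategory.standard

/-- The isomorphism of ρ.P and ρ'.P in the derived category lifts to a chain map, and a
quasi-isomorphism between K-projective complexes is a homotopy equivalence. Hence Tor, which is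
defined from an arbitrary resolution, may be computed from a bounded one. -/
lemma ProjRes.exists_homotopyEquiv {M : CochainComplex (ModuleCat.{u} R) ℤ} (ρ ρ' : ProjRes M) :
    Nonempty (HomotopyEquiv ρ.P ρ'.P) := by
  have := ρ.isKProjective
  have := ρ'.isKProjective
  have h : IsIso (DerivedCategory.Q.map ρ.π) :=
    (DerivedCategory.isIso_Q_map_iff_quasiIso _ _).2 ρ.quasiIso
  have h' : IsIso (DerivedCategory.Q.map ρ'.π) :=
    (DerivedCategory.isIso_Q_map_iff_quasiIso _ _).2 ρ'.quasiIso
  obtain ⟨f', hf'⟩ := (CochainComplex.IsKProjective.Qh_map_bijective ρ.P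
    ((HomotopyCategory.quotient _ _).obj ρ'.P)).surjective
      (DerivedCategory.Q.map ρ.π ≫ (@asIso _ _ _ _ _ h').inv)
  obtain ⟨f, rfl⟩ := (HomotopyCategory.quotient _ _).map_surjective f'
  have hf : DerivedCategory.Q.map f = DerivedCategory.Q.map ρ.π ≫
    (@asIso _ _ _ _ _ h').inv := hf'
  have hq : QuasiIso f := by
    rw [← DerivedCategory.isIso_Q_map_iff_quasiIso, hf]
    infer_instance
  obtain ⟨e, -⟩ := (CochainComplex.IsKProjective.quasiIso_iff f).1 hq
  exact ⟨e⟩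

/-- `P ⊗ N` only depends on the homotopy type of `P`. -/
noncomputable def tensorHomotopyEquiv {P P' : CochainComplex (ModuleCat.{u} Rᵐᵒᵖ) ℤ}
    (e : HomotopyEquiv P P') (N : CochainComplex (ModuleCat.{u} R) ℤ) :
    HomotopyEquiv (tensorComplex k P N) (tensorComplex k P' N) :=
  let G := ((tensorFunctor k R).map₂HomologicalComplex (ComplexShape.up ℤ) (ComplexShape.up ℤ)
    (ComplexShape.up ℤ)).flip.obj N
  { hom := G.map e.hom
    inv := G.map e.inv
    homotopyHomInvId := (Homotopy.ofEq (G.map_comp _ _).symm).trans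
      ((HomologicalComplex.mapBifunctorMapHomotopy₁ e.homotopyHomInvId (𝟙 N)
        (tensorFunctor k R) (ComplexShape.up ℤ)).trans (Homotopy.ofEq (G.map_id _)))
    homotopyInvHomId := (Homotopy.ofEq (G.map_comp _ _).symm).trans
      ((HomologicalComplex.mapBifunctorMapHomotopy₁ e.homotopyInvHomId (𝟙 N)
        (tensorFunctor k R) (ComplexShape.up ℤ)).trans (Homotopy.ofEq (G.map_id _))) }

/-- The super dimension of `Tor` can be computed from any resolution. -/
theorem hasSuperDim_tor {M : CochainComplex (ModuleCat.{u} Rᵐᵒᵖ) ℤ} (ρ ρ' : ProjRes M)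
    (hρ : IsBoundedFD k ρ.P) {N : CochainComplex (ModuleCat.{u} R) ℤ} (hN : IsBoundedFD k N) :
    HasSuperDim k (tor k ρ' N) (eulerSum (fun X ↦ eulerSum (tensorRank k X) N) ρ.P) :=
  (hasSuperDim_tensorComplex hρ hN).of_linearEquiv fun l ↦
    ⟨((tensorHomotopyEquiv (ρ.exists_homotopyEquiv ρ').some N).toHomologyIso (-l)).toLinearEquiv⟩

end TensorEuler

/-! ### Modules over algebras with a system of characters -/

section Characters

open scoped ModuleCat

variable {k : Type u} [Field k] {R : Type u} [Ring R] [Algebra k R]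

/-- The one dimensional module attached to a character. -/
noncomputable def charModule (χ : R →ₐ[k] k) : ModuleCat.{u} R :=
  letI := Module.compHom k (χ : R →+* k)
  ModuleCat.of R k

/-- The identification of `charModule χ` with `k`. -/
noncomputable def charModuleEquiv (χ : R →ₐ[k] k) : charModule χ ≃ₗ[k] k where
  toFun x := (show k from x)
  invFun x := (show k from x)
  map_add' _ _ := rfl
  map_smul' c x := by
    change χ (algebraMap k R c) * (show k from x) = c * (show k from x)
    rw [AlgHom.commutes, Algebra.algebraMap_self_apply]
  left_inv _ := rfl
  right_inv _ := rfl

lemma charModuleEquiv_smul (χ : R →ₐ[k] k) (r : R) (x : charModule χ) :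
    charModuleEquiv χ (r • x) = χ r * charModuleEquiv χ x := rfl

lemma charModule_smul (χ : R →ₐ[k] k) (r : R) (x : charModule χ) : r • x = χ r • x := by
  apply (charModuleEquiv χ).injective
  rw [charModuleEquiv_smul, map_smul, smul_eq_mul]

lemma finite_charModule (χ : R →ₐ[k] k) : Module.Finite k (charModule χ) :=
  Module.Finite.equiv (charModuleEquiv χ).symm

/-- A module which is one dimensional and on which the algebra acts by `χ` is isomorphic to
`charModule χ`. -/
lemma nonempty_iso_charModule (χ : R →ₐ[k] k) {X : ModuleCat.{u} R} (φ : X ≃ₗ[k] k)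
    (h : ∀ (r : R) (x : X), r • x = χ r • x) : Nonempty (X ≅ charModule χ) := by
  let ψ : X ≃ₗ[k] charModule χ := φ.trans (charModuleEquiv χ).symm
  let ψ' : X ≃ₗ[R] charModule χ :=
    { ψ with
      map_smul' := fun r x ↦ by
        change ψ (r • x) = r • ψ x
        rw [h, map_smul, charModule_smul] }
  exact ⟨ψ'.toModuleIso⟩

lemma lsmul_charModule (χ : R →ₐ[k] k) (f : R) :
    Algebra.lsmul k k (charModule χ) f = χ f • LinearMap.id :=
  LinearMap.ext fun x ↦ charModule_smul χ f x

lemma actionRank_charModule_of_eq_zero {χ : R →ₐ[k] k} {f : R} (h : χ f = 0) :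
    actionRank k f (charModule χ) = 0 := by
  rw [actionRank, lsmul_charModule, h, zero_smul, LinearMap.range_zero, finrank_bot]

lemma actionRank_charModule_of_ne_zero {χ : R →ₐ[k] k} {f : R} (h : χ f ≠ 0) :
    actionRank k f (charModule χ) = 1 := by
  rw [actionRank, lsmul_charModule, LinearMap.range_smul _ _ h, LinearMap.range_id, finrank_top,
    (charModuleEquiv χ).finrank_eq, Module.finrank_self]

variable {ι : Type}

/-- A family of idempotents and characters dual to each other, such that every nonzero module
has a simultaneous eigenvector for one of the characters. -/
structure IsCharacterSystem [DecidableEq ι] (f : ι → R) (χ : ι → R →ₐ[k] k) : Prop where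
  idem : ∀ a, IsIdempotentElem (f a)
  apply_eq : ∀ a b, χ a (f b) = if a = b then 1 else 0
  exists_eigenvector : ∀ (V : Type u) [AddCommGroup V] [Module R V] [Nontrivial V],
    ∃ (a : ι) (v : V), v ≠ 0 ∧ ∀ r : R, r • v = algebraMap k R (χ a r) • v

variable [DecidableEq ι] {f : ι → R} {χ : ι → R →ₐ[k] k}

/-- A simultaneous eigenvector spans a one dimensional submodule; the quotient by it has smaller
dimension and feeds the induction. -/
lemma exists_shortExact_charModule (h : IsCharacterSystem f χ) (N : ModuleCat.{u} R)
    (hN : Module.Finite k N) (hN' : Nontrivial N) :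
    ∃ (a : ι) (L Q : ModuleCat.{u} R) (i : L ⟶ N) (p : N ⟶ Q) (w : i ≫ p = 0),
      (ShortComplex.mk i p w).ShortExact ∧ Nonempty (L ≅ charModule (χ a)) ∧
        Module.Finite k Q ∧ Module.finrank k Q < Module.finrank k N := by
  obtain ⟨a, v, hv, hr⟩ := h.exists_eigenvector N
  let W : Submodule R N := Submodule.span R {v}
  have hW : ∀ x ∈ W, ∃ c : k, x = c • v := fun x hx ↦ by
    obtain ⟨r, rfl⟩ := Submodule.mem_span_singleton.1 hx
    exact ⟨χ a r, hr r⟩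
  let g : k →ₗ[k] N := LinearMap.toSpanSingleton k N v
  have hg : Function.Injective g := by
    intro c d hcd
    exact smul_left_injective k hv hcd
  let i : ModuleCat.of R W ⟶ N := ModuleCat.ofHom W.subtype
  let p : N ⟶ ModuleCat.of R (N ⧸ W) := ModuleCat.ofHom W.mkQ
  have w : i ≫ p = 0 := by
    ext x
    exact (Submodule.Quotient.mk_eq_zero W).2 x.2
  have hs : (ShortComplex.mk i p w).ShortExact :=
    { exact := (ShortComplex.ShortExact.moduleCat_exact_iff_function_exact _).2 fun x ↦ by
        change W.mkQ x = 0 ↔ x ∈ Set.range W.subtype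
        rw [Submodule.mkQ_apply, Submodule.Quotient.mk_eq_zero]
        simp
      mono_f := (ModuleCat.mono_iff_injective _).2 Subtype.val_injective
      epi_g := (ModuleCat.epi_iff_surjective _).2 W.mkQ_surjective }
  obtain ⟨L, hL⟩ : ∃ L, L = ModuleCat.of R W := ⟨_, rfl⟩
  obtain ⟨Q, hQ⟩ : ∃ Q, Q = ModuleCat.of R (N ⧸ W) := ⟨_, rfl⟩
  let ik : ModuleCat.of R W →ₗ[k] N := i.hom.restrictScalars k
  let pk : N →ₗ[k] ModuleCat.of R (N ⧸ W) := p.hom.restrictScalars k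
  have hpk : Function.Surjective pk := W.mkQ_surjective
  have hik : Function.Injective ik := Subtype.val_injective
  let g' : k →ₗ[k] ModuleCat.of R W :=
    { toFun := fun c ↦ ⟨c • v, W.smul_mem (algebraMap k R c) (Submodule.mem_span_singleton_self v)⟩
      map_add' := fun c d ↦ Subtype.ext (add_smul c d v)
      map_smul' := fun c d ↦ Subtype.ext (mul_smul c d v) }
  have hg' : Function.Bijective g' := by
    refine ⟨fun c d hcd ↦ hg (congrArg Subtype.val hcd), fun x ↦ ?_⟩
    obtain ⟨c, hc⟩ := hW x.1 x.2
    exact ⟨c, Subtype.ext hc.symm⟩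
  have hpv : pk v = 0 := (Submodule.Quotient.mk_eq_zero W).2 (Submodule.mem_span_singleton_self v)
  refine ⟨a, _, _, i, p, w, hs, nonempty_iso_charModule (χ a)
    (LinearEquiv.ofBijective g' hg').symm fun r x ↦ ?_, Module.Finite.of_surjective pk hpk, ?_⟩
  · obtain ⟨c, hc⟩ := hW x.1 x.2
    refine Subtype.ext ?_
    change r • x.1 = (χ a r) • x.1
    rw [hc, smul_comm r c v, smul_comm _ c v]
    exact congrArg _ (hr r)
  · have := pk.finrank_range_add_finrank_ker
    rw [LinearMap.range_eq_top.2 hpk, finrank_top] at this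
    have h0 : 0 < Module.finrank k (LinearMap.ker pk) := by
      have : Nontrivial (LinearMap.ker pk) := ⟨⟨v, hpv⟩, 0, fun h ↦ hv (congrArg Subtype.val h)⟩
      exact Module.finrank_pos
    omega

/-- Induction on finite dimensional modules. -/
theorem finite_module_induction (h : IsCharacterSystem f χ) {p : ModuleCat.{u} R → Prop}
    (zero : ∀ X, Limits.IsZero X → p X) (char : ∀ a, p (charModule (χ a)))
    (ext : ∀ ⦃Z : ShortComplex (ModuleCat.{u} R)⦄, Z.ShortExact → Module.Finite k Z.X₁ →
      Module.Finite k Z.X₂ → Module.Finite k Z.X₃ → p Z.X₁ → p Z.X₃ → p Z.X₂)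
    (N : ModuleCat.{u} R) (hN : Module.Finite k N) : p N := by
  obtain ⟨n, hn⟩ : ∃ n, Module.finrank k N = n := ⟨_, rfl⟩
  induction n using Nat.strong_induction_on generalizing N with
  | _ n ih =>
    rcases subsingleton_or_nontrivial N with hs | hs
    · exact zero _ (ModuleCat.isZero_of_subsingleton N)
    · obtain ⟨a, L, Q, i, q, w, hZ, ⟨φ⟩, hQ, hlt⟩ := exists_shortExact_charModule h N hN hs
      have hL : Module.Finite k L := isReplete_finite.iso φ.symm (finite_charModule _)
      refine ext hZ hL hN hQ ?_ (ih _ (hn ▸ hlt) Q hQ rfl)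
      -- The property p is not assumed invariant under isomorphism. It passes from the character
      -- module to L through the short exact sequence with zero third term.
      let O : ModuleCat.{u} R := ModuleCat.of R PUnit
      have hO : Limits.IsZero O := ModuleCat.isZero_of_subsingleton _
      exact ext (Z := ShortComplex.mk φ.inv (0 : L ⟶ O) (by simp))
        { exact := (ShortComplex.exact_iff_epi _ rfl).2 inferInstance
          mono_f := inferInstance
          epi_g := ⟨fun _ _ _ ↦ hO.eq_of_src _ _⟩ }
        (finite_charModule _) hL (isReplete_finite.zero _ hO) (char a) (zero _ hO)

/-- An additive function of finite dimensional modules is determined by its values on the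
characters. -/
theorem IsRank.eq_sum [Fintype ι] (h : IsCharacterSystem f χ) {r : ModuleCat.{u} R → ℤ}
    (hr : IsRank (fun X ↦ Module.Finite k X) r) (N : ModuleCat.{u} R) (hN : Module.Finite k N) :
    r N = ∑ a, r (charModule (χ a)) * (actionRank k (f a) N : ℤ) := by
  refine finite_module_induction h
    (p := fun N ↦ r N = ∑ a, r (charModule (χ a)) * (actionRank k (f a) N : ℤ)) ?_ ?_ ?_ N hN
  · intro X hX
    rw [hr.eq_zero isReplete_finite hX]
    refine (Finset.sum_eq_zero fun a _ ↦ ?_).symm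
    rw [(isRank_actionRank (h.idem a)).eq_zero isReplete_finite hX, mul_zero]
  · intro b
    rw [Finset.sum_eq_single b]
    · rw [actionRank_charModule_of_ne_zero (by simp [h.apply_eq]), Nat.cast_one, mul_one]
    · intro a _ hab
      rw [actionRank_charModule_of_eq_zero (by rw [h.apply_eq, if_neg (Ne.symm hab)]),
        Nat.cast_zero, mul_zero]
    · simp
  · intro Z hZ h1 h2 h3 e1 e3
    rw [hr.add hZ h1 h2 h3, e1, e3, ← Finset.sum_add_distrib]
    refine Finset.sum_congr rfl fun a _ ↦ ?_
    rw [(isRank_actionRank (h.idem a)).add hZ h1 h2 h3, mul_add]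

end Characters

/-! ### Dual modules -/

section Dual

open scoped ModuleCat

variable {k : Type u} [Field k] {T : Type u} [Ring T] [Algebra k T]
  {V : Type u} [AddCommGroup V] [Module k V]

/-- The action on the dual of a vector space on which `T` acts from the right. -/
noncomputable def dualAction (ρ : T →ₐ[k] (Module.End k V)ᵐᵒᵖ) :
    T →+* Module.End k (Module.Dual k V) where
  toFun t := (ρ t).unop.dualMap
  map_one' := by
    rw [map_one]
    rfl
  map_mul' s t := by
    rw [map_mul]
    rfl
  map_zero' := by
    rw [map_zero]
    exact LinearMap.ext fun l ↦ LinearMap.ext fun v ↦ l.map_zero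
  map_add' s t := by
    rw [map_add]
    exact LinearMap.ext fun l ↦ LinearMap.ext fun v ↦ l.map_add _ _

/-- The dual of a vector space on which `T` acts from the right, as a left `T`-module. -/
noncomputable def dualModule (ρ : T →ₐ[k] (Module.End k V)ᵐᵒᵖ) : ModuleCat.{u} T :=
  letI := Module.compHom (Module.Dual k V) (dualAction ρ)
  ModuleCat.of T (Module.Dual k V)

/-- The identification of `dualModule ρ` with the dual vector space. -/
noncomputable def dualModuleEquiv (ρ : T →ₐ[k] (Module.End k V)ᵐᵒᵖ) :
    dualModule ρ ≃ₗ[k] Module.Dual k V where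
  toFun x := (show Module.Dual k V from x)
  invFun x := (show Module.Dual k V from x)
  map_add' _ _ := rfl
  map_smul' c x := by
    change (ρ (algebraMap k T c)).unop.dualMap (show Module.Dual k V from x) =
      c • (show Module.Dual k V from x)
    rw [AlgHom.commutes]
    exact LinearMap.ext fun v ↦ LinearMap.map_smul _ c v
  left_inv _ := rfl
  right_inv _ := rfl

lemma dualModuleEquiv_smul (ρ : T →ₐ[k] (Module.End k V)ᵐᵒᵖ) (t : T) (x : dualModule ρ) (v : V) :
    dualModuleEquiv ρ (t • x) v = dualModuleEquiv ρ x ((ρ t).unop v) := rfl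

lemma finite_dualModule [Module.Finite k V] (ρ : T →ₐ[k] (Module.End k V)ᵐᵒᵖ) :
    Module.Finite k (dualModule ρ) :=
  Module.Finite.equiv (dualModuleEquiv ρ).symm

lemma actionRank_dualModule [Module.Finite k V] (ρ : T →ₐ[k] (Module.End k V)ᵐᵒᵖ) (t : T) :
    actionRank k t (dualModule ρ) = Module.finrank k (LinearMap.range (ρ t).unop) := by
  rw [← LinearMap.finrank_range_dualMap_eq_finrank_range, actionRank]
  have e : ((dualModuleEquiv ρ) : dualModule ρ →ₗ[k] Module.Dual k V) ∘ₗ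
      Algebra.lsmul k k (dualModule ρ) t = (ρ t).unop.dualMap ∘ₗ (dualModuleEquiv ρ) := rfl
  have := congrArg LinearMap.range e
  rw [LinearMap.range_comp, LinearMap.range_comp_of_range_eq_top _
    (LinearEquiv.range _)] at this
  rw [← this]
  exact ((dualModuleEquiv ρ).finrank_map_eq _).symm

/-- Morphisms to a dual module are balanced bilinear forms. -/
noncomputable def toBilinear {ρ : T →ₐ[k] (Module.End k V)ᵐᵒᵖ} {P : ModuleCat.{u} T} :
    (P ⟶ dualModule ρ) →ₗ[k] (P →ₗ[k] V →ₗ[k] k) where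
  toFun φ := (dualModuleEquiv ρ : dualModule ρ →ₗ[k] Module.Dual k V) ∘ₗ φ.hom.restrictScalars k
  map_add' _ _ := rfl
  map_smul' c φ := by
    refine LinearMap.ext fun x ↦ ?_
    exact (dualModuleEquiv ρ).map_smul c (φ.hom x)

lemma toBilinear_smul {ρ : T →ₐ[k] (Module.End k V)ᵐᵒᵖ} {P : ModuleCat.{u} T}
    (φ : P ⟶ dualModule ρ) (t : T) (x : P) (v : V) :
    toBilinear φ (t • x) v = toBilinear φ x ((ρ t).unop v) := by
  change dualModuleEquiv ρ (φ.hom (t • x)) v = _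
  rw [map_smul, dualModuleEquiv_smul]
  rfl

lemma toBilinear_injective {ρ : T →ₐ[k] (Module.End k V)ᵐᵒᵖ} {P : ModuleCat.{u} T} :
    Function.Injective (toBilinear (ρ := ρ) (P := P)) := by
  intro φ ψ h
  ext x
  exact (dualModuleEquiv ρ).injective (LinearMap.congr_fun h x)

lemma exists_toBilinear_eq {ρ : T →ₐ[k] (Module.End k V)ᵐᵒᵖ} {P : ModuleCat.{u} T}
    (b : P →ₗ[k] V →ₗ[k] k) (hb : ∀ t x v, b (t • x) v = b x ((ρ t).unop v)) :
    ∃ φ : P ⟶ dualModule ρ, toBilinear φ = b := by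
  let φ : P →ₗ[T] dualModule ρ :=
    { toFun := fun x ↦ (dualModuleEquiv ρ).symm (b x)
      map_add' := fun x y ↦ by rw [map_add, map_add]
      map_smul' := fun t x ↦ by
        apply (dualModuleEquiv ρ).injective
        refine LinearMap.ext fun v ↦ ?_
        rw [LinearEquiv.apply_symm_apply, RingHom.id_apply, dualModuleEquiv_smul,
          LinearEquiv.apply_symm_apply, hb] }
  exact ⟨ModuleCat.ofHom (X := P) (Y := dualModule ρ) φ,
    LinearMap.ext fun x ↦ (dualModuleEquiv ρ).apply_symm_apply _⟩

/-- The right action of `T` on the right ideal `f T`. -/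
noncomputable def rightIdealAction (f : T) :
    T →ₐ[k] (Module.End k (LinearMap.range (LinearMap.mulLeft k f)))ᵐᵒᵖ where
  toFun t := op ((LinearMap.mulRight k t).restrict (p := LinearMap.range (LinearMap.mulLeft k f))
    (q := LinearMap.range (LinearMap.mulLeft k f)) (by
      rintro _ ⟨x, rfl⟩
      exact ⟨x * t, (mul_assoc _ _ _).symm⟩))
  map_one' := unop_injective (LinearMap.ext fun v ↦ Subtype.ext (mul_one _))
  map_mul' s t := unop_injective (LinearMap.ext fun v ↦ Subtype.ext (mul_assoc _ _ _).symm)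
  map_zero' := unop_injective (LinearMap.ext fun v ↦ Subtype.ext (mul_zero _))
  map_add' s t := unop_injective (LinearMap.ext fun v ↦ Subtype.ext (mul_add _ _ _))
  commutes' c := unop_injective (LinearMap.ext fun v ↦ Subtype.ext (by
    change v.1 * algebraMap k T c = c • v.1
    rw [Algebra.smul_def, Algebra.commutes]))

/-- On D(f T) the element g acts by the transpose of right multiplication by g on f T, whose image
is f T g; transposition preserves rank. -/
lemma actionRank_dualModule_rightIdeal [Module.Finite k T] (f g : T) :
    actionRank k g (dualModule (rightIdealAction (k := k) f)) =
      Module.finrank k (LinearMap.range (LinearMap.mulLeftRight k (f, g))) := by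
  rw [actionRank_dualModule]
  let W := LinearMap.range (LinearMap.mulLeft k f)
  have e : LinearMap.range (LinearMap.mulLeftRight k (f, g)) =
      (LinearMap.range (rightIdealAction (k := k) f g).unop).map W.subtype := by
    ext x
    simp only [LinearMap.mem_range, Submodule.mem_map]
    constructor
    · rintro ⟨y, rfl⟩
      exact ⟨_, ⟨⟨f * y, y, rfl⟩, rfl⟩, by
        change f * y * g = _
        rw [LinearMap.mulLeftRight_apply]⟩
    · rintro ⟨_, ⟨⟨_, y, rfl⟩, rfl⟩, rfl⟩
      refine ⟨y, ?_⟩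
      rw [LinearMap.mulLeftRight_apply]
      rfl
  rw [e]
  exact (LinearEquiv.finrank_eq (Submodule.equivMapOfInjective _ W.injective_subtype _))

/-- `Hom(P, D(f T))` is the dual of `f P`. -/
lemma homRank_dualModule_rightIdeal {f : T} (hf : IsIdempotentElem f) (P : ModuleCat.{u} T) :
    homRank k P (dualModule (rightIdealAction (k := k) f)) = (actionRank k f P : ℤ) := by
  let W := LinearMap.range (LinearMap.mulLeft k f)
  let U := LinearMap.range (Algebra.lsmul k k P f)
  have hW : ∀ v : W, f * v.1 = v.1 := by
    rintro ⟨_, y, rfl⟩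
    change f * (f * y) = f * y
    rw [← mul_assoc, hf.eq]
  have hU : ∀ x : U, f • x.1 = x.1 := by
    rintro ⟨_, y, rfl⟩
    change f • (f • y) = f • y
    rw [smul_smul, hf.eq]
  let f₀ : W := ⟨f, 1, mul_one f⟩
  let F : (P ⟶ dualModule (rightIdealAction (k := k) f)) →ₗ[k] Module.Dual k U :=
    { toFun := fun φ ↦ ((toBilinear φ).flip f₀) ∘ₗ U.subtype
      map_add' := fun φ ψ ↦ by
        rw [map_add]
        rfl
      map_smul' := fun c φ ↦ by
        rw [map_smul]
        rfl }
  -- A balanced form on P × f T is determined by its values at the generator f, since b(x, v) = b(x,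
  -- f v) = b(v x, f). This identifies it with a linear form on f P.
  have key : ∀ φ (x : P) (v : W),
      toBilinear φ x v = F φ ⟨v.1 • x, v.1 • x, by
        change f • v.1 • x = _
        rw [smul_smul, hW]⟩ := fun φ x v ↦ by
    change _ = toBilinear φ (v.1 • x) f₀
    rw [toBilinear_smul]
    congr 1
    exact Subtype.ext (hW v).symm
  have hF : Function.Bijective F := by
    constructor
    · intro φ ψ h
      apply toBilinear_injective
      refine LinearMap.ext fun x ↦ LinearMap.ext fun v ↦ ?_
      rw [key, key, h]
    · intro μ
      have hm (x : P) (v : W) : v.1 • x ∈ U := ⟨v.1 • x, by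
        change f • v.1 • x = _
        rw [smul_smul, hW]⟩
      obtain ⟨φ, hφ⟩ := exists_toBilinear_eq (ρ := rightIdealAction (k := k) f) (P := P)
        (LinearMap.mk₂ k (fun x v ↦ μ ⟨v.1 • x, hm x v⟩)
          (fun x y v ↦ by
            rw [← map_add]
            congr 1
            exact Subtype.ext (smul_add _ _ _))
          (fun c x v ↦ by
            rw [← map_smul]
            congr 1
            exact Subtype.ext (smul_comm _ _ _))
          (fun x v w ↦ by
            rw [← map_add]
            congr 1
            exact Subtype.ext (add_smul _ _ _))
          (fun c x v ↦ by
            rw [← map_smul]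
            congr 1
            exact Subtype.ext (smul_assoc _ _ _)))
        (fun t x v ↦ by
          change μ _ = μ _
          congr 1
          exact Subtype.ext (smul_smul _ _ _))
      refine ⟨φ, LinearMap.ext fun x ↦ ?_⟩
      change toBilinear φ x.1 f₀ = μ x
      rw [hφ]
      change μ _ = μ _
      congr 1
      exact Subtype.ext (hU x)
  rw [homRank, (LinearEquiv.ofBijective F hF).finrank_eq, Subspace.dual_finrank_eq]
  rfl

/-! ### Duality between left and right modules -/

variable {S : Type u} [Ring S] [Algebra k S]

variable (k) in
/-- The dual of a left `S`-module, as a right `S`-module. -/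
noncomputable abbrev dualOp (N : ModuleCat.{u} S) : ModuleCat.{u} Sᵐᵒᵖ :=
  dualModule (AlgHom.op (Algebra.lsmul k k N))

variable (k) in
/-- The identification of `dualOp k N` with the dual vector space. -/
noncomputable def dualOpEquiv (N : ModuleCat.{u} S) : dualOp k N ≃ₗ[k] Module.Dual k N :=
  dualModuleEquiv _

lemma dualOpEquiv_smul (N : ModuleCat.{u} S) (s : S) (x : dualOp k N) (v : N) :
    dualOpEquiv k N (op s • x) v = dualOpEquiv k N x (s • v) := rfl

lemma finite_dualOp (N : ModuleCat.{u} S) (hN : Module.Finite k N) : Module.Finite k (dualOp k N) :=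
  finite_dualModule _

variable (k) in
/-- The transpose of a morphism of left modules. -/
noncomputable def dualOpMap {N N' : ModuleCat.{u} S} (f : N ⟶ N') : dualOp k N' ⟶ dualOp k N :=
  let f' : N →ₗ[k] N' := f.hom.restrictScalars k
  let φ : dualOp k N' →ₗ[Sᵐᵒᵖ] dualOp k N :=
    { toFun := fun x ↦ (dualOpEquiv k N).symm (f'.dualMap (dualOpEquiv k N' x))
      map_add' := fun x y ↦ by simp only [map_add]
      map_smul' := fun s x ↦ by
        apply (dualOpEquiv k N).injective
        refine LinearMap.ext fun v ↦ ?_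
        induction s with
        | h s =>
          rw [RingHom.id_apply, dualOpEquiv_smul, LinearEquiv.apply_symm_apply,
            LinearEquiv.apply_symm_apply]
          change dualOpEquiv k N' (op s • x) (f.hom v) = dualOpEquiv k N' x (f.hom (s • v))
          rw [dualOpEquiv_smul, f.hom.map_smul] }
  ModuleCat.ofHom (X := dualOp k N') (Y := dualOp k N) φ

lemma dualOpEquiv_dualOpMap {N N' : ModuleCat.{u} S} (f : N ⟶ N') (x : dualOp k N') :
    dualOpEquiv k N ((dualOpMap k f).hom x) = dualOpEquiv k N' x ∘ₗ f.hom.restrictScalars k :=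
  (dualOpEquiv k N).apply_symm_apply _

variable (k) in
/-- The transpose of a short complex of left modules. -/
noncomputable def dualOpShortComplex (Z : ShortComplex (ModuleCat.{u} S)) :
    ShortComplex (ModuleCat.{u} Sᵐᵒᵖ) :=
  ShortComplex.mk (dualOpMap k Z.g) (dualOpMap k Z.f) (by
    ext x
    apply (dualOpEquiv k _).injective
    refine LinearMap.ext fun v ↦ ?_
    change dualOpEquiv k _ ((dualOpMap k Z.f).hom ((dualOpMap k Z.g).hom x)) v =
      dualOpEquiv k _ 0 v
    rw [dualOpEquiv_dualOpMap, dualOpEquiv_dualOpMap, map_zero]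
    change dualOpEquiv k _ x (Z.g.hom (Z.f.hom v)) = 0
    have : Z.g.hom (Z.f.hom v) = 0 := ConcreteCategory.congr_hom Z.zero v
    rw [this, map_zero])

lemma dualOpShortComplex_shortExact {Z : ShortComplex (ModuleCat.{u} S)} (hZ : Z.ShortExact) :
    (dualOpShortComplex k Z).ShortExact := by
  have hex := (ShortComplex.ShortExact.moduleCat_exact_iff_function_exact Z).1 hZ.exact
  have hinj : Function.Injective Z.f.hom := hZ.moduleCat_injective_f
  have hsurj : Function.Surjective Z.g.hom := hZ.moduleCat_surjective_g
  let f : Z.X₁ →ₗ[k] Z.X₂ := Z.f.hom.restrictScalars k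
  let g : Z.X₂ →ₗ[k] Z.X₃ := Z.g.hom.restrictScalars k
  have hfg : Function.Exact f g := hex
  refine
    { exact := (ShortComplex.ShortExact.moduleCat_exact_iff_function_exact _).2
        fun (x : dualOp k Z.X₂) ↦ ?_
      mono_f := (ModuleCat.mono_iff_injective _).2 fun (x y : dualOp k Z.X₃) h ↦ ?_
      epi_g := (ModuleCat.epi_iff_surjective _).2 fun (x : dualOp k Z.X₁) ↦ ?_ }
  · change (dualOpMap k Z.f).hom x = 0 ↔ x ∈ Set.range (dualOpMap k Z.g).hom
    have h1 : (dualOpMap k Z.f).hom x = 0 ↔ dualOpEquiv k Z.X₂ x ∈ LinearMap.ker f.dualMap := by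
      rw [← (dualOpEquiv k Z.X₁).map_eq_zero_iff, dualOpEquiv_dualOpMap]
      rfl
    rw [h1, LinearMap.ker_dualMap_eq_dualAnnihilator_range, ← hfg.linearMap_ker_eq,
      ← LinearMap.range_dualMap_eq_dualAnnihilator_ker]
    constructor
    · rintro ⟨y, hy⟩
      refine ⟨(dualOpEquiv k Z.X₃).symm y, (dualOpEquiv k Z.X₂).injective ?_⟩
      rw [dualOpEquiv_dualOpMap, LinearEquiv.apply_symm_apply]
      exact hy
    · rintro ⟨y, rfl⟩
      exact ⟨dualOpEquiv k Z.X₃ y, (dualOpEquiv_dualOpMap Z.g y).symm⟩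
  · apply (dualOpEquiv k Z.X₃).injective
    have h' := congrArg (dualOpEquiv k Z.X₂) h
    change dualOpEquiv k Z.X₂ ((dualOpMap k Z.g).hom x) =
      dualOpEquiv k Z.X₂ ((dualOpMap k Z.g).hom y) at h'
    rw [dualOpEquiv_dualOpMap, dualOpEquiv_dualOpMap] at h'
    exact LinearMap.dualMap_injective_of_surjective (f := g) hsurj h'
  · obtain ⟨y, hy⟩ := LinearMap.dualMap_surjective_of_injective (f := f) hinj
      (dualOpEquiv k Z.X₁ x)
    refine ⟨(dualOpEquiv k Z.X₂).symm y, (dualOpEquiv k Z.X₁).injective ?_⟩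
    change dualOpEquiv k Z.X₁ ((dualOpMap k Z.f).hom _) = _
    rw [dualOpEquiv_dualOpMap, LinearEquiv.apply_symm_apply]
    exact hy

/-- The character of the opposite algebra given by a character. -/
def charOp (χ : S →ₐ[k] k) : Sᵐᵒᵖ →ₐ[k] k := χ.fromOpposite fun _ _ ↦ Commute.all _ _

lemma nonempty_dualOp_charModule_iso (χ : S →ₐ[k] k) :
    Nonempty (dualOp k (charModule χ) ≅ charModule (charOp χ)) := by
  refine nonempty_iso_charModule _ ((dualOpEquiv k _).trans
    ((charModuleEquiv χ).symm.dualMap.trans (LinearMap.ringLmapEquivSelf k k k))) fun s x ↦ ?_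
  induction s with
  | h s =>
    apply (dualOpEquiv k _).injective
    refine LinearMap.ext fun v ↦ ?_
    rw [dualOpEquiv_smul, charModule_smul, map_smul, map_smul]
    rfl

lemma exists_bilinear_equiv (P : ModuleCat.{u} Sᵐᵒᵖ) (N : ModuleCat.{u} S) :
    ∃ b : (P ⟶ dualOp k N) →ₗ[k] (P →ₗ[k] N →ₗ[k] k), Function.Injective b ∧
      ∀ c, c ∈ Set.range b ↔ ∀ (s : S) (x : P) (n : N), c (op s • x) n = c x (s • n) := by
  refine ⟨toBilinear, toBilinear_injective, fun c ↦
    ⟨?_, fun hc ↦ exists_toBilinear_eq c fun t x n ↦ ?_⟩⟩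
  · rintro ⟨φ, rfl⟩ s x n
    exact toBilinear_smul φ (op s) x n
  · induction t with
    | h s => exact hc s x n

/-- The dual of the tensor product is the space of morphisms to the dual. -/
lemma tensorRank_eq_homRank (P : ModuleCat.{u} Sᵐᵒᵖ) (N : ModuleCat.{u} S) :
    tensorRank k P N = homRank k P (dualOp k N) := by
  obtain ⟨b, hb, hb'⟩ := exists_bilinear_equiv (k := k) P N
  let B := balancing k P N
  let G : Module.Dual k ((P ⊗[k] N) ⧸ B) →ₗ[k] (P →ₗ[k] N →ₗ[k] k) :=
    (TensorProduct.lift.equiv (RingHom.id k) P N k).symm.toLinearMap ∘ₗ B.mkQ.dualMap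
  have hG : Function.Injective G :=
    (TensorProduct.lift.equiv (RingHom.id k) P N k).symm.injective.comp
      (LinearMap.dualMap_injective_of_surjective B.mkQ_surjective)
  have hGb : LinearMap.range G = LinearMap.range b := by
    ext c
    refine Iff.trans ?_ (hb' c).symm
    constructor
    · rintro ⟨μ, rfl⟩ s x n
      change μ (B.mkQ ((op s • x) ⊗ₜ n)) = μ (B.mkQ (x ⊗ₜ (s • n)))
      congr 1
      rw [← sub_eq_zero, ← map_sub]
      exact (Submodule.Quotient.mk_eq_zero _).2 (Submodule.subset_span ⟨x, s, n, rfl⟩)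
    · intro hc
      have hle : B ≤ LinearMap.ker (TensorProduct.lift c) := by
        refine Submodule.span_le.2 ?_
        rintro _ ⟨m, r, n, rfl⟩
        rw [SetLike.mem_coe, LinearMap.mem_ker, map_sub, TensorProduct.lift.tmul,
          TensorProduct.lift.tmul, sub_eq_zero]
        exact hc r m n
      exact ⟨B.liftQ (TensorProduct.lift c) hle, rfl⟩
  have e : Module.finrank k (Module.Dual k ((P ⊗[k] N) ⧸ B)) =
      Module.finrank k (P ⟶ dualOp k N) := by
    rw [← LinearMap.finrank_range_of_inj hG, hGb, LinearMap.finrank_range_of_inj hb]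
  rw [homRank, ← e, Subspace.dual_finrank_eq]
  rfl

/-- Exactness of P ⊗ - is read off from Hom(P, D(-)): duality is exact and Hom(P, -) is exact.
Duality reverses the sequence, whence the exchange of summands. -/
lemma isRank_tensorRank {P : ModuleCat.{u} Sᵐᵒᵖ} (hP : FDProjective k P) :
    IsRank (fun X : ModuleCat.{u} S ↦ Module.Finite k X) (tensorRank k P) where
  add Z hZ h1 h2 h3 := by
    rw [tensorRank_eq_homRank, tensorRank_eq_homRank, tensorRank_eq_homRank, add_comm]
    exact (isRank_homRank_right k hP).add (dualOpShortComplex_shortExact hZ) (finite_dualOp _ h3)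
      (finite_dualOp _ h2) (finite_dualOp _ h1)

lemma tensorRank_charModule {P : ModuleCat.{u} Sᵐᵒᵖ} (hP : FDProjective k P) (χ : S →ₐ[k] k) :
    tensorRank k P (charModule χ) = homRank k P (charModule (charOp χ)) := by
  obtain ⟨φ⟩ := nonempty_dualOp_charModule_iso χ
  rw [tensorRank_eq_homRank, (isRank_homRank_right k hP).eq_of_iso isReplete_finite φ
    (finite_dualOp _ (finite_charModule _))]

/-! ### Hom and tensor dimensions as linear functions of dimension vectors -/

section Weights

variable {ι : Type} [Fintype ι] [DecidableEq ι]

lemma homRank_eq_sum {f : ι → T} {χ : ι → T →ₐ[k] k} (h : IsCharacterSystem f χ)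
    {P : ModuleCat.{u} T} (hP : FDProjective k P) (N : ModuleCat.{u} T) (hN : Module.Finite k N) :
    homRank k P N = ∑ a, homRank k P (charModule (χ a)) * (actionRank k (f a) N : ℤ) :=
  (isRank_homRank_right k hP).eq_sum h N hN

lemma tensorRank_eq_sum {f : ι → S} {χ : ι → S →ₐ[k] k} (h : IsCharacterSystem f χ)
    {P : ModuleCat.{u} Sᵐᵒᵖ} (hP : FDProjective k P) (N : ModuleCat.{u} S)
    (hN : Module.Finite k N) :
    tensorRank k P N =
      ∑ a, homRank k P (charModule (charOp (χ a))) * (actionRank k (f a) N : ℤ) := by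
  simp only [← tensorRank_charModule hP]
  exact (isRank_tensorRank hP).eq_sum h N hN

/-- The multiplicities of a projective module determine its dimension vector via the Cartan
matrix. -/
lemma actionRank_eq_sum [Module.Finite k T] {f : ι → T} {χ : ι → T →ₐ[k] k}
    (h : IsCharacterSystem f χ) {P : ModuleCat.{u} T} (hP : FDProjective k P) (b : ι) :
    (actionRank k (f b) P : ℤ) = ∑ a, homRank k P (charModule (χ a)) *
      (Module.finrank k (LinearMap.range (LinearMap.mulLeftRight k (f b, f a))) : ℤ) := by
  -- The expansion of dim Hom(P, -) in dimension vectors is applied to the test module D(f_b T),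
  -- whose a-th dimension is dim(f_b T f_a).
  rw [← homRank_dualModule_rightIdeal (h.idem b), homRank_eq_sum h hP _ (finite_dualModule _)]
  simp only [actionRank_dualModule_rightIdeal]

end Weights

end Dual

/-! ### Characters of elementary algebras -/

section CharacterSystems

variable {k : Type u} [Field k]

section

variable {R : Type u} [Ring R] [Algebra k R] {ι : Type} [Fintype ι] [DecidableEq ι]

/-- A complete family of idempotents and a dual family of characters with nil intersection of
kernels form a character system. -/
lemma isCharacterSystem_of_isNilpotent [Module.Finite k R] {f : ι → R} {χ : ι → R →ₐ[k] k}
    (idem : ∀ a, IsIdempotentElem (f a)) (apply_eq : ∀ a b, χ a (f b) = if a = b then 1 else 0)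
    (hsum : ∑ a, f a = 1) (hnil : ∀ x, (∀ a, χ a x = 0) → IsNilpotent x) :
    IsCharacterSystem f χ := by
  refine ⟨idem, apply_eq, fun V _ _ _ ↦ ?_⟩
  have : IsArtinianRing R := IsArtinianRing.of_finite k R
  obtain ⟨v, hv⟩ := exists_ne (0 : V)
  let W : Submodule R V := Submodule.span R {v}
  have hv0 : (⟨v, Submodule.mem_span_singleton_self v⟩ : W) ≠ 0 :=
    fun h ↦ hv (congrArg Subtype.val h)
  have : Nontrivial W := ⟨_, _, hv0⟩
  -- V may be infinite dimensional, but the cyclic module W over an Artinian ring is Artinian and so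
  -- contains a simple submodule N.
  obtain ⟨N, hN, -⟩ := (IsAtomic.eq_bot_or_exists_atom_le (⊤ : Submodule R W)).resolve_left top_ne_bot
  obtain ⟨m, hm, hm0⟩ := N.exists_mem_ne_zero_of_ne_bot hN.1
  -- If x m ≠ 0, simplicity gives m = r x m for some r. All characters vanish on r x, so r x is
  -- nilpotent and m = (r x)^d m = 0.
  have hK : ∀ x : R, (∀ a, χ a x = 0) → x • m = 0 := by
    intro x hx
    by_contra hxm
    have hle : Submodule.span R {x • m} ≤ N :=
      (Submodule.span_singleton_le_iff_mem _ _).2 (N.smul_mem x hm)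
    have hmem : m ∈ Submodule.span R {x • m} := by
      rcases hN.le_iff.1 hle with h | h
      · exact absurd (Submodule.span_singleton_eq_bot.1 h) hxm
      · rw [h]
        exact hm
    obtain ⟨r, hr⟩ := Submodule.mem_span_singleton.1 hmem
    rw [smul_smul] at hr
    obtain ⟨d, hd⟩ := hnil (r * x) fun a ↦ by rw [map_mul, hx, mul_zero]
    have hp : ∀ d : ℕ, (r * x) ^ d • m = m := fun d ↦ by
      induction d with
      | zero => rw [pow_zero, one_smul]
      | succ d ih => rw [pow_succ, mul_smul, hr, ih]
    exact hm0 (by rw [← hp d, hd, zero_smul])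
  obtain ⟨a, ha⟩ : ∃ a, f a • m ≠ 0 := by
    by_contra! h
    apply hm0
    rw [← one_smul R m, ← hsum, Finset.sum_smul]
    exact Finset.sum_eq_zero fun a _ ↦ h a
  refine ⟨a, (f a • m : W), fun h ↦ ha (Subtype.ext h), fun r ↦ ?_⟩
  -- This element is killed by every character: by χ_a because χ_a(f_a) = 1, by the others because
  -- they vanish on f_a. Hence f_a m is an eigenvector for χ_a.
  have := hK (r * f a - algebraMap k R (χ a r) * f a) fun b ↦ by
    rw [map_sub, map_mul, map_mul, apply_eq, AlgHom.commutes, Algebra.algebraMap_self_apply]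
    split_ifs with hab
    · rw [hab, sub_self]
    · rw [mul_zero, mul_zero, sub_self]
  rw [sub_smul, mul_smul, mul_smul, sub_eq_zero] at this
  exact congrArg Subtype.val this

end

section

variable {B C : Type u} [Ring B] [Algebra k B] [Ring C] [Algebra k C]

/-- The product of two characters. -/
noncomputable def charTensor (χ : B →ₐ[k] k) (ψ : C →ₐ[k] k) : B ⊗[k] C →ₐ[k] k :=
  Algebra.TensorProduct.lift χ ψ fun _ _ ↦ Commute.all _ _

lemma charTensor_tmul (χ : B →ₐ[k] k) (ψ : C →ₐ[k] k) (b : B) (c : C) :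
    charTensor χ ψ (b ⊗ₜ c) = χ b * ψ c :=
  Algebra.TensorProduct.lift_tmul _ _ _ _ _

/-- The actions of B and C on V commute, so a nonzero χ_a-eigenspace of B is a C-submodule; an
eigenvector of C inside it is an eigenvector of B ⊗ C. -/
lemma IsCharacterSystem.tensor {ι κ : Type} [DecidableEq ι] [DecidableEq κ] {f : ι → B}
    {χ : ι → B →ₐ[k] k} {g : κ → C} {ψ : κ → C →ₐ[k] k} (h : IsCharacterSystem f χ)
    (h' : IsCharacterSystem g ψ) :
    IsCharacterSystem (fun p : ι × κ ↦ f p.1 ⊗ₜ[k] g p.2) fun p ↦ charTensor (χ p.1) (ψ p.2) where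
  idem p := by
    rw [IsIdempotentElem, Algebra.TensorProduct.tmul_mul_tmul, (h.idem _).eq, (h'.idem _).eq]
  apply_eq p q := by
    rw [charTensor_tmul, h.apply_eq, h'.apply_eq]
    by_cases h1 : p.1 = q.1 <;> by_cases h2 : p.2 = q.2 <;> simp [h1, h2, Prod.ext_iff]
  exists_eigenvector V _ _ _ := by
    let mB : Module B V := Module.compHom V
      (Algebra.TensorProduct.includeLeft : B →ₐ[k] B ⊗[k] C).toRingHom
    let mC : Module C V := Module.compHom V
      (Algebra.TensorProduct.includeRight : C →ₐ[k] B ⊗[k] C).toRingHom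
    obtain ⟨a, v, hv, hva⟩ := h.exists_eigenvector V
    have hva' : ∀ b : B, (b ⊗ₜ[k] (1 : C)) • v = algebraMap k (B ⊗[k] C) (χ a b) • v := hva
    let W : Submodule C V :=
      { carrier := {w | ∀ b : B, (b ⊗ₜ[k] (1 : C)) • w = algebraMap k (B ⊗[k] C) (χ a b) • w}
        add_mem' := fun {x y} hx hy b ↦ by rw [smul_add, smul_add, hx, hy]
        zero_mem' := fun b ↦ by rw [smul_zero, smul_zero]
        smul_mem' := fun c x hx b ↦ by
          change (b ⊗ₜ[k] (1 : C)) • ((1 : B) ⊗ₜ[k] c) • x =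
            algebraMap k (B ⊗[k] C) (χ a b) • ((1 : B) ⊗ₜ[k] c) • x
          rw [smul_smul, smul_smul, Algebra.commutes, mul_smul _ (algebraMap _ _ _), ← hx b,
            smul_smul]
          simp }
    have : Nontrivial W := ⟨⟨v, hva'⟩, 0, fun h ↦ hv (congrArg Subtype.val h)⟩
    obtain ⟨c, w, hw, hwc⟩ := h'.exists_eigenvector W
    have h1 : ∀ b : B, (b ⊗ₜ[k] (1 : C)) • w.1 = algebraMap k (B ⊗[k] C) (χ a b) • w.1 := w.2
    have h2 : ∀ r : C, ((1 : B) ⊗ₜ[k] r) • w.1 = algebraMap k (B ⊗[k] C) (ψ c r) • w.1 :=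
      fun r ↦ (congrArg Subtype.val (hwc r)).trans (by
        change ((1 : B) ⊗ₜ[k] algebraMap k C (ψ c r)) • w.1 = _
        rw [← Algebra.TensorProduct.algebraMap_apply'])
    refine ⟨(a, c), w.1, fun h ↦ hw (Subtype.ext h), fun r ↦ ?_⟩
    induction r using TensorProduct.induction_on with
    | zero => rw [map_zero, map_zero, zero_smul]
    | add x y hx hy => rw [map_add, map_add, add_smul, add_smul, hx, hy]
    | tmul x y =>
      have : x ⊗ₜ[k] y = (x ⊗ₜ[k] (1 : C)) * ((1 : B) ⊗ₜ[k] y) := by simp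
      rw [charTensor_tmul, this, mul_smul, h2, smul_smul, ← Algebra.commutes, mul_smul, h1,
        smul_smul, ← map_mul, mul_comm]

end

/-! ### Characters dual to a complete set of primitive idempotents -/

section Elementary

variable {A : Type u} [Ring A] [Algebra k A]

lemma isNilpotent_of_mem_jacobson [Module.Finite k A] {x : A} (hx : x ∈ Ring.jacobson A) :
    IsNilpotent x := by
  have : IsArtinianRing A := IsArtinianRing.of_finite k A
  obtain ⟨n, hn⟩ := IsSemiprimaryRing.isNilpotent (R := A)
  refine ⟨n, ?_⟩
  have := Ideal.pow_mem_pow hx n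
  rwa [hn] at this

/-- The characters of an elementary algebra dual to a complete set of primitive idempotents. -/
theorem exists_characters (hA : IsElementary k A) {n : ℕ} {e : Fin n → A}
    (he : IsCompletePrimitive e) :
    ∃ χ : Fin n → A →ₐ[k] k, (∀ a b, χ a (e b) = if a = b then 1 else 0) ∧
      ∀ x, (∀ a, χ a x = 0) → IsNilpotent x := by
  obtain ⟨hfin, m, ⟨φ⟩⟩ := hA
  let π : A →ₐ[k] (Fin m → k) := φ.toAlgHom.comp (Ideal.Quotient.mkₐ k (Ring.jacobson A))
  have hπ : Function.Surjective π := φ.surjective.comp Ideal.Quotient.mk_surjective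
  have hker : ∀ x, π x = 0 → IsNilpotent x := fun x hx ↦ by
    refine isNilpotent_of_mem_jacobson (k := k) ?_
    rw [← Ideal.Quotient.eq_zero_iff_mem]
    exact φ.injective (hx.trans (map_zero φ).symm)
  have hidem : ∀ i, IsIdempotentElem (π (e i)) := fun i ↦ by
    rw [IsIdempotentElem, ← map_mul, (he.2 i).1.eq]
  have hne : ∀ i, ∃ p, π (e i) p ≠ 0 := fun i ↦ by
    by_contra! h
    obtain ⟨d, hd⟩ := hker (e i) (funext h)
    refine (he.2 i).2.1 ?_
    rcases Nat.eq_zero_or_pos d with rfl | hd'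
    · rw [pow_zero] at hd
      rw [← mul_one (e i), hd, mul_zero]
    · rwa [(he.2 i).1.pow_eq (by omega)] at hd
  have h01 : ∀ i p, π (e i) p = 0 ∨ π (e i) p = 1 := fun i p ↦ by
    have := congrFun (hidem i).eq p
    rw [Pi.mul_apply] at this
    exact (IsIdempotentElem.iff_eq_zero_or_one).1 this
  choose q hq using hne
  have hq1 : ∀ i, π (e i) (q i) = 1 := fun i ↦ (h01 i (q i)).resolve_left (hq i)
  -- Primitivity of e_i passes to the quotient k^m by lifting idempotents. The coordinate idempotent
  -- lifts to an idempotent g orthogonal to 1 - e_i, so e_i = g + (e_i - g) is an orthogonal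
  -- decomposition. Here g = 0 is impossible, and g = e_i gives the claim.
  have hpi : ∀ i, π (e i) = Pi.single (q i) 1 := by
    intro i
    by_contra hi
    have hs : ∀ x : Fin m → k, x (q i) = 0 → Pi.single (q i) 1 * x = 0 := fun x hx ↦ by
      funext p
      by_cases hp : p = q i
      · rw [Pi.mul_apply, hp, hx, mul_zero, Pi.zero_apply]
      · rw [Pi.mul_apply, Pi.single_eq_of_ne hp, zero_mul, Pi.zero_apply]
    obtain ⟨g, hg, hgπ, h1, h2⟩ := exists_isIdempotentElem_mul_eq_zero_of_ker_isNilpotent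
      π.toRingHom (fun x hx ↦ hker x hx) (Pi.single (q i) 1) (hπ _)
      (by rw [IsIdempotentElem, ← Pi.single_mul, mul_one]) (1 - e i) (he.2 i).1.one_sub
      (by
        change _ * π (1 - e i) = 0
        rw [map_sub, map_one]
        exact hs _ (by rw [Pi.sub_apply, hq1, Pi.one_apply, sub_self]))
      (by
        change π (1 - e i) * _ = 0
        rw [map_sub, map_one, mul_comm]
        exact hs _ (by rw [Pi.sub_apply, hq1, Pi.one_apply, sub_self]))
    rw [mul_sub, mul_one, sub_eq_zero] at h1
    rw [sub_mul, one_mul, sub_eq_zero] at h2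
    rcases (he.2 i).2.2 g (e i - g) hg
      (by rw [IsIdempotentElem, sub_mul, mul_sub, mul_sub, (he.2 i).1.eq, ← h1, ← h2, hg.eq]; simp)
      (by rw [mul_sub, ← h1, hg.eq, sub_self]) (by rw [sub_mul, ← h2, hg.eq, sub_self])
      (by simp) with h | h
    · rw [h, map_zero] at hgπ
      exact one_ne_zero (by simpa using (congrFun hgπ (q i)).symm : (1 : k) = 0)
    · exact hi ((congrArg π (sub_eq_zero.1 h)).trans hgπ)
  have hqi : Function.Injective q := by
    intro i j hij
    by_contra h
    have h1 : π (e i) * π (e j) = 0 := by rw [← map_mul, he.1.ortho h, map_zero]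
    have h2 := congrFun h1 (q i)
    rw [Pi.mul_apply, hq1, hij, hq1] at h2
    simp at h2
  -- A coordinate missed by q would be zero in the image of the sum of the e_i, which is 1.
  have hqs : Function.Surjective q := by
    intro p
    by_contra! h
    have h1 := congrFun (congrArg π he.1.complete) p
    rw [map_sum, map_one, Finset.sum_apply, Finset.sum_eq_zero fun i _ ↦ by
      rw [hpi, Pi.single_eq_of_ne (h i).symm]] at h1
    simp at h1
  refine ⟨fun a ↦ (Pi.evalAlgHom k (fun _ ↦ k) (q a)).comp π, fun a b ↦ ?_, fun x hx ↦ ?_⟩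
  · change π (e b) (q a) = _
    rw [hpi, Pi.single_apply]
    simp only [hqi.eq_iff]
  · refine hker x (funext fun p ↦ ?_)
    obtain ⟨a, rfl⟩ := hqs p
    exact hx a

lemma isCharacterSystem_op [Module.Finite k A] {ι : Type} [Fintype ι] [DecidableEq ι] {f : ι → A}
    {χ : ι → A →ₐ[k] k} (idem : ∀ a, IsIdempotentElem (f a))
    (apply_eq : ∀ a b, χ a (f b) = if a = b then 1 else 0)
    (hsum : ∑ a, f a = 1) (hnil : ∀ x, (∀ a, χ a x = 0) → IsNilpotent x) :
    IsCharacterSystem (fun a ↦ op (f a)) fun a ↦ charOp (χ a) :=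
  isCharacterSystem_of_isNilpotent (fun a ↦ congrArg op (idem a)) apply_eq
    (by rw [← op_one, ← hsum, Finset.op_sum]) fun x hx ↦ by
      obtain ⟨d, hd⟩ := hnil x.unop hx
      exact ⟨d, unop_injective (by rw [unop_pow, hd, unop_zero])⟩

end Elementary

end CharacterSystems

/-! ### Finite projective dimension of left modules -/

section LeftModules

open scoped ModuleCat

variable {k : Type u} [Field k] {A : Type u} [Ring A] [Algebra k A]

/-- The dual of a projective left module is an injective right module. -/
lemma injective_dualOp (F : ModuleCat.{u} A) (hF : Projective F) : Injective (dualOp k F) where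
  factors {X Y} g f hf := by
    have hf' : Function.Injective (f.hom.restrictScalars k) := (ModuleCat.mono_iff_injective f).1 hf
    let ρ (X : ModuleCat.{u} Aᵐᵒᵖ) : A →ₐ[k] (Module.End k X)ᵐᵒᵖ :=
      (AlgHom.op (Algebra.lsmul k k X)).comp (AlgEquiv.opOp k A).toAlgHom
    -- Dualizing the mono X → Y gives an epi p : DY → DX of left modules. The map X → DF corresponds
    -- to a map F → DX; it lifts along p by projectivity of F, and the lift F → DY transposes to the
    -- required extension Y → DF.
    obtain ⟨p, hp⟩ := exists_toBilinear_eq (ρ := ρ X) (P := dualModule (ρ Y))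
      ((f.hom.restrictScalars k).dualMap ∘ₗ (dualModuleEquiv (ρ Y)).toLinearMap) (fun a y x ↦ by
        change dualModuleEquiv (ρ Y) y (op a • f.hom x) = dualModuleEquiv (ρ Y) y (f.hom (op a • x))
        rw [map_smul f.hom])
    have hp' : Epi p := (ModuleCat.epi_iff_surjective p).2 fun x ↦ by
      obtain ⟨y, hy⟩ := LinearMap.dualMap_surjective_of_injective hf' (dualModuleEquiv (ρ X) x)
      refine ⟨(dualModuleEquiv (ρ Y)).symm y, (dualModuleEquiv (ρ X)).injective ?_⟩
      change toBilinear p _ = _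
      rw [hp, ← hy]
      rfl
    obtain ⟨φ, hφ⟩ := exists_toBilinear_eq (ρ := ρ X) (P := F) (toBilinear g).flip
      fun a n x ↦ (toBilinear_smul g (op a) x n).symm
    let ψ := Projective.factorThru φ p
    have hψ : ∀ n x, toBilinear ψ n (f.hom x) = toBilinear g x n := fun n x ↦ by
      have h1 : toBilinear (ψ ≫ p) n x = toBilinear φ n x := by rw [Projective.factorThru_comp]
      rw [hφ] at h1
      refine Eq.trans ?_ h1
      change _ = toBilinear p (ψ.hom n) x
      rw [hp]
      rfl
    obtain ⟨h, hh⟩ := exists_toBilinear_eq (ρ := AlgHom.op (Algebra.lsmul k k F)) (P := Y)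
      (toBilinear ψ).flip fun a y n ↦ by
        induction a with
        | h a => exact (toBilinear_smul ψ a n y).symm
    refine ⟨h, toBilinear_injective (LinearMap.ext fun x ↦ LinearMap.ext fun n ↦ ?_)⟩
    change toBilinear h (f.hom x) n = _
    rw [hh]
    exact hψ n x

/-- A finite dimensional module with injective dual is projective. -/
lemma projective_of_injective_dualOp [Module.Finite k A] (X : ModuleCat.{u} A)
    (hX : Module.Finite k X) (h : Injective (dualOp k X)) : Projective X := by
  obtain ⟨K, F, i, p, w, hZ, ⟨hF, hFp⟩, hK⟩ := exists_fdProjective_cover X hX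
  have hD := dualOpShortComplex_shortExact (k := k) hZ
  have hm : Mono (dualOpMap k p) := hD.mono_f
  -- Injectivity of DX makes Dp a split mono. Since F is finite dimensional, the retraction
  -- transposes through F ≅ F** to a section of p.
  let r : dualOp k F ⟶ dualOp k X := Injective.factorThru (𝟙 _) (dualOpMap k p)
  have hr : dualOpMap k p ≫ r = 𝟙 _ := Injective.comp_factorThru _ _
  let R : Module.Dual k F →ₗ[k] Module.Dual k X :=
    (dualOpEquiv k X).toLinearMap ∘ₗ r.hom.restrictScalars k ∘ₗ (dualOpEquiv k F).symm.toLinearMap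
  have hR : ∀ ψ : Module.Dual k X, R (ψ ∘ₗ p.hom.restrictScalars k) = ψ := fun ψ ↦ by
    have h1 := ConcreteCategory.congr_hom hr ((dualOpEquiv k X).symm ψ)
    have h2 := congrArg (dualOpEquiv k X) h1
    change dualOpEquiv k X (r.hom ((dualOpMap k p).hom _)) = _ at h2
    refine Eq.trans ?_ (h2.trans ((dualOpEquiv k X).apply_symm_apply ψ))
    change dualOpEquiv k X (r.hom _) = _
    congr 2
  have hRA : ∀ (a : A) (φ : Module.Dual k F) (x : X),
      R φ (a • x) = R (φ ∘ₗ Algebra.lsmul k k F a) x := fun a φ x ↦ by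
    change dualOpEquiv k X (op a • r.hom ((dualOpEquiv k F).symm φ)) x = _
    rw [← map_smul r.hom]
    change _ = dualOpEquiv k X (r.hom _) x
    congr 3
  let s₀ : X →ₗ[k] F := (Module.evalEquiv k F).symm.toLinearMap ∘ₗ R.flip
  have hs₀ : ∀ (φ : Module.Dual k F) (x : X), φ (s₀ x) = R φ x := fun φ x ↦ by
    change φ ((Module.evalEquiv k F).symm (R.flip x)) = _
    rw [Module.apply_evalEquiv_symm_apply]
    rfl
  have sep : ∀ {Y : ModuleCat.{u} A} {x y : Y}, (∀ φ : Module.Dual k Y, φ x = φ y) → x = y :=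
    fun {Y x y} h ↦ by
      rw [← sub_eq_zero, ← Module.forall_dual_apply_eq_zero_iff k]
      exact fun φ ↦ by rw [map_sub, h, sub_self]
  let s : X →ₗ[A] F :=
    { s₀ with
      map_smul' := fun a x ↦ sep fun φ ↦ by
        change φ (s₀ (a • x)) = (φ ∘ₗ Algebra.lsmul k k F a) (s₀ x)
        rw [hs₀, hs₀, hRA] }
  have hs : ModuleCat.ofHom s ≫ p = 𝟙 X := by
    ext x
    refine sep fun ψ ↦ ?_
    change (ψ ∘ₗ p.hom.restrictScalars k) (s₀ x) = ψ x
    rw [hs₀, hR]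
  exact (Retract.mk (X := X) (Y := F) (ModuleCat.ofHom s) p hs).projective

/-- Dimension shifting on both sides: a cover K → F → X dualizes to DX → DF → DK with DF injective.
-/
lemma hasProjectiveDimensionLT_of_dualOp [Module.Finite k A] (d : ℕ) (X : ModuleCat.{u} A)
    (hX : Module.Finite k X) (h : HasInjectiveDimensionLT (dualOp k X) (d + 1)) :
    HasProjectiveDimensionLT X (d + 1) := by
  induction d generalizing X with
  | zero =>
    have := projective_of_injective_dualOp X hX (injective_iff_hasInjectiveDimensionLT_one.2 h)
    exact projective_iff_hasProjectiveDimensionLT_one.1 this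
  | succ d ih =>
    obtain ⟨K, F, i, p, w, hZ, ⟨hF, hFp⟩, hK⟩ := exists_fdProjective_cover X hX
    have hD := dualOpShortComplex_shortExact (k := k) hZ
    have hDF := injective_dualOp (k := k) F hFp
    have := ih K hK ((hD.hasInjectiveDimensionLT_X₃_iff d hDF).2 h)
    exact (hZ.hasProjectiveDimensionLT_X₃_iff d hFp).2 this

/-- Finite dimensional left modules over an algebra of finite (right) global dimension have finite
projective dimension. -/
theorem exists_hasProjectiveDimensionLT_left [Module.Finite k A] (h : HasFiniteGlobalDimension A) :
    ∃ d, ∀ X : ModuleCat.{u} A, Module.Finite k X → HasProjectiveDimensionLT X d := by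
  obtain ⟨d, hd⟩ := h
  refine ⟨d + 1, fun X hX ↦ hasProjectiveDimensionLT_of_dualOp d X hX ?_⟩
  let := HasExt.standard (ModuleCat.{u} Aᵐᵒᵖ)
  -- The projective dimension bound on all right modules Y kills Ext^i(Y, DX) for i > d, which
  -- bounds the injective dimension of DX.
  refine HasInjectiveDimensionLT.mk fun i hi Y e ↦ ?_
  have := hd Y
  exact e.eq_zero_of_hasProjectiveDimensionLT (d + 1) hi

end LeftModules

/-! ### External tensor products -/

section ExternalTensor

variable {k : Type u} [Field k] {B C : Type u} [Ring B] [Algebra k B] [Ring C] [Algebra k C]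

section Unbundled

variable (X : Type u) [AddCommGroup X] [Module k X] [Module B X] [IsScalarTower k B X]
  (Y : Type u) [AddCommGroup Y] [Module k Y] [Module C Y] [IsScalarTower k C Y]

/-- The module structure over `B ⊗ C` on the tensor product of a `B`-module and a `C`-module. -/
noncomputable abbrev externalModule : Module (B ⊗[k] C) (X ⊗[k] Y) :=
  Module.compHom (X ⊗[k] Y) ((Module.endTensorEndAlgHom (R := k) (S := k) (A := k) (M := X)
    (N := Y)).comp (Algebra.TensorProduct.map (Algebra.lsmul k k X) (Algebra.lsmul k k Y)) :
      B ⊗[k] C →ₐ[k] Module.End k (X ⊗[k] Y)).toRingHom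

attribute [local instance] externalModule

variable {X Y}

lemma external_smul (b : B) (c : C) (x : X) (y : Y) :
    (b ⊗ₜ[k] c) • (x ⊗ₜ[k] y) = (b • x) ⊗ₜ[k] (c • y) := rfl

variable {X' : Type u} [AddCommGroup X'] [Module k X'] [Module B X'] [IsScalarTower k B X']
  {Y' : Type u} [AddCommGroup Y'] [Module k Y'] [Module C Y'] [IsScalarTower k C Y']

/-- Functoriality of the external tensor product. -/
noncomputable def externalMap (f : X →ₗ[B] X') (g : Y →ₗ[C] Y') :
    (X ⊗[k] Y) →ₗ[B ⊗[k] C] (X' ⊗[k] Y') :=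
  { TensorProduct.map (f.restrictScalars k) (g.restrictScalars k) with
    map_smul' := fun r t ↦ by
      change TensorProduct.map (f.restrictScalars k) (g.restrictScalars k) (r • t) =
        r • TensorProduct.map (f.restrictScalars k) (g.restrictScalars k) t
      induction r using TensorProduct.induction_on with
      | zero => rw [zero_smul, zero_smul, map_zero]
      | add r s hr hs => rw [add_smul, add_smul, map_add, hr, hs]
      | tmul b c =>
        induction t using TensorProduct.induction_on with
        | zero => rw [smul_zero, map_zero, smul_zero]
        | add x y hx hy => rw [smul_add, map_add, map_add, smul_add, hx, hy]
        | tmul x y =>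
          rw [external_smul, TensorProduct.map_tmul, TensorProduct.map_tmul, external_smul]
          simp }

lemma externalMap_apply (f : X →ₗ[B] X') (g : Y →ₗ[C] Y') (t : X ⊗[k] Y) :
    externalMap f g t = TensorProduct.map (f.restrictScalars k) (g.restrictScalars k) t := rfl

lemma projective_external_finsupp (I J : Type u) :
    Module.Projective (B ⊗[k] C) ((I →₀ B) ⊗[k] (J →₀ C)) := by
  let φ := finsuppTensorFinsupp k k B C I J
  have hφ : ∀ (r : B ⊗[k] C) t, φ (r • t) = r • φ t := fun r t ↦ by
    induction r using TensorProduct.induction_on with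
    | zero => rw [zero_smul (B ⊗[k] C) t, zero_smul, map_zero]
    | add r s hr hs => rw [add_smul _ _ t, add_smul, map_add, hr, hs]
    | tmul b c =>
      induction t using TensorProduct.induction_on with
      | zero => rw [smul_zero (A := (I →₀ B) ⊗[k] (J →₀ C)), map_zero, smul_zero]
      | add x y hx hy => rw [smul_add _ x y, map_add, map_add, smul_add, hx, hy]
      | tmul x y =>
        refine Finsupp.ext fun p ↦ ?_
        rw [external_smul, Finsupp.smul_apply, finsuppTensorFinsupp_apply,
          finsuppTensorFinsupp_apply, smul_eq_mul, Algebra.TensorProduct.tmul_mul_tmul]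
        rfl
  let ψ : ((I →₀ B) ⊗[k] (J →₀ C)) ≃ₗ[B ⊗[k] C] (I × J →₀ B ⊗[k] C) :=
    { φ with map_smul' := hφ }
  exact Module.Projective.of_equiv ψ.symm

/-- X ⊗ Y is a retract of a tensor product of free modules, which is free over B ⊗ C. -/
lemma projective_external (hX : Module.Projective B X) (hY : Module.Projective C Y) :
    Module.Projective (B ⊗[k] C) (X ⊗[k] Y) := by
  obtain ⟨s, hs⟩ := hX.out
  obtain ⟨t, ht⟩ := hY.out
  have := projective_external_finsupp (k := k) (B := B) (C := C) X Y
  refine Module.Projective.of_split (externalMap s t)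
    (externalMap (Finsupp.linearCombination B id) (Finsupp.linearCombination C id)) ?_
  refine LinearMap.ext fun z ↦ ?_
  change externalMap _ _ (externalMap _ _ z) = z
  rw [externalMap_apply, externalMap_apply]
  induction z using TensorProduct.induction_on with
  | zero => rw [map_zero, map_zero]
  | add x y hx hy => rw [map_add, map_add, hx, hy]
  | tmul x y =>
    rw [TensorProduct.map_tmul, TensorProduct.map_tmul]
    exact congrArg₂ _ (hs x) (ht y)

end Unbundled

open scoped ModuleCat

attribute [local instance] externalModule

/-- The external tensor product of a `B`-module and a `C`-module. -/
noncomputable def external (k : Type u) [Field k] {B C : Type u} [Ring B] [Algebra k B] [Ring C]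
    [Algebra k C] (X : ModuleCat.{u} B) (Y : ModuleCat.{u} C) : ModuleCat.{u} (B ⊗[k] C) :=
  ModuleCat.of (B ⊗[k] C) (X ⊗[k] Y)

lemma external_shortExact_left {Z : ShortComplex (ModuleCat.{u} B)} (hZ : Z.ShortExact)
    (Y : ModuleCat.{u} C) :
    ∃ (f : external k Z.X₁ Y ⟶ external k Z.X₂ Y) (g : external k Z.X₂ Y ⟶ external k Z.X₃ Y)
      (w : f ≫ g = 0), (ShortComplex.mk f g w).ShortExact := by
  have hex := (ShortComplex.ShortExact.moduleCat_exact_iff_function_exact Z).1 hZ.exact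
  have hinj : Function.Injective Z.f.hom := hZ.moduleCat_injective_f
  have hsurj : Function.Surjective Z.g.hom := hZ.moduleCat_surjective_g
  have h1 : Function.Exact ((Z.f.hom.restrictScalars k).rTensor Y)
      ((Z.g.hom.restrictScalars k).rTensor Y) := rTensor_exact Y hex hsurj
  have h2 := LinearMap.rTensor_surjective (Q := Y) (g := Z.g.hom.restrictScalars k) hsurj
  have h3 := Module.Flat.rTensor_preserves_injective_linearMap (M := Y)
    (Z.f.hom.restrictScalars k) hinj
  refine ⟨ModuleCat.ofHom (externalMap Z.f.hom LinearMap.id),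
    ModuleCat.ofHom (externalMap Z.g.hom LinearMap.id), ?_,
    { exact := (ShortComplex.ShortExact.moduleCat_exact_iff_function_exact _).2 h1
      mono_f := (ModuleCat.mono_iff_injective _).2 h3
      epi_g := (ModuleCat.epi_iff_surjective _).2 h2 }⟩
  ext t
  exact h1.apply_apply_eq_zero t

lemma external_shortExact_right (X : ModuleCat.{u} B) {Z : ShortComplex (ModuleCat.{u} C)}
    (hZ : Z.ShortExact) :
    ∃ (f : external k X Z.X₁ ⟶ external k X Z.X₂) (g : external k X Z.X₂ ⟶ external k X Z.X₃)
      (w : f ≫ g = 0), (ShortComplex.mk f g w).ShortExact := by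
  have hex := (ShortComplex.ShortExact.moduleCat_exact_iff_function_exact Z).1 hZ.exact
  have hinj : Function.Injective Z.f.hom := hZ.moduleCat_injective_f
  have hsurj : Function.Surjective Z.g.hom := hZ.moduleCat_surjective_g
  have h1 : Function.Exact ((Z.f.hom.restrictScalars k).lTensor X)
      ((Z.g.hom.restrictScalars k).lTensor X) := lTensor_exact X hex hsurj
  have h2 := LinearMap.lTensor_surjective (Q := X) (g := Z.g.hom.restrictScalars k) hsurj
  have h3 := Module.Flat.lTensor_preserves_injective_linearMap (M := X)
    (Z.f.hom.restrictScalars k) hinj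
  refine ⟨ModuleCat.ofHom (externalMap LinearMap.id Z.f.hom),
    ModuleCat.ofHom (externalMap LinearMap.id Z.g.hom), ?_,
    { exact := (ShortComplex.ShortExact.moduleCat_exact_iff_function_exact _).2 h1
      mono_f := (ModuleCat.mono_iff_injective _).2 h3
      epi_g := (ModuleCat.epi_iff_surjective _).2 h2 }⟩
  ext t
  exact h1.apply_apply_eq_zero t

lemma exists_projective_cover {R : Type u} [Ring R] (X : ModuleCat.{u} R) :
    ∃ Z : ShortComplex (ModuleCat.{u} R), Z.ShortExact ∧ Projective Z.X₂ ∧ Z.X₃ = X :=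
  ⟨ShortComplex.mk (Limits.kernel.ι (Projective.π X)) (Projective.π X)
    (Limits.kernel.condition _),
    { exact := ShortComplex.exact_kernel _
      mono_f := inferInstance
      epi_g := inferInstance }, inferInstance, rfl⟩

/-- Subadditivity of projective dimension. Tensoring over a field is exact, so a projective cover of
one factor gives a short exact sequence of external products; the bound for X is lowered to 0 first,
and the base case is an induction on the bound for Y. -/
lemma hasProjectiveDimensionLT_external (a b : ℕ) (X : ModuleCat.{u} B) (Y : ModuleCat.{u} C)
    (hX : HasProjectiveDimensionLT X (a + 1)) (hY : HasProjectiveDimensionLT Y (b + 1)) :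
    HasProjectiveDimensionLT (external k X Y) (a + b + 1) := by
  induction a generalizing X with
  | zero =>
    have hX' := projective_iff_hasProjectiveDimensionLT_one.2 hX
    rw [zero_add]
    induction b generalizing Y with
    | zero =>
      have hY' := projective_iff_hasProjectiveDimensionLT_one.2 hY
      refine projective_iff_hasProjectiveDimensionLT_one.1 ?_
      rw [← IsProjective.iff_projective] at hX' hY'
      exact (IsProjective.iff_projective _).1 (projective_external hX' hY')
    | succ b ih =>
      obtain ⟨Z, hZ, hp, rfl⟩ := exists_projective_cover Y
      obtain ⟨f, g, w, h⟩ := external_shortExact_right (k := k) X hZ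
      have h1 := ih Z.X₁ ((hZ.hasProjectiveDimensionLT_X₃_iff b hp).1 hY)
      have h2 : HasProjectiveDimensionLT (external k X Z.X₂) (b + 1) :=
        ih Z.X₂ inferInstance
      exact h.hasProjectiveDimensionLT_X₃ (b + 1) h1
        (hasProjectiveDimensionLT_of_ge _ (b + 1) _ (by omega))
  | succ a ih =>
    obtain ⟨Z, hZ, hp, rfl⟩ := exists_projective_cover X
    obtain ⟨f, g, w, h⟩ := external_shortExact_left (k := k) hZ Y
    have h1 := ih Z.X₁ ((hZ.hasProjectiveDimensionLT_X₃_iff a hp).1 hX)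
    have h2 : HasProjectiveDimensionLT (external k Z.X₂ Y) (a + b + 1) :=
      ih Z.X₂ inferInstance
    have h3 := h.hasProjectiveDimensionLT_X₃ (a + b + 1) h1
      (hasProjectiveDimensionLT_of_ge _ (a + b + 1) _ (by omega))
    rwa [add_right_comm a 1 b]

lemma nonempty_external_charModule_iso (χ : B →ₐ[k] k) (ψ : C →ₐ[k] k) :
    Nonempty (external k (charModule χ) (charModule ψ) ≅ charModule (charTensor χ ψ)) := by
  have hs : ∀ (r : B ⊗[k] C) (t : charModule χ ⊗[k] charModule ψ),
      r • t = charTensor χ ψ r • t := fun r t ↦ by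
    induction r using TensorProduct.induction_on with
    | zero => rw [zero_smul, map_zero, zero_smul]
    | add r s hr hs => rw [add_smul, map_add, add_smul, hr, hs]
    | tmul b c =>
      induction t using TensorProduct.induction_on with
      | zero => rw [smul_zero, smul_zero]
      | add x y hx hy => rw [smul_add, smul_add, hx, hy]
      | tmul x y =>
        rw [external_smul, charTensor_tmul, charModule_smul, charModule_smul,
          TensorProduct.smul_tmul_smul]
  have hk : ∀ (c : k) (t : charModule χ ⊗[k] charModule ψ), algebraMap k (B ⊗[k] C) c • t = c • t :=
    fun c t ↦ by rw [hs, AlgHom.commutes, Algebra.algebraMap_self_apply]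
  let φ : (charModule χ ⊗[k] charModule ψ) ≃ₗ[k] k :=
    (TensorProduct.congr (charModuleEquiv χ) (charModuleEquiv ψ)).trans (TensorProduct.lid k k)
  let φ' : external k (charModule χ) (charModule ψ) ≃ₗ[k] k :=
    { φ.toAddEquiv with
      map_smul' := fun c t ↦ by
        change φ (algebraMap k (B ⊗[k] C) c • t) = c • φ t
        exact (congrArg φ (hk c t)).trans (map_smul φ c _) }
  exact nonempty_iso_charModule _ φ' fun r t ↦ (hs r t).trans (hk _ t).symm

/-- Finite dimensional modules over a tensor product of algebras with enough characters have
finite projective dimension, if this holds for the factors. -/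
theorem exists_hasProjectiveDimensionLT_tensor {ι κ : Type} [DecidableEq ι] [DecidableEq κ]
    {f : ι → B} {χ : ι → B →ₐ[k] k} {g : κ → C} {ψ : κ → C →ₐ[k] k} (h : IsCharacterSystem f χ)
    (h' : IsCharacterSystem g ψ)
    (hB : ∃ d, ∀ X : ModuleCat.{u} B, Module.Finite k X → HasProjectiveDimensionLT X d)
    (hC : ∃ d, ∀ X : ModuleCat.{u} C, Module.Finite k X → HasProjectiveDimensionLT X d) :
    ∃ d, ∀ X : ModuleCat.{u} (B ⊗[k] C), Module.Finite k X → HasProjectiveDimensionLT X d := by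
  obtain ⟨a, ha⟩ := hB
  obtain ⟨b, hb⟩ := hC
  -- A bound on projective dimension is stable under extensions, so only the character modules
  -- matter, and these are external products of character modules of the factors.
  refine ⟨a + b + 1, finite_module_induction (h.tensor h') ?_ ?_ ?_⟩
  · intro X hX
    have := hX.hasProjectiveDimensionLT_zero
    exact hasProjectiveDimensionLT_of_ge X 0 _ (by omega)
  · rintro ⟨i, j⟩
    obtain ⟨φ⟩ := nonempty_external_charModule_iso (χ i) (ψ j)
    have h1 := ha _ (finite_charModule (χ i))
    have h2 := hb _ (finite_charModule (ψ j))
    have := hasProjectiveDimensionLT_external (k := k) a b (charModule (χ i)) (charModule (ψ j))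
      (hasProjectiveDimensionLT_of_ge _ a _ (by omega))
      (hasProjectiveDimensionLT_of_ge _ b _ (by omega))
    exact hasProjectiveDimensionLT_of_iso φ _
  · intro Z hZ _ _ _ h1 h3
    exact hZ.hasProjectiveDimensionLT_X₂ _ h1 h3

end ExternalTensor

/-! ### Euler forms in terms of dimension vectors -/

section EulerForms

open scoped ModuleCat

variable {k : Type u} [Field k]

lemma eulerSum_eq_sum {R : Type u} [Ring R] {ι : Type} [Fintype ι]
    {M : CochainComplex (ModuleCat.{u} R) ℤ} {r : ModuleCat.{u} R → ℤ}
    {s : ι → ModuleCat.{u} R → ℤ} (c : ι → ℤ)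
    (hs : ∀ a, (Function.support fun l ↦ s a (M.X l)).Finite)
    (hr : ∀ l, r (M.X l) = ∑ a, c a * s a (M.X l)) :
    eulerSum r M = ∑ a, c a * eulerSum (s a) M := by
  rw [eulerSum, funext hr, altSum_finsetSum]
  · exact Finset.sum_congr rfl fun a _ ↦ altSum_mul_left _ _
  · intro a _
    refine (hs a).subset fun l hl h ↦ hl ?_
    exact mul_eq_zero_of_right _ h

lemma superRank_single {R : Type u} [Ring R] [Algebra k R] {f : R} (hf : IsIdempotentElem f)
    {X : ModuleCat.{u} R} (hX : Module.Finite k X) :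
    superRank k f ((CochainComplex.singleFunctor _ 0).obj X) = actionRank k f X := by
  refine ((isRank_actionRank hf).eulerSum_single isReplete_finite 0 hX).trans ?_
  simp

attribute [local instance] HasDerivedCategory.standard

section

variable {T : Type u} [Ring T] [Algebra k T] [Module.Finite k T] {ι : Type} [Fintype ι]
  [DecidableEq ι] {f : ι → T} {χ : ι → T →ₐ[k] k}

/-- The Cartan matrix of a family of idempotents, with entries `dim (f_b T f_a)`. -/
noncomputable def idempotentMatrix (k : Type u) [Field k] {T : Type u} [Ring T] [Algebra k T]
    {ι : Type} (f : ι → T) : Matrix ι ι ℤ :=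
  Matrix.of fun b a ↦ (Module.finrank k (LinearMap.range (LinearMap.mulLeftRight k (f b, f a))) : ℤ)

/-- Bounded complexes have bounded projective resolutions, whose multiplicities are determined by
the dimension vector. -/
lemma exists_projRes_multiplicity (h : IsCharacterSystem f χ)
    (hpd : ∃ d, ∀ X : ModuleCat.{u} T, Module.Finite k X → HasProjectiveDimensionLT X d)
    {M : CochainComplex (ModuleCat.{u} T) ℤ} (hM : IsBoundedFD k M) :
    ∃ ρ : ProjRes M, BoundedIn (FDProjective k) ρ.P ∧
      (idempotentMatrix k f *ᵥ fun a ↦ eulerSum (fun X ↦ homRank k X (charModule (χ a))) ρ.P) =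
        fun b ↦ superRank k (f b) M := by
  obtain ⟨d, hd⟩ := hpd
  -- The functions carried along the construction of the resolution are the dimensions of f_a X, so
  -- ρ.P has the same dimension vector as M.
  obtain ⟨ρ, hρ, hr⟩ := (isPerfect_of_bounded (r := fun a X ↦ (actionRank k (f a) X : ℤ))
    (fun a ↦ isRank_actionRank (h.idem a)) hM fun l ↦ ⟨d, hd _ (hM.2 l)⟩).exists_projRes
  refine ⟨ρ, hρ, funext fun b ↦ Eq.trans ?_ (hr b)⟩
  refine (eulerSum_eq_sum (fun a ↦ idempotentMatrix k f b a) (fun a ↦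
    (isRank_homRank_left k (finite_charModule (χ a))).support_finite (isReplete_fdProjective k) hρ)
    fun l ↦ ?_).symm
  rw [actionRank_eq_sum h (hρ.2 l)]
  exact Finset.sum_congr rfl fun a _ ↦ mul_comm _ _

/-- The vector t is independent of N and specified only by a linear system, so that the result
serves both right A-modules and bimodules before any matrix is inverted. -/
theorem exists_hasSuperDim_ext (h : IsCharacterSystem f χ)
    (hpd : ∃ d, ∀ X : ModuleCat.{u} T, Module.Finite k X → HasProjectiveDimensionLT X d)
    {M : CochainComplex (ModuleCat.{u} T) ℤ} (hM : IsBoundedFD k M) :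
    ∃ t : ι → ℤ, (idempotentMatrix k f *ᵥ t = fun b ↦ superRank k (f b) M) ∧
      ∀ N : CochainComplex (ModuleCat.{u} T) ℤ, IsBoundedFD k N →
        HasSuperDim k (ext k M N) (t ⬝ᵥ fun a ↦ superRank k (f a) N) := by
  obtain ⟨ρ, hρ, ht⟩ := exists_projRes_multiplicity h hpd hM
  refine ⟨_, ht, fun N hN ↦ ?_⟩
  have hi : IsIso (DerivedCategory.Q.map ρ.π) :=
    (DerivedCategory.isIso_Q_map_iff_quasiIso _ _).2 ρ.quasiIso
  refine cast ?_ ((hasSuperDim_ext_of_projective k hρ hN).shiftHom_of_iso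
    (@asIso _ _ _ _ _ hi) (Iso.refl _))
  change HasSuperDim k (ext k M N) _ = _
  congr 1
  rw [eulerSum_eq_sum (s := fun a X ↦ homRank k X (charModule (χ a)))
    (fun a ↦ superRank k (f a) N) (fun a ↦
    (isRank_homRank_left k (finite_charModule (χ a))).support_finite (isReplete_fdProjective k) hρ)]
  · exact Finset.sum_congr rfl fun a _ ↦ mul_comm _ _
  · intro l
    refine (eulerSum_eq_sum (s := fun a Y ↦ (actionRank k (f a) Y : ℤ))
      (fun a ↦ homRank k (ρ.P.X l) (charModule (χ a))) (fun a ↦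
      (isRank_actionRank (h.idem a)).support_finite isReplete_finite hN) fun m ↦
      homRank_eq_sum h (hρ.2 l) _ (hN.2 m)).trans ?_
    exact Finset.sum_congr rfl fun a _ ↦ mul_comm _ _

/-- The dimension vectors of the character modules are the unit vectors. Their multiplicity vectors
are therefore the columns of an integral right inverse. -/
lemma isUnit_det_idempotentMatrix (h : IsCharacterSystem f χ)
    (hpd : ∃ d, ∀ X : ModuleCat.{u} T, Module.Finite k X → HasProjectiveDimensionLT X d) :
    IsUnit (idempotentMatrix k f).det := by
  have (a : ι) : ∃ t : ι → ℤ, (idempotentMatrix k f *ᵥ t) = Pi.single a 1 := by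
    obtain ⟨ρ, -, ht⟩ := exists_projRes_multiplicity h hpd
      (boundedIn_single isReplete_finite 0 (finite_charModule (χ a)))
    refine ⟨_, ht.trans (funext fun b ↦ ?_)⟩
    rw [superRank_single (h.idem b) (finite_charModule _)]
    by_cases hab : b = a
    · rw [actionRank_charModule_of_ne_zero (by rw [h.apply_eq, if_pos hab.symm]; exact one_ne_zero),
        hab, Pi.single_eq_same, Nat.cast_one]
    · rw [actionRank_charModule_of_eq_zero (by rw [h.apply_eq, if_neg (Ne.symm hab)]),
        Pi.single_eq_of_ne hab, Nat.cast_zero]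
  choose t ht using this
  refine Matrix.isUnit_det_of_right_inverse (B := (Matrix.of t)ᵀ) (Matrix.ext fun b a ↦ ?_)
  have := congrFun (ht a) b
  rw [Pi.single_apply] at this
  rw [Matrix.one_apply]
  exact this

end

theorem exists_hasSuperDim_tor {S : Type u} [Ring S] [Algebra k S] [Module.Finite k S] {ι : Type}
    [Fintype ι] [DecidableEq ι] {f : ι → S} {χ : ι → S →ₐ[k] k} (h : IsCharacterSystem f χ)
    (h' : IsCharacterSystem (fun a ↦ op (f a)) fun a ↦ charOp (χ a))
    (hpd : ∃ d, ∀ X : ModuleCat.{u} Sᵐᵒᵖ, Module.Finite k X → HasProjectiveDimensionLT X d)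
    {M : CochainComplex (ModuleCat.{u} Sᵐᵒᵖ) ℤ} (hM : IsBoundedFD k M) :
    Nonempty (ProjRes M) ∧ ∃ t : ι → ℤ,
      (idempotentMatrix k (fun a ↦ op (f a)) *ᵥ t = fun b ↦ superRank k (op (f b)) M) ∧
      ∀ (N : CochainComplex (ModuleCat.{u} S) ℤ) (ρ : ProjRes M), IsBoundedFD k N →
        HasSuperDim k (tor k ρ N) (t ⬝ᵥ fun a ↦ superRank k (f a) N) := by
  obtain ⟨ρ, hρ, ht⟩ := exists_projRes_multiplicity h' hpd hM
  refine ⟨⟨ρ⟩, _, ht, fun N ρ' hN ↦ ?_⟩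
  refine cast ?_ (hasSuperDim_tor ρ ρ' ⟨hρ.1, fun l ↦ (hρ.2 l).1⟩ hN)
  congr 1
  rw [eulerSum_eq_sum (s := fun a X ↦ homRank k X (charModule (charOp (χ a))))
    (fun a ↦ superRank k (f a) N) (fun a ↦
    (isRank_homRank_left k (finite_charModule _)).support_finite (isReplete_fdProjective k) hρ)]
  · exact Finset.sum_congr rfl fun a _ ↦ mul_comm _ _
  · intro l
    refine (eulerSum_eq_sum (s := fun a Y ↦ (actionRank k (f a) Y : ℤ))
      (fun a ↦ homRank k (ρ.P.X l) (charModule (charOp (χ a)))) (fun a ↦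
      (isRank_actionRank (h.idem a)).support_finite isReplete_finite hN) fun m ↦
      tensorRank_eq_sum h (hρ.2 l) _ (hN.2 m)).trans ?_
    exact Finset.sum_congr rfl fun a _ ↦ mul_comm _ _

end EulerForms

/-! ### Transport along isomorphisms and dimension formulas -/

section Transport

open scoped ModuleCat

variable {k : Type u} [Field k] {T S : Type u} [Ring T] [Algebra k T] [Ring S] [Algebra k S]

/-- Used to pass to the opposite of the enveloping algebra, which `envSwap` identifies with the
enveloping algebra itself at the price of exchanging the two indices. -/
lemma IsCharacterSystem.of_algEquiv {ι κ : Type} [DecidableEq ι] [DecidableEq κ] {f : ι → S}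
    {χ : ι → S →ₐ[k] k} (h : IsCharacterSystem f χ) (σ : T ≃ₐ[k] S) (τ : κ ≃ ι) {g : κ → T}
    {ψ : κ → T →ₐ[k] k} (hg : ∀ b, σ (g b) = f (τ b)) (hψ : ∀ b t, ψ b t = χ (τ b) (σ t)) :
    IsCharacterSystem g ψ where
  idem b := σ.injective (by rw [map_mul, hg, (h.idem _).eq])
  apply_eq a b := by
    rw [hψ, hg, h.apply_eq]
    simp only [τ.injective.eq_iff]
  exists_eigenvector V _ _ _ := by
    let : Module S V := Module.compHom V (σ.symm : S →+* T)
    obtain ⟨a, v, hv, hr⟩ := h.exists_eigenvector V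
    refine ⟨τ.symm a, v, hv, fun t ↦ ?_⟩
    have := hr (σ t)
    change σ.symm (σ t) • v = σ.symm (algebraMap k S _) • v at this
    rw [hψ, τ.apply_symm_apply]
    rwa [σ.symm_apply_apply, AlgEquiv.commutes] at this

attribute [local instance] RingHomInvPair.of_ringEquiv in
lemma exists_hasProjectiveDimensionLT_of_algEquiv (σ : T ≃ₐ[k] S)
    (h : ∃ d, ∀ X : ModuleCat.{u} S, Module.Finite k X → HasProjectiveDimensionLT X d) :
    ∃ d, ∀ X : ModuleCat.{u} T, Module.Finite k X → HasProjectiveDimensionLT X d := by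
  obtain ⟨d, hd⟩ := h
  refine ⟨d + 1, fun X hX ↦ ?_⟩
  let e : S ≃+* T := σ.symm.toRingEquiv
  obtain ⟨Y, φ, hφ⟩ : ∃ (Y : ModuleCat.{u} S) (φ : Y ≃+ X), ∀ (s : S) y, φ (s • y) = e s • φ y := by
    let : Module S X := Module.compHom X (e : S →+* T)
    exact ⟨ModuleCat.of S X, AddEquiv.refl X, fun _ _ ↦ rfl⟩
  let φk : Y ≃ₗ[k] X :=
    { φ with
      map_smul' := fun c y ↦ by
        refine (hφ (algebraMap k S c) y).trans ?_
        change σ.symm (algebraMap k S c) • φ y = algebraMap k T c • φ y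
        rw [AlgEquiv.commutes] }
  have hY : HasProjectiveDimensionLT Y d := hd Y (Module.Finite.equiv φk.symm)
  have hY' : HasProjectiveDimensionLE Y d := hasProjectiveDimensionLT_of_ge Y d (d + 1) (by omega)
  let φs : Y ≃ₛₗ[RingHomClass.toRingHom e] X := { φ with map_smul' := hφ }
  exact ModuleCat.hasProjectiveDimensionLE_of_semiLinearEquiv e φs d

lemma actionRank_of_linearEquiv {V : Type u} [AddCommGroup V] [Module k V] {X : ModuleCat.{u} T}
    (φ : V ≃ₗ[k] X) (f : T) (g : V →ₗ[k] V) (h : ∀ v, f • φ v = φ (g v)) :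
    actionRank k f X = Module.finrank k (LinearMap.range g) := by
  have e : Algebra.lsmul k k X f ∘ₗ φ.toLinearMap = φ.toLinearMap ∘ₗ g := LinearMap.ext h
  have := congrArg LinearMap.range e
  rw [LinearMap.range_comp_of_range_eq_top _ (LinearEquiv.range _), LinearMap.range_comp] at this
  rw [actionRank, this]
  exact φ.finrank_map_eq _

lemma finrank_range_mulLeftRight_op (a b : T) :
    Module.finrank k (LinearMap.range (LinearMap.mulLeftRight k (op a, op b))) =
      Module.finrank k (LinearMap.range (LinearMap.mulLeftRight k (b, a))) := by
  have e : LinearMap.mulLeftRight k (op a, op b) ∘ₗ (opLinearEquiv k : T ≃ₗ[k] Tᵐᵒᵖ).toLinearMap =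
      (opLinearEquiv k : T ≃ₗ[k] Tᵐᵒᵖ).toLinearMap ∘ₗ LinearMap.mulLeftRight k (b, a) :=
    LinearMap.ext fun x ↦ by
      change LinearMap.mulLeftRight k (op a, op b) (op x) = op (LinearMap.mulLeftRight k (b, a) x)
      rw [LinearMap.mulLeftRight_apply, LinearMap.mulLeftRight_apply, ← op_mul, ← op_mul, mul_assoc]
  have := congrArg LinearMap.range e
  rw [LinearMap.range_comp_of_range_eq_top _ (LinearEquiv.range _), LinearMap.range_comp] at this
  rw [this]
  exact (opLinearEquiv k : T ≃ₗ[k] Tᵐᵒᵖ).finrank_map_eq _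

/-- By flatness over a field, the image of f ⊗ g is the tensor product of the images. This makes the
Cartan matrix of a tensor product of algebras a Kronecker product. -/
lemma finrank_range_tensorMap {V W V' W' : Type u} [AddCommGroup V] [Module k V] [AddCommGroup W]
    [Module k W] [AddCommGroup V'] [Module k V'] [AddCommGroup W'] [Module k W']
    (f : V →ₗ[k] V') (g : W →ₗ[k] W') :
    Module.finrank k (LinearMap.range (TensorProduct.map f g)) =
      Module.finrank k (LinearMap.range f) * Module.finrank k (LinearMap.range g) := by
  have e : TensorProduct.map f g = TensorProduct.map f.range.subtype g.range.subtype ∘ₗ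
      TensorProduct.map f.rangeRestrict g.rangeRestrict := by
    rw [← TensorProduct.map_comp]
    rfl
  have hs : Function.Surjective (TensorProduct.map f.rangeRestrict g.rangeRestrict) :=
    TensorProduct.map_surjective f.surjective_rangeRestrict g.surjective_rangeRestrict
  have hi : Function.Injective (TensorProduct.map f.range.subtype g.range.subtype) := by
    have : TensorProduct.map f.range.subtype g.range.subtype =
        (f.range.subtype).rTensor W' ∘ₗ (g.range.subtype).lTensor f.range := by
      rw [LinearMap.rTensor_comp_lTensor]
    rw [this]
    exact (Module.Flat.rTensor_preserves_injective_linearMap _ f.range.injective_subtype).comp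
      (Module.Flat.lTensor_preserves_injective_linearMap _ g.range.injective_subtype)
  rw [e, LinearMap.range_comp_of_range_eq_top _ (LinearMap.range_eq_top.2 hs),
    LinearMap.finrank_range_of_inj hi, Module.finrank_tensorProduct]

lemma finrank_range_mulLeftRight_tmul (a b : T) (c d : S) :
    Module.finrank k (LinearMap.range (LinearMap.mulLeftRight k (a ⊗ₜ[k] c, b ⊗ₜ[k] d))) =
      Module.finrank k (LinearMap.range (LinearMap.mulLeftRight k (a, b))) *
        Module.finrank k (LinearMap.range (LinearMap.mulLeftRight k (c, d))) := by
  have e : LinearMap.mulLeftRight k (a ⊗ₜ[k] c, b ⊗ₜ[k] d) =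
      TensorProduct.map (LinearMap.mulLeftRight k (a, b)) (LinearMap.mulLeftRight k (c, d)) :=
    TensorProduct.ext' fun x y ↦ by
      rw [TensorProduct.map_tmul, LinearMap.mulLeftRight_apply, LinearMap.mulLeftRight_apply,
        LinearMap.mulLeftRight_apply, Algebra.TensorProduct.tmul_mul_tmul,
        Algebra.TensorProduct.tmul_mul_tmul]
  rw [e, finrank_range_tensorMap]

end Transport

/-! ### The diagonal bimodule -/

section Diagonal

open scoped ModuleCat

variable {k : Type u} [Field k] {A : Type u} [Ring A] [Algebra k A]

/-- Replacing A by an isomorphic copy X keeps the bimodule action apart from the other module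
structures on A. -/
lemma exists_diagLeft : ∃ (X : ModuleCat.{u} (A ⊗[k] Aᵐᵒᵖ)) (φ : A ≃ₗ[k] X),
    (diagLeft k A = (CochainComplex.singleFunctor _ 0).obj X) ∧
      ∀ a b x, (a ⊗ₜ[k] op b) • φ x = φ (a * x * b) := by
  obtain ⟨X, φ, h, hφ⟩ : ∃ (X : ModuleCat.{u} (A ⊗[k] Aᵐᵒᵖ)) (φ : A ≃+ X),
      (diagLeft k A = (CochainComplex.singleFunctor _ 0).obj X) ∧
        ∀ a b x, (a ⊗ₜ[k] op b) • φ x = φ (a * x * b) := by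
    let : Module (A ⊗[k] Aᵐᵒᵖ) A := TensorProduct.Algebra.module
    exact ⟨ModuleCat.of _ A, AddEquiv.refl A, rfl, fun a b x ↦ diagLeft_smul k A a b x⟩
  refine ⟨X, { φ with map_smul' := fun c x ↦ ?_ }, h, hφ⟩
  refine Eq.trans ?_ (hφ (algebraMap k A c) 1 x).symm
  change φ (c • x) = _
  rw [mul_one, Algebra.smul_def]

lemma exists_diagRight : ∃ (X : ModuleCat.{u} (A ⊗[k] Aᵐᵒᵖ)ᵐᵒᵖ) (φ : A ≃ₗ[k] X),
    (diagRight k A = (CochainComplex.singleFunctor _ 0).obj X) ∧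
      ∀ a b x, op (a ⊗ₜ[k] op b) • φ x = φ (b * x * a) := by
  obtain ⟨X, φ, h, hφ⟩ : ∃ (X : ModuleCat.{u} (A ⊗[k] Aᵐᵒᵖ)ᵐᵒᵖ) (φ : A ≃+ X),
      (diagRight k A = (CochainComplex.singleFunctor _ 0).obj X) ∧
        ∀ a b x, op (a ⊗ₜ[k] op b) • φ x = φ (b * x * a) := by
    let := rightEnvModule k A
    exact ⟨ModuleCat.of _ A, AddEquiv.refl A, rfl, fun a b x ↦ rightEnvModule_smul k A a b x⟩
  refine ⟨X, { φ with map_smul' := fun c x ↦ ?_ }, h, hφ⟩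
  refine Eq.trans ?_ (hφ (algebraMap k A c) 1 x).symm
  change φ (c • x) = _
  rw [one_mul, Algebra.smul_def, Algebra.commutes]

variable [Module.Finite k A]

lemma isBoundedFD_diagLeft : IsBoundedFD k (diagLeft k A) := by
  obtain ⟨X, φ, h, -⟩ := exists_diagLeft (k := k) (A := A)
  rw [h]
  exact boundedIn_single isReplete_finite 0 (Module.Finite.equiv φ)

lemma isBoundedFD_diagRight : IsBoundedFD k (diagRight k A) := by
  obtain ⟨X, φ, h, -⟩ := exists_diagRight (k := k) (A := A)
  rw [h]
  exact boundedIn_single isReplete_finite 0 (Module.Finite.equiv φ)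

lemma superRank_diagLeft {e f : A} (he : IsIdempotentElem e) (hf : IsIdempotentElem f) :
    superRank k (e ⊗ₜ[k] op f) (diagLeft k A) =
      Module.finrank k (LinearMap.range (LinearMap.mulLeftRight k (e, f))) := by
  obtain ⟨X, φ, h, hφ⟩ := exists_diagLeft (k := k) (A := A)
  have hi : IsIdempotentElem (e ⊗ₜ[k] op f) := by
    rw [IsIdempotentElem, Algebra.TensorProduct.tmul_mul_tmul, he.eq, ← op_mul, hf.eq]
  rw [h, superRank_single hi (Module.Finite.equiv φ),
    actionRank_of_linearEquiv φ _ (LinearMap.mulLeftRight k (e, f)) fun v ↦ by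
      rw [hφ, LinearMap.mulLeftRight_apply]]

lemma superRank_diagRight {e f : A} (he : IsIdempotentElem e) (hf : IsIdempotentElem f) :
    superRank k (op (e ⊗ₜ[k] op f)) (diagRight k A) =
      Module.finrank k (LinearMap.range (LinearMap.mulLeftRight k (f, e))) := by
  obtain ⟨X, φ, h, hφ⟩ := exists_diagRight (k := k) (A := A)
  have hi : IsIdempotentElem (op (e ⊗ₜ[k] op f)) := by
    rw [IsIdempotentElem, ← op_mul, Algebra.TensorProduct.tmul_mul_tmul, he.eq, ← op_mul, hf.eq]
  rw [h, superRank_single hi (Module.Finite.equiv φ),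
    actionRank_of_linearEquiv φ _ (LinearMap.mulLeftRight k (f, e)) fun v ↦ by
      rw [hφ, LinearMap.mulLeftRight_apply]]

end Diagonal

/-! ### Inverting the Cartan matrix and assembling the formulas -/

lemma eq_inv_of_mul_mul_eq {n : ℕ} {C X : Matrix (Fin n) (Fin n) ℤ} (hC : IsUnit C.det)
    (h : C * X * C = C) : X = C⁻¹ := by
  have h1 : C⁻¹ * (C * X * C) * C⁻¹ = C⁻¹ * C * C⁻¹ := by rw [h]
  rwa [Matrix.mul_assoc C X C, ← Matrix.mul_assoc, Matrix.nonsing_inv_mul _ hC, Matrix.one_mul,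
    Matrix.mul_assoc, Matrix.mul_nonsing_inv _ hC, Matrix.mul_one, Matrix.one_mul] at h1

section Main

open scoped ModuleCat

/-- The Hirzebruch-Riemann-Roch theorem for elementary algebras of finite global dimension. -/
theorem hirzebruchRiemannRoch {k : Type u} [Field k] {A : Type u} [Ring A] [Algebra k A]
    (hA : IsElementary k A) (hgl : HasFiniteGlobalDimension A)
    {n : ℕ} (e : Fin n → A) (he : IsCompletePrimitive e) :
    IsUnit (cartanMatrix k e).det ∧
    (∀ M N : CochainComplex (ModuleCat.{u} Aᵐᵒᵖ) ℤ,
      IsBoundedFD k M → IsBoundedFD k N →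
        HasSuperDim k (ext k M N)
          (ringelForm (cartanMatrix k e)
            (dimVecRight k e M) (dimVecRight k e N))) ∧
    (∀ (M : CochainComplex (ModuleCat.{u} Aᵐᵒᵖ) ℤ) (N : CochainComplex (ModuleCat.{u} A) ℤ),
      IsBoundedFD k M → IsBoundedFD k N →
        Nonempty (ProjRes M) ∧
        ∀ ρ : ProjRes M,
          HasSuperDim k (tor k ρ N)
            (ringelFormOp (cartanMatrix k e)
              (dimVecLeft k e N) (dimVecRight k e M))) ∧
    (∀ M : CochainComplex (ModuleCat.{u} (A ⊗[k] Aᵐᵒᵖ)) ℤ, IsBoundedFD k M →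
      HasSuperDim k (hochschildCohomology k A M)
        (((cartanMatrix k e)⁻¹)ᵀ * dimMatrix k e M).trace) ∧
    (∀ M : CochainComplex (ModuleCat.{u} (A ⊗[k] Aᵐᵒᵖ)) ℤ, IsBoundedFD k M →
      Nonempty (ProjRes (diagRight k A)) ∧
      ∀ ρ : ProjRes (diagRight k A),
        HasSuperDim k (hochschildHomology k ρ M)
          ((cartanMatrix k e)⁻¹ * dimMatrix k e M).trace) := by
  have hfin : Module.Finite k A := hA.1
  have hfin' : Module.Finite k Aᵐᵒᵖ := inferInstance
  have hidem : ∀ i, IsIdempotentElem (e i) := fun i ↦ (he.2 i).1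
  obtain ⟨χ, hχ, hnil⟩ := exists_characters hA he
  have hL : IsCharacterSystem e χ :=
    isCharacterSystem_of_isNilpotent hidem hχ he.1.complete hnil
  have hR := isCharacterSystem_op hidem hχ he.1.complete hnil
  have pdR : ∃ d, ∀ X : ModuleCat.{u} Aᵐᵒᵖ, Module.Finite k X → HasProjectiveDimensionLT X d := by
    obtain ⟨d, hd⟩ := hgl
    exact ⟨d + 1, fun X (_ : Module.Finite k X) ↦ hd X⟩
  have pdL := exists_hasProjectiveDimensionLT_left (k := k) hgl
  have hE := hL.tensor hR
  have pdE := exists_hasProjectiveDimensionLT_tensor hL hR pdL pdR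
  set C := cartanMatrix k e with hCdef
  have hCe : ∀ i j, (Module.finrank k (LinearMap.range (LinearMap.mulLeftRight k (e j, e i))) : ℤ) =
      C i j := fun i j ↦ rfl
  -- The convention c_{ij} = dim(e_j A e_i) makes C the matrix of right modules; that of left
  -- modules is its transpose.
  have hCR : idempotentMatrix k (fun a ↦ op (e a)) = C := Matrix.ext fun b a ↦ by
    rw [← hCe, idempotentMatrix, Matrix.of_apply, finrank_range_mulLeftRight_op]
  have hC : IsUnit C.det := hCR ▸ isUnit_det_idempotentMatrix hR pdR
  have hsolve : ∀ {t x : Fin n → ℤ}, C *ᵥ t = x → t = C⁻¹ *ᵥ x := by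
    rintro t _ rfl
    rw [Matrix.mulVec_mulVec, Matrix.nonsing_inv_mul _ hC, Matrix.one_mulVec]
  refine ⟨hC, fun M N hM hN ↦ ?_, fun M N hM hN ↦ ?_, fun M hM ↦ ?_, fun M hM ↦ ?_⟩
  · obtain ⟨t, ht, h⟩ := exists_hasSuperDim_ext hR pdR hM
    rw [hCR] at ht
    have : ringelForm C (dimVecRight k e M) (dimVecRight k e N) =
        t ⬝ᵥ fun a ↦ superRank k (op (e a)) N := by
      rw [hsolve ht, ringelForm, Matrix.dotProduct_mulVec, Matrix.vecMul_transpose]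
      rfl
    rw [this]
    exact h N hN
  · obtain ⟨hne, t, ht, h⟩ := exists_hasSuperDim_tor hL hR pdR hM
    rw [hCR] at ht
    refine ⟨hne, fun ρ ↦ ?_⟩
    have : ringelFormOp C (dimVecLeft k e N) (dimVecRight k e M) =
        t ⬝ᵥ fun a ↦ superRank k (e a) N := by
      rw [hsolve ht, ringelFormOp, dotProduct_comm]
      rfl
    rw [this]
    exact h N ρ hN
  · obtain ⟨t, ht, h⟩ := exists_hasSuperDim_ext hE pdE (isBoundedFD_diagLeft (k := k) (A := A))
    -- The (b, a) equation of the linear system is ∑ C_{aj} t(i, j) C_{ib} = C_{ab}. It reads C X C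
    -- = C once t is arranged with its indices exchanged.
    let X : Matrix (Fin n) (Fin n) ℤ := Matrix.of fun i j ↦ t (j, i)
    have hX : X = C⁻¹ := by
      refine eq_inv_of_mul_mul_eq hC (Matrix.ext fun a b ↦ ?_)
      have := congrFun ht (b, a)
      rw [superRank_diagLeft (hidem b) (hidem a), hCe] at this
      rw [← this]
      simp only [Matrix.mul_apply, Matrix.mulVec, dotProduct, Fintype.sum_prod_type, Finset.sum_mul]
      refine Finset.sum_congr rfl fun i _ ↦ Finset.sum_congr rfl fun j _ ↦ ?_
      rw [idempotentMatrix, Matrix.of_apply, finrank_range_mulLeftRight_tmul,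
        finrank_range_mulLeftRight_op, Nat.cast_mul, hCe, hCe]
      change C a j * t (i, j) * C i b = _
      ring
    have : ((C⁻¹)ᵀ * dimMatrix k e M).trace =
        t ⬝ᵥ fun p : Fin n × Fin n ↦ superRank k (e p.1 ⊗ₜ[k] op (e p.2)) M := by
      rw [← hX]
      simp only [Matrix.trace, Matrix.diag, Matrix.mul_apply, dotProduct, Fintype.sum_prod_type]
      rfl
    rw [this]
    exact h M hM
  · have hE' : IsCharacterSystem (fun p : Fin n × Fin n ↦ op (e p.1 ⊗ₜ[k] op (e p.2)))
        fun p ↦ charOp (charTensor (χ p.1) (charOp (χ p.2))) := by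
      refine hE.of_algEquiv (envSwap k A) (Equiv.prodComm _ _) (fun p ↦ envSwap_tmul k A _ _)
        fun p t ↦ ?_
      induction t with
      | h t =>
        change charTensor (χ p.1) (charOp (χ p.2)) t = charTensor (χ p.2) (charOp (χ p.1)) _
        induction t using TensorProduct.induction_on with
        | zero => rw [op_zero, map_zero, map_zero, map_zero]
        | add x y hx hy => rw [MulOpposite.op_add, map_add, map_add, map_add, hx, hy]
        | tmul x y =>
          induction y with
          | h y =>
            rw [envSwap_tmul, charTensor_tmul, charTensor_tmul]
            exact mul_comm _ _
    obtain ⟨hne, t, ht, h⟩ := exists_hasSuperDim_tor hE hE'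
      (exists_hasProjectiveDimensionLT_of_algEquiv (envSwap k A) pdE)
      (isBoundedFD_diagRight (k := k) (A := A))
    refine ⟨hne, fun ρ ↦ ?_⟩
    -- Over the opposite enveloping algebra the equation is ∑ C_{bi} t(i, j) C_{ja} = C_{ba}, so no
    -- exchange of indices occurs and C⁻¹ appears untransposed in the trace.
    let X : Matrix (Fin n) (Fin n) ℤ := Matrix.of fun i j ↦ t (i, j)
    have hX : X = C⁻¹ := by
      refine eq_inv_of_mul_mul_eq hC (Matrix.ext fun b a ↦ ?_)
      have := congrFun ht (b, a)
      rw [superRank_diagRight (hidem b) (hidem a), hCe] at this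
      rw [← this]
      simp only [Matrix.mul_apply, Matrix.mulVec, dotProduct, Fintype.sum_prod_type, Finset.sum_mul]
      rw [Finset.sum_comm]
      refine Finset.sum_congr rfl fun i _ ↦ Finset.sum_congr rfl fun j _ ↦ ?_
      rw [idempotentMatrix, Matrix.of_apply, finrank_range_mulLeftRight_op,
        finrank_range_mulLeftRight_tmul, finrank_range_mulLeftRight_op, Nat.cast_mul, hCe, hCe]
      change C b i * t (i, j) * C j a = _
      ring
    have : (C⁻¹ * dimMatrix k e M).trace =
        t ⬝ᵥ fun p : Fin n × Fin n ↦ superRank k (e p.1 ⊗ₜ[k] op (e p.2)) M := by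
      rw [← hX]
      simp only [Matrix.trace, Matrix.diag, Matrix.mul_apply, dotProduct, Fintype.sum_prod_type]
      rfl
    rw [this]
    exact h M ρ hM

end Main

end HRR

theorem theorem3 {k : Type u} [Field k] {A : Type u} [Ring A] [Algebra k A]
    (hA : HRR.IsElementary k A) (hgl : HRR.HasFiniteGlobalDimension A)
    {n : ℕ} (e : Fin n → A) (he : HRR.IsCompletePrimitive e) :
    IsUnit (HRR.cartanMatrix k e).det ∧
    (∀ M N : CochainComplex (ModuleCat.{u} Aᵐᵒᵖ) ℤ,
      HRR.IsBoundedFD k M → HRR.IsBoundedFD k N →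
        HRR.HasSuperDim k (HRR.ext k M N)
          (HRR.ringelForm (HRR.cartanMatrix k e)
            (HRR.dimVecRight k e M) (HRR.dimVecRight k e N))) ∧
    (∀ (M : CochainComplex (ModuleCat.{u} Aᵐᵒᵖ) ℤ) (N : CochainComplex (ModuleCat.{u} A) ℤ),
      HRR.IsBoundedFD k M → HRR.IsBoundedFD k N →
        Nonempty (HRR.ProjRes M) ∧
        ∀ ρ : HRR.ProjRes M,
          HRR.HasSuperDim k (HRR.tor k ρ N)
            (HRR.ringelFormOp (HRR.cartanMatrix k e)
              (HRR.dimVecLeft k e N) (HRR.dimVecRight k e M))) ∧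
    (∀ M : CochainComplex (ModuleCat.{u} (A ⊗[k] Aᵐᵒᵖ)) ℤ, HRR.IsBoundedFD k M →
      HRR.HasSuperDim k (HRR.hochschildCohomology k A M)
        (((HRR.cartanMatrix k e)⁻¹)ᵀ * HRR.dimMatrix k e M).trace) ∧
    (∀ M : CochainComplex (ModuleCat.{u} (A ⊗[k] Aᵐᵒᵖ)) ℤ, HRR.IsBoundedFD k M →
      Nonempty (HRR.ProjRes (HRR.diagRight k A)) ∧
      ∀ ρ : HRR.ProjRes (HRR.diagRight k A),
        HRR.HasSuperDim k (HRR.hochschildHomology k ρ M)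
          ((HRR.cartanMatrix k e)⁻¹ * HRR.dimMatrix k e M).trace) :=
  HRR.hirzebruchRiemannRoch hA hgl e he
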